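/- Let $S$ be a finite set and let $\mathcal D_1$ be an arbitrary Coxeter diagram with vertex set $S\sqcup\{\sigma_1\}$. For $n\ge 1$ let $\mathcal D_n$ be the Coxeter diagram with vertex set $S\sqcup\{\sigma_1,\dots,\sigma_n\}$ obtained from $\mathcal D_1$ by attaching a tail $\sigma_1 - \sigma_2 - \cdots - \sigma_n$ of type $\mathbf A$ at $\sigma_1$: that is, $m(\sigma_i,\sigma_{i+1})=3$, $m(\sigma_i,\sigma_j)=2$ for $|i-j|\ge 2$, and $m(s,\sigma_j)=2$ for $s\in S$, $j\ge 2$. Let $\mathcal D_0$ be $\mathcal D_1$ with the vertex $\sigma_1$ removed. Let $A_n^+$ be the Artin monoid of $\mathcal D_n$, i.e. the monoid with generators the vertices of $\mathcal D_n$ and relations $sts\cdots = tst\cdots$ ($m(s,t)$ letters on both sides) whenever $m(s,t)\neq\infty$. For $q\le n$ regard $A_q^+$ as the submonoid of $A_n^+$ generated by $S\cup\{\sigma_1,\dots,\sigma_q\}$. Let $\approx$ (with respect to $A_q^+$) be the transitive closure of the relation on $A_n^+$ $$\alpha_1\sim\alpha_2\iff \alpha_1\beta_1=\alpha_2\beta_2\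 \text{ for some }\beta_1,\beta_2\in A_q^+,$$ and write $[\alpha]_q$ for the class of $\alpha$. Let $\mathcal C^n_\bullet$ be the semi-simplicial set with $\mathcal C^n_p=\{[\alpha]_{n-p-1} : \alpha\in A_n^+\}$ for $0\le p\le n-1$, with no $p$-simplices for $p\ge n$, and with face maps, for $1\le p\le n-1$ and $0\le k\le p$, $$\partial^p_k:\mathcal C^n_p\to\mathcal C^n_{p-1},\qquad [\alpha]_{n-p-1}\mapsto[\alpha\,\sigma_{n-p+k}\sigma_{n-p+k-1}\cdots\sigma_{n-p+1}]_{n-p}$$ (the product is empty for $k=0$). Theorem. For every $n\ge 0$ the geometric realisation $\|\mathcal C^n_\bullet\|$ is $(n-2)$-connected: it is non-empty if $n\ge 1$, and $\pi_i(\|\mathcal C^n_\bullet\|,x)$ is trivial for every base point $x$ and all $0\le i\le n-2$. -/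

import Mathlib

/-! ### Semi-simplicial sets, their geometric realisation, and connectivity -/

/-- A semi-simplicial set, given by its levels and by face maps
`∂ᵢ : X (p + 1) → X p`, `0 ≤ i ≤ p + 1`, that satisfy `∂ᵢ ∂ⱼ = ∂ⱼ₋₁ ∂ᵢ` for `i < j`
(written below with `j + 1` in place of `j`). -/
structure SemiSimplicialSet where
  obj : ℕ → Type*
  face : (p : ℕ) → Fin (p + 2) → obj (p + 1) → obj p
  face_face : ∀ (p : ℕ) (i j : Fin (p + 2)), i ≤ j → ∀ x : obj (p + 2),
    face p i (face (p + 1) j.succ x) = face p j (face (p + 1) i.castSucc x)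

namespace SemiSimplicialSet

/-- The space `∐ₚ Xₚ × |Δᵖ|` with `Xₚ` discrete, that is, the topological sum of one copy of the
standard `p`-simplex for every `p`-simplex of `X`. -/
abbrev Cells (X : SemiSimplicialSet) : Type _ :=
  Σ x : (Σ p : ℕ, X.obj p), stdSimplex ℝ (Fin (x.1 + 1))

/-- The gluing relation `(x, Dⁱ u) ∼ (∂ᵢ x, u)`, where `Dⁱ` is the inclusion of the `i`-th facet
of the standard simplex. -/
inductive Glue (X : SemiSimplicialSet) : X.Cells → X.Cells → Prop
  | mk (p : ℕ) (i : Fin (p + 2)) (x : X.obj (p + 1)) (u : stdSimplex ℝ (Fin (p + 1))) :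
      Glue X ⟨⟨p + 1, x⟩, stdSimplex.map i.succAbove u⟩ ⟨⟨p, X.face p i x⟩, u⟩

/-- The geometric realisation `‖X‖`: the quotient of `X.Cells` by the equivalence relation
generated by `Glue`. -/
def Realisation (X : SemiSimplicialSet) : Type _ := Quot X.Glue

/-- The quotient topology. -/
instance (X : SemiSimplicialSet) : TopologicalSpace X.Realisation :=
  inferInstanceAs (TopologicalSpace (Quot X.Glue))

end SemiSimplicialSet

/-- A space is `k`-connected if it is non-empty (when `k ≥ -1`) and `πᵢ` vanishes at every base
point for all `0 ≤ i ≤ k`; here `π₀` is the set of path components. -/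
def IsKConnected (k : ℤ) (X : Type*) [TopologicalSpace X] : Prop :=
  (-1 ≤ k → Nonempty X) ∧
    ∀ i : ℕ, (i : ℤ) ≤ k → ∀ x : X, Subsingleton (HomotopyGroup.Pi i X x)

/-! ### Artin monoids -/

/-- The alternating word `abab…` of length `k` that starts with `a`. -/
def altWord {B : Type*} (a b : B) : ℕ → FreeMonoid B
  | 0 => 1
  | k + 1 => FreeMonoid.of a * altWord b a k

/-- The Artin relations `sts… = tst…` (`m(s,t)` letters on both sides). As always for
`CoxeterMatrix`, the entry `0` stands for `m(s,t) = ∞`, where there is no relation. -/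
inductive ArtinRel {B : Type*} (M : CoxeterMatrix B) : FreeMonoid B → FreeMonoid B → Prop
  | mk (s t : B) (h : M s t ≠ 0) : ArtinRel M (altWord s t (M s t)) (altWord t s (M s t))

/-- The Artin monoid of a Coxeter matrix. -/
abbrev ArtinMonoid {B : Type*} (M : CoxeterMatrix B) : Type _ := PresentedMonoid (ArtinRel M)

namespace ArtinMonoid

/-- The generator of the Artin monoid that belongs to `s`. -/
def gen {B : Type*} (M : CoxeterMatrix B) (s : B) : ArtinMonoid M :=
  PresentedMonoid.of (ArtinRel M) s

theorem altWord_eq {B : Type*} (M : CoxeterMatrix B) (s t : B) (h : M s t ≠ 0) :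
    PresentedMonoid.mk (ArtinRel M) (altWord s t (M s t)) =
      PresentedMonoid.mk (ArtinRel M) (altWord t s (M s t)) :=
  Quotient.sound (ConGen.Rel.of _ _ (ArtinRel.mk s t h))

theorem gen_comm {B : Type*} (M : CoxeterMatrix B) (s t : B) (h : M s t = 2) :
    gen M s * gen M t = gen M t * gen M s := by
  have := altWord_eq M s t (by omega)
  rw [h] at this
  simpa [altWord, gen, PresentedMonoid.of] using this

theorem gen_braid {B : Type*} (M : CoxeterMatrix B) (s t : B) (h : M s t = 3) :
    gen M s * gen M t * gen M s = gen M t * gen M s * gen M t := by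
  have := altWord_eq M s t (by omega)
  rw [h] at this
  simpa [altWord, gen, PresentedMonoid.of, mul_assoc] using this

end ArtinMonoid

/-! ### Cosets of a submonoid -/

/-- `α₁ ∼ α₂` if `α₁ β₁ = α₂ β₂` for some `β₁, β₂` in the submonoid `N`. -/
def CosetRel {A : Type*} [Monoid A] (N : Submonoid A) (a₁ a₂ : A) : Prop :=
  ∃ b₁ ∈ N, ∃ b₂ ∈ N, a₁ * b₁ = a₂ * b₂

/-- The equivalence relation `≈`: the transitive closure of `∼`. -/
def cosetSetoid {A : Type*} [Monoid A] (N : Submonoid A) : Setoid A where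
  r := Relation.TransGen (CosetRel N)
  iseqv :=
    { refl := fun _ => .single ⟨1, N.one_mem, 1, N.one_mem, rfl⟩
      symm := fun h => by
        induction h with
        | single h =>
          obtain ⟨b₁, h₁, b₂, h₂, e⟩ := h
          exact .single ⟨b₂, h₂, b₁, h₁, e.symm⟩
        | tail _ h ih =>
          obtain ⟨b₁, h₁, b₂, h₂, e⟩ := h
          exact .head ⟨b₂, h₂, b₁, h₁, e.symm⟩ ih
      trans := fun h h' => h.trans h' }

/-- Right multiplication by an element that commutes with `N` respects `≈`. -/
theorem cosetSetoid_mul_right {A : Type*} [Monoid A] {N N' : Submonoid A} (hN : N ≤ N') (w : A)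
    (hw : ∀ b ∈ N, b * w = w * b) {a₁ a₂ : A} (h : cosetSetoid N a₁ a₂) :
    cosetSetoid N' (a₁ * w) (a₂ * w) := by
  refine Relation.TransGen.lift (r := CosetRel N) (p := CosetRel N') (· * w) ?_ a₁ a₂ h
  rintro x y ⟨b₁, h₁, b₂, h₂, e⟩
  refine ⟨b₁, hN h₁, b₂, hN h₂, ?_⟩
  rw [mul_assoc, mul_assoc, ← hw _ h₁, ← hw _ h₂, ← mul_assoc, ← mul_assoc, e]

/-! ### The sequence of Artin monoids `A⁺₀ → A⁺₁ → A⁺₂ → ⋯`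

The starting datum is a Coxeter matrix `M` on `Option S`: the element `none` is the vertex `σ₁`
and `S` is the set of all other vertices of the diagram of `A₁`. -/

/-- The generators of `A⁺ₙ`: the elements of `S` together with `σ₁, …, σₙ`. -/
abbrev Gen (S : Type*) (n : ℕ) : Type _ := S ⊕ Set.Icc 1 n

/-- The matrix entries for the diagram of `Aₙ`, obtained from that of `A₁` by attaching the tail
`σ₁ — σ₂ — ⋯ — σₙ` of type `A` at the vertex `σ₁`. -/
def towerEntry {S : Type*} (M : CoxeterMatrix (Option S)) (n : ℕ) : Gen S n → Gen S n → ℕ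
  | .inl s, .inl t => M (some s) (some t)
  | .inl s, .inr j => if j.1 = 1 then M (some s) none else 2
  | .inr i, .inl t => if i.1 = 1 then M none (some t) else 2
  | .inr i, .inr j => if i.1 = j.1 then 1 else if i.1 = j.1 + 1 ∨ j.1 = i.1 + 1 then 3 else 2

/-- The Coxeter matrix of `Aₙ`. -/
def towerMatrix {S : Type*} (M : CoxeterMatrix (Option S)) (n : ℕ) : CoxeterMatrix (Gen S n) where
  M := towerEntry M n
  isSymm := by
    ext x y
    change towerEntry M n y x = towerEntry M n x y
    rcases x with s | i <;> rcases y with t | j <;> simp only [towerEntry]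
    · exact M.symmetric _ _
    · rw [M.symmetric none]
    · rw [M.symmetric none]
    · grind
  diagonal x := by
    rcases x with s | i
    · exact M.diagonal _
    · simp [towerEntry]
  off_diagonal x y h := by
    rcases x with s | i <;> rcases y with t | j <;> simp only [towerEntry]
    · exact M.off_diagonal _ _ (by simpa using h)
    · split_ifs
      · exact M.off_diagonal _ _ (by simp)
      · decide
    · split_ifs
      · exact M.off_diagonal _ _ (by simp)
      · decide
    · have : i.1 ≠ j.1 := fun e => h (by rw [Subtype.ext e])
      rw [if_neg this]
      split_ifs <;> decide

theorem towerMatrix_apply {S : Type*} (M : CoxeterMatrix (Option S)) (n : ℕ) (x y : Gen S n) :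
    (towerMatrix M n).M x y = towerEntry M n x y := rfl

/-- The Artin monoid `A⁺ₙ`. -/
abbrev TowerMonoid {S : Type*} (M : CoxeterMatrix (Option S)) (n : ℕ) : Type _ :=
  ArtinMonoid (towerMatrix M n)

namespace TowerMonoid

variable {S : Type*} (M : CoxeterMatrix (Option S)) (n : ℕ)

/-- The generator `σⱼ` of `A⁺ₙ` for `1 ≤ j ≤ n` (and `1` for all other `j`, which is never
used). -/
def sigma (j : ℕ) : TowerMonoid M n :=
  if h : j ∈ Set.Icc 1 n then ArtinMonoid.gen (towerMatrix M n) (.inr ⟨j, h⟩) else 1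

/-- The submonoid `A⁺_q` of `A⁺ₙ` (for `q ≤ n`): it is generated by `S` and `σ₁, …, σ_q`. -/
def parabolic (q : ℕ) : Submonoid (TowerMonoid M n) :=
  Submonoid.closure
    {a | (∃ s : S, a = ArtinMonoid.gen (towerMatrix M n) (.inl s)) ∨
      ∃ j : Set.Icc 1 n, j.1 ≤ q ∧ a = ArtinMonoid.gen (towerMatrix M n) (.inr j)}

/-- The product `σ_{r+k} σ_{r+k-1} ⋯ σ_{r+1}` of `k` generators. -/
def descend (r : ℕ) : ℕ → TowerMonoid M n
  | 0 => 1
  | k + 1 => sigma M n (r + k + 1) * descend r k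

theorem parabolic_mono {q q' : ℕ} (h : q ≤ q') : parabolic M n q ≤ parabolic M n q' := by
  apply Submonoid.closure_mono
  rintro a (ha | ⟨j, hj, ha⟩)
  · exact Or.inl ha
  · exact Or.inr ⟨j, hj.trans h, ha⟩

theorem sigma_mem_parabolic {j q : ℕ} (h : j ≤ q) : sigma M n j ∈ parabolic M n q := by
  unfold sigma
  split_ifs with hj
  · exact Submonoid.subset_closure (Or.inr ⟨⟨j, hj⟩, h, rfl⟩)
  · exact Submonoid.one_mem _

theorem sigma_comm {i j : ℕ} (h : i + 2 ≤ j) :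
    sigma M n i * sigma M n j = sigma M n j * sigma M n i := by
  unfold sigma
  split_ifs with hi hj
  · apply ArtinMonoid.gen_comm
    rw [towerMatrix_apply]
    simp only [towerEntry]
    rw [if_neg (by omega), if_neg (by omega)]
  all_goals simp

theorem sigma_braid {i : ℕ} (h1 : 1 ≤ i) (h2 : i + 1 ≤ n) :
    sigma M n (i + 1) * sigma M n i * sigma M n (i + 1) =
      sigma M n i * sigma M n (i + 1) * sigma M n i := by
  unfold sigma
  rw [dif_pos (show i ∈ Set.Icc 1 n from ⟨h1, by omega⟩),
    dif_pos (show i + 1 ∈ Set.Icc 1 n from ⟨by omega, h2⟩)]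
  apply ArtinMonoid.gen_braid
  rw [towerMatrix_apply]
  simp [towerEntry]

theorem parabolic_comm_sigma {q j : ℕ} (h : q + 2 ≤ j) :
    ∀ b ∈ parabolic M n q, b * sigma M n j = sigma M n j * b := by
  intro b hb
  induction hb using Submonoid.closure_induction with
  | one => simp
  | mul x y _ _ hx hy => rw [mul_assoc, hy, ← mul_assoc, hx, mul_assoc]
  | mem x hx =>
    rcases hx with ⟨s, rfl⟩ | ⟨i, hi, rfl⟩
    · unfold sigma
      split_ifs with hj
      · apply ArtinMonoid.gen_comm
        rw [towerMatrix_apply]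
        simp only [towerEntry]
        rw [if_neg (by omega)]
      · simp
    · have := sigma_comm M n (i := i.1) (j := j) (by omega)
      rwa [sigma, dif_pos i.2] at this

theorem parabolic_comm_descend {q r : ℕ} (h : q + 1 ≤ r) (k : ℕ) :
    ∀ b ∈ parabolic M n q, b * descend M n r k = descend M n r k * b := by
  intro b hb
  induction k with
  | zero => simp [descend]
  | succ k ih =>
    rw [descend, ← mul_assoc, parabolic_comm_sigma M n (by omega) b hb, mul_assoc, ih, mul_assoc]

theorem descend_comm_sigma {r k j : ℕ} (h : r + k + 2 ≤ j) :
    descend M n r k * sigma M n j = sigma M n j * descend M n r k := by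
  induction k with
  | zero => simp [descend]
  | succ k ih =>
    rw [descend, mul_assoc, ih (by omega), ← mul_assoc, sigma_comm M n (by omega), mul_assoc]

theorem descend_sigma {r k t : ℕ} (ht : 1 ≤ t) (htk : t < k) (hk : r + k ≤ n) :
    descend M n r k * sigma M n (r + t + 1) = sigma M n (r + t) * descend M n r k := by
  induction k with
  | zero => omega
  | succ k ih =>
    rcases Nat.lt_or_ge t k with h | h
    · rw [descend, mul_assoc, ih h (by omega), ← mul_assoc, ← sigma_comm M n (by omega), mul_assoc]
    · obtain rfl : t = k := by omega
      obtain ⟨k, rfl⟩ : ∃ k, t = k + 1 := ⟨t - 1, by omega⟩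
      have hb := sigma_braid M n (i := r + (k + 1)) (by omega) (by omega)
      simp only [descend, mul_assoc] at hb ⊢
      rw [descend_comm_sigma M n (by omega)]
      simp only [← mul_assoc] at hb ⊢
      simpa [← add_assoc] using congrArg (· * descend M n r k) hb

theorem descend_succ_eq (r k : ℕ) :
    descend M n r (k + 1) = descend M n (r + 1) k * sigma M n (r + 1) := by
  induction k with
  | zero => simp [descend]
  | succ k ih =>
    rw [descend, ih, ← mul_assoc, descend]
    congr 3
    omega

theorem descend_descend {r i j : ℕ} (hij : i ≤ j) (hj : r + j + 1 ≤ n) :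
    descend M n r (j + 1) * descend M n (r + 1) i =
      descend M n r i * descend M n (r + 1) j * sigma M n (r + 1) := by
  induction i with
  | zero => rw [descend_succ_eq M n r j]; simp [descend]
  | succ i ih =>
    have h := descend_sigma M n (r := r) (k := j + 1) (t := i + 1) (by omega) (by omega) (by omega)
    rw [descend.eq_def M n (r + 1) (i + 1)]
    dsimp only
    rw [← mul_assoc, show r + 1 + i + 1 = r + (i + 1) + 1 by omega, h, mul_assoc,
      ih (by omega), descend.eq_def M n r (i + 1)]
    simp only [mul_assoc, add_assoc]

end TowerMonoid

open TowerMonoid in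
/-- The semi-simplicial set `Cⁿ`. For `0 ≤ p ≤ n - 1` its `p`-simplices are the classes
`[α]_{n-p-1}` of `A⁺ₙ` under `≈` with respect to `A⁺_{n-p-1}`; there are none for `p ≥ n`.
The face map `∂ₖ` on `p`-simplices (`p + 1`-simplices below) sends `[α]_{n-p-1}` to
`[α σ_{n-p+k} ⋯ σ_{n-p+1}]_{n-p}`. -/
def cosetComplex {S : Type*} (M : CoxeterMatrix (Option S)) (n : ℕ) : SemiSimplicialSet where
  obj p := {_c : Quotient (cosetSetoid (parabolic M n (n - p - 1))) // p < n}
  face p k x :=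
    ⟨Quotient.map' (s₁ := cosetSetoid (parabolic M n (n - (p + 1) - 1)))
      (s₂ := cosetSetoid (parabolic M n (n - p - 1)))
      (fun α => α * descend M n (n - (p + 1)) k)
      (fun _ _ h => cosetSetoid_mul_right (parabolic_mono M n (by omega)) _
        (parabolic_comm_descend M n (by have := x.2; omega) _) h) x.1,
      by have := x.2; omega⟩
  face_face p i j hij x := by
    obtain ⟨c, hp⟩ := x
    induction c using Quotient.inductionOn' with
    | h α =>
      apply Subtype.ext
      apply Quotient.sound'
      have h := descend_descend M n (r := n - (p + 2)) (i := i) (j := j) hij (by omega)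
      refine Relation.TransGen.single ⟨1, Submonoid.one_mem _, sigma M n (n - (p + 2) + 1),
        sigma_mem_parabolic M n (by omega), ?_⟩
      simp only [Fin.val_succ, Fin.val_castSucc, mul_one, mul_assoc] at h ⊢
      rw [show n - (p + 1) = n - (p + 2) + 1 by omega]
      exact congrArg (α * ·) h

/-! The complex is built from its simplices of dimension `n - 1`, attached in order of length. They
are the classes `[g]₀`, and each has exactly one representative `g` that does not end with a
generator in `S`. Facet number `c` of `[g]₀` is `[g σ_c ⋯ σ₂]₁`. If `g` ends with `σ_{c+1}` or with
`σ_c ⋯ σ₁`, this is also a facet of a simplex with a shorter representative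
(`exists_shorter_facet`); otherwise the facet is called free. Only `g = 1` has all its facets free
(`eq_one_of_isFree`). A point has only one description as a point of a simplex `[g]₀` that lies on
no non-free facet (`eq_of_cell_eq`). So every simplex except the first is glued to the earlier ones
exactly along a non-empty union of facets.

If some facet of a new simplex is free, the simplex can be pushed back onto the facets along which
it is glued. If none is free, a map from the boundary of an `(i + 1)`-cube with `i ≤ n - 2` can be
perturbed off the barycentre and then pushed to the boundary of the simplex. A compact set meets
only finitely many stages, so such a map is homotopic into the first simplex and hence
null-homotopic (`Shelling.nullhomotopic`). This kills `πᵢ`.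

Uniqueness of the description rests on algebra. The point's normal form lies in an iterated face
along free facets, represented by `g` times a product of descending chains. This product is the
shortest representative of its class (`noEnd_mul_chain`), and it determines both `g` and the facets
(`mul_chain_inj`). These facts, and the uniqueness of shortest representatives, follow from right
cancellation and the reduction lemma: an element of an Artin monoid that ends with two different
generators ends with their least common multiple (`reductionAt`).

For the reduction lemma, two factorisations of one element are joined by braid moves that change the
last letter, and the issue is transitivity for three letters. An auxiliary reduced element brings
this into the Coxeter group. There, right descents are governed by the signs of roots in the
geometric representation, and Matsumoto's theorem carries the answer back to the monoid. -/

/-! ### The geometric representation of a Coxeter group -/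

namespace CoxeterMatrix

variable {B : Type*} (M : CoxeterMatrix B)

/-- The Cartan vector of `s`: its `r`-th entry is `-2 cos (π / m(s,r))`. -/
noncomputable def cartanVec (s : B) : B → ℝ := fun r => -2 * Real.cos (Real.pi / M s r)

theorem cartanVec_self (s : B) : M.cartanVec s s = 2 := by
  simp [cartanVec]

theorem cartanVec_symm (s t : B) : M.cartanVec s t = M.cartanVec t s := by
  simp only [cartanVec, M.symmetric s t]

/-- The dual geometric reflection `f ↦ f - f(s) a_s` on functions on the set of generators. -/
noncomputable def dualReflection (s : B) : Module.End ℝ (B → ℝ) where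
  toFun f := f - f s • M.cartanVec s
  map_add' f g := by simp only [Pi.add_apply, add_smul]; abel
  map_smul' c f := by simp [smul_sub, smul_smul]

theorem dualReflection_apply (s : B) (f : B → ℝ) :
    M.dualReflection s f = f - f s • M.cartanVec s := rfl

theorem dualReflection_mul_self (s : B) : M.dualReflection s * M.dualReflection s = 1 := by
  ext1 f
  simp only [Module.End.mul_apply, dualReflection_apply, Pi.sub_apply, Pi.smul_apply,
    cartanVec_self, smul_eq_mul, Module.End.one_apply]
  module

/-- This is Cayley–Hamilton on the span of the two Cartan vectors, with determinant `1` and trace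
`cartanVec s t ^ 2 - 2 = 2 cos (2π / m)`: the product of the reflections behaves like a rotation by
`2π / m`. -/
theorem dualReflection_quadratic (s t : B) (x y : ℝ) :
    let T := M.dualReflection s * M.dualReflection t
    let p := x • M.cartanVec s + y • M.cartanVec t
    T (T p) = (M.cartanVec s t ^ 2 - 2) • T p - p := by
  intro T p
  simp only [T, p, Module.End.mul_apply, dualReflection_apply, Pi.sub_apply, Pi.smul_apply,
    Pi.add_apply, cartanVec_self, smul_eq_mul, M.cartanVec_symm t s]
  module

/-- The recursion is that of a rotation by `θ`, so `T ^ m` fixes `p` and the orbit sum is fixed by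
`T`. A fixed vector that obeys the recursion is annihilated by `2 - 2 cos θ`, which is non-zero
because `sin θ` is. -/
theorem sum_pow_eq_zero_of_quadratic {V : Type*} [AddCommGroup V] [Module ℝ V]
    (T : Module.End ℝ V) (p : V) (θ : ℝ) (m : ℕ) (hθ : Real.sin θ ≠ 0)
    (hm : m * θ = 2 * Real.pi)
    (h : ∀ k : ℕ, (T ^ (k + 2)) p = (2 * Real.cos θ) • (T ^ (k + 1)) p - (T ^ k) p) :
    ∑ k ∈ Finset.range m, (T ^ k) p = 0 := by
  have key : ∀ k : ℕ, Real.sin θ • (T ^ k) p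
      = Real.sin (k * θ) • T p - Real.sin (k * θ - θ) • p := by
    intro k
    induction k using Nat.twoStepInduction with
    | zero => simp
    | one => simp
    | more k h1 h2 =>
      have e : ∀ x : ℝ, Real.sin (x + θ) = 2 * Real.cos θ * Real.sin x - Real.sin (x - θ) := by
        intro x; rw [Real.sin_add, Real.sin_sub]; ring
      have e1 := e ((k + 1 : ℕ) * θ)
      have e2 := e ((k + 1 : ℕ) * θ - θ)
      rw [show ((k + 1 : ℕ) : ℝ) * θ + θ = (k + 2 : ℕ) * θ by push_cast; ring,
        show ((k + 1 : ℕ) : ℝ) * θ - θ = k * θ by push_cast; ring] at e1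
      rw [show ((k + 1 : ℕ) : ℝ) * θ - θ + θ = (k + 2 : ℕ) * θ - θ by push_cast; ring,
        show ((k + 1 : ℕ) : ℝ) * θ - θ - θ = k * θ - θ by push_cast; ring] at e2
      rw [h, smul_sub, smul_comm, h1, h2, e1, e2]
      module
  have hp : (T ^ m) p = p := by
    have := key m
    rw [hm, Real.sin_two_pi, Real.sin_two_pi_sub, zero_smul, zero_sub, neg_smul, neg_neg] at this
    exact smul_right_injective _ hθ this
  set S := ∑ k ∈ Finset.range m, (T ^ k) p with hS
  have h1 : T S = S := by
    have e : T S = ∑ k ∈ Finset.range m, (T ^ (k + 1)) p := by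
      rw [hS, map_sum]
      exact Finset.sum_congr rfl fun k _ => by rw [pow_succ']; rfl
    have := Finset.sum_range_succ' (fun k => (T ^ k) p) m
    rw [Finset.sum_range_succ, hp, ← e, ← hS] at this
    simpa using this.symm
  have h2 : T (T S) = (2 * Real.cos θ) • T S - S := by
    rw [hS]
    simp only [map_sum, Finset.smul_sum]
    rw [← Finset.sum_sub_distrib]
    refine Finset.sum_congr rfl fun k _ => ?_
    have := h k
    rw [pow_succ', pow_succ'] at this
    simpa [Module.End.mul_apply] using this
  rw [h1, h1] at h2
  have h3 : (2 - 2 * Real.cos θ) • S = 0 := by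
    rw [eq_sub_iff_add_eq] at h2
    rw [sub_smul, two_smul, h2, sub_self]
  rcases smul_eq_zero.1 h3 with h4 | h4
  · exfalso
    have : Real.cos θ = 1 := by linarith
    apply hθ
    have := Real.sin_sq_add_cos_sq θ
    nlinarith
  · exact h4

theorem isLiftable_dualReflection : M.IsLiftable M.dualReflection := by
  intro s t
  rcases eq_or_ne s t with rfl | hst
  · simp [dualReflection_mul_self]
  set m := M s t with hm
  rcases Nat.eq_zero_or_pos m with h0 | hpos
  · simp [h0]
  have h1 : m ≠ 1 := M.off_diagonal s t hst
  set T := M.dualReflection s * M.dualReflection t with hT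
  have main : ∀ x y : ℝ,
      ∑ k ∈ Finset.range m, (T ^ k) (x • M.cartanVec s + y • M.cartanVec t) = 0 := by
    intro x y
    -- For `m = 2` the angle is `π` and its sine vanishes, so the rotation lemma does not apply;
    -- here `T` is `-1` on the span.
    rcases eq_or_ne m 2 with h2 | h2
    · rw [h2]
      have hc : M.cartanVec s t = 0 := by simp [cartanVec, ← hm, h2]
      have hc' : M.cartanVec t s = 0 := by rw [cartanVec_symm, hc]
      simp only [Finset.sum_range_succ, Finset.range_zero, Finset.sum_empty, pow_zero, pow_one,
        Module.End.one_apply, hT, Module.End.mul_apply, dualReflection_apply, Pi.sub_apply,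
        Pi.smul_apply, Pi.add_apply, cartanVec_self, smul_eq_mul, hc, hc']
      module
    · have hm3 : (3 : ℝ) ≤ m := by exact_mod_cast (by omega : 3 ≤ m)
      apply sum_pow_eq_zero_of_quadratic T _ (2 * (Real.pi / m)) m
      · apply ne_of_gt
        apply Real.sin_pos_of_pos_of_lt_pi
        · positivity
        · rw [← mul_div_assoc, div_lt_iff₀ (by positivity)]
          nlinarith [Real.pi_pos]
      · field_simp
      · intro k
        have h := M.dualReflection_quadratic s t x y
        simp only [← hT] at h
        have hc : M.cartanVec s t ^ 2 - 2 = 2 * Real.cos (2 * (Real.pi / m)) := by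
          rw [Real.cos_two_mul, cartanVec, ← hm]; ring
        rw [hc] at h
        have := congrArg (T ^ k) h
        rw [map_sub, map_smul] at this
        rw [pow_add, pow_add, pow_one, sq]
        exact this
  ext1 f
  -- Telescoping reduces `T ^ m = 1` to the span of the two Cartan vectors, since `T f - f` lies
  -- there.
  have tel : ∀ k : ℕ, (T ^ k) f = f + ∑ j ∈ Finset.range k, (T ^ j) (T f - f) := by
    intro k
    induction k with
    | zero => simp
    | succ k ih =>
      rw [Finset.sum_range_succ, ← add_assoc, ← ih, map_sub, pow_succ]
      simp [Module.End.mul_apply]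
  have hq : T f - f = (-(f s - f t * M.cartanVec t s)) • M.cartanVec s
      + (- f t) • M.cartanVec t := by
    simp only [hT, Module.End.mul_apply, dualReflection_apply, Pi.sub_apply,
        Pi.smul_apply, smul_eq_mul]
    module
  rw [tel, hq, main, add_zero, Module.End.one_apply]

/-- The dual geometric representation. -/
noncomputable def dualRep : M.Group →* Module.End ℝ (B → ℝ) :=
  M.toCoxeterSystem.lift ⟨M.dualReflection, M.isLiftable_dualReflection⟩

theorem dualRep_simple (s : B) : M.dualRep (M.toCoxeterSystem.simple s) = M.dualReflection s :=
  M.toCoxeterSystem.lift_apply_simple M.isLiftable_dualReflection s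

/-- The root `w α_s` is positive, expressed by pairing with all dominant functions. -/
def PosRoot (w : M.Group) (s : B) : Prop := ∀ f : B → ℝ, 0 ≤ f → 0 ≤ M.dualRep w⁻¹ f s

theorem dualRep_inv_mul_simple (w : M.Group) (s : B) (f : B → ℝ) :
    M.dualRep (w * M.toCoxeterSystem.simple s)⁻¹ f = M.dualReflection s (M.dualRep w⁻¹ f) := by
  rw [mul_inv_rev, map_mul, CoxeterSystem.inv_simple, dualRep_simple]; rfl

/-- Multiplication by `s` changes the sign of the functional `f ↦ (w⁻¹ f)(s)`. If both signs were
non-negative, the functional would vanish on non-negative functions and hence on all differences of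
such, but it takes the value `1` at `w · 1`. -/
theorem not_posRoot_mul_simple {w : M.Group} {s : B} (h : M.PosRoot w s) :
    ¬ M.PosRoot (w * M.toCoxeterSystem.simple s) s := by
  intro h'
  have hz : ∀ f : B → ℝ, 0 ≤ f → M.dualRep w⁻¹ f s = 0 := by
    intro f hf
    have h1 := h f hf
    have h2 := h' f hf
    rw [dualRep_inv_mul_simple, dualReflection_apply] at h2
    simp only [Pi.sub_apply, Pi.smul_apply, cartanVec_self, smul_eq_mul] at h2
    linarith
  have hz' : ∀ f : B → ℝ, M.dualRep w⁻¹ f s = 0 := by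
    intro f
    have e : f = f⁺ - f⁻ := (posPart_sub_negPart f).symm
    rw [e, map_sub, Pi.sub_apply, hz _ (posPart_nonneg f), hz _ (negPart_nonneg f), sub_zero]
  have := hz' (M.dualRep w (fun _ => 1))
  rw [← Module.End.mul_apply, ← map_mul, inv_mul_cancel, map_one] at this
  simp at this

/-- The alternating product `⋯ t s` with `k` factors that ends with `s`, in a monoid. -/
def altProd {B A : Type*} [Monoid A] (g : B → A) (s t : B) : ℕ → A
  | 0 => 1
  | k + 1 => altProd g t s k * g s

theorem altProd_succ_left {A : Type*} [Monoid A] (g : B → A) (s t : B) (k : ℕ) :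
    altProd g s t (k + 1) = g (if Even k then s else t) * altProd g s t k := by
  induction k generalizing s t with
  | zero => simp [altProd]
  | succ k ih =>
    rw [altProd, ih t s, altProd, mul_assoc]
    congr 2
    by_cases h : Even k <;> simp [h, Nat.even_add_one]

/-- Rank two sequence: the value of the root after `k` alternating reflections. -/
theorem dihedral_nonneg (v : M.Group) (s t : B) (hst : s ≠ t) (hs : M.PosRoot v s)
    (ht : M.PosRoot v t) (k : ℕ) (hk : M s t = 0 ∨ k < M s t) :
    M.PosRoot (v * altProd M.toCoxeterSystem.simple s t k) t := by
  intro f hf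
  set φ : ℝ := Real.pi / M s t with hφ
  set c : ℝ := Real.cos φ with hc
  have hcs : M.cartanVec s t = -2 * c := rfl
  have hct : M.cartanVec t s = -2 * c := by rw [cartanVec_symm, hcs]
  have hps := hs f hf
  have hpt := ht f hf
  -- the two-term recursion
  have rec2 : ∀ (a b : B) (k : ℕ), M.cartanVec b a = -2 * c →
      M.dualRep (v * altProd M.toCoxeterSystem.simple a b (k + 2))⁻¹ f b =
      2 * c * M.dualRep (v * altProd M.toCoxeterSystem.simple b a (k + 1))⁻¹ f a -
        M.dualRep (v * altProd M.toCoxeterSystem.simple a b k)⁻¹ f b := by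
    intro a b k hab
    rw [altProd, ← mul_assoc, dualRep_inv_mul_simple, dualReflection_apply]
    have h1 : M.dualRep (v * altProd M.toCoxeterSystem.simple b a (k + 1))⁻¹ f b
        = - M.dualRep (v * altProd M.toCoxeterSystem.simple a b k)⁻¹ f b := by
      rw [altProd, ← mul_assoc, dualRep_inv_mul_simple, dualReflection_apply]
      simp only [Pi.sub_apply, Pi.smul_apply, cartanVec_self, smul_eq_mul]
      ring
    simp only [Pi.sub_apply, Pi.smul_apply, smul_eq_mul, h1, M.cartanVec_symm a b, hab]
    ring
  have one : ∀ (a b : B), M.cartanVec a b = -2 * c →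
      M.dualRep (v * altProd M.toCoxeterSystem.simple a b 1)⁻¹ f b =
        M.dualRep v⁻¹ f b + 2 * c * M.dualRep v⁻¹ f a := by
    intro a b hab
    rw [altProd, altProd, one_mul, dualRep_inv_mul_simple, dualReflection_apply]
    simp only [Pi.sub_apply, Pi.smul_apply, smul_eq_mul, hab]
    ring
  rcases Nat.eq_zero_or_pos (M s t) with h0 | hpos
  · have hc1 : c = 1 := by simp [hc, hφ, h0]
    have key : ∀ k : ℕ, ∀ a b : B, M.cartanVec a b = -2 * c → M.cartanVec b a = -2 * c →
        0 ≤ M.dualRep v⁻¹ f a → 0 ≤ M.dualRep v⁻¹ f b →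
        0 ≤ M.dualRep (v * altProd M.toCoxeterSystem.simple a b k)⁻¹ f b ∧
        M.dualRep (v * altProd M.toCoxeterSystem.simple a b k)⁻¹ f b ≤
        M.dualRep (v * altProd M.toCoxeterSystem.simple b a (k + 1))⁻¹ f a := by
      intro k
      induction k with
      | zero =>
        intro a b hab hba ha hb
        rw [one b a hba, hc1]
        simp only [altProd, mul_one]
        exact ⟨hb, by linarith⟩
      | succ k ih =>
        intro a b hab hba ha hb
        obtain ⟨h1, h2⟩ := ih b a hba hab hb ha
        refine ⟨h1.trans h2, ?_⟩
        rw [rec2 b a k hab, hc1]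
        linarith
    exact (key k s t hcs hct hps hpt).1
  · have hm1 : M s t ≠ 1 := M.off_diagonal s t hst
    have hm2 : (2 : ℝ) ≤ M s t := by exact_mod_cast (by omega : 2 ≤ M s t)
    have hsin : 0 < Real.sin φ := by
      apply Real.sin_pos_of_pos_of_lt_pi
      · rw [hφ]; positivity
      · rw [hφ, div_lt_iff₀ (by positivity)]
        nlinarith [Real.pi_pos]
    -- The Chebyshev-type solution of the recursion; both sine coefficients are non-negative as long
    -- as `k + 1 ≤ m`.
    have key : ∀ k : ℕ, ∀ a b : B, M.cartanVec a b = -2 * c → M.cartanVec b a = -2 * c →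
        Real.sin φ * M.dualRep (v * altProd M.toCoxeterSystem.simple a b k)⁻¹ f b =
          Real.sin ((k + 1) * φ) * M.dualRep v⁻¹ f (if Even k then b else a) +
            Real.sin (k * φ) * M.dualRep v⁻¹ f (if Even k then a else b) := by
      intro k
      induction k using Nat.twoStepInduction with
      | zero => intro a b hab hba; simp [altProd]
      | one =>
        intro a b hab hba
        rw [one a b hab]
        have : Real.sin ((((1 : ℕ) : ℝ) + 1) * φ) = 2 * Real.sin φ * c := by
          rw [hc, ← Real.sin_two_mul]; norm_num
        rw [this]
        simp
        ring
      | more k h1 h2 =>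
        intro a b hab hba
        rw [rec2 a b k hba, mul_sub, h1 a b hab hba,
          show Real.sin φ * (2 * c * M.dualRep (v * altProd M.toCoxeterSystem.simple b a
            (k + 1))⁻¹ f a) = 2 * c * (Real.sin φ * M.dualRep (v * altProd
              M.toCoxeterSystem.simple b a (k + 1))⁻¹ f a) by ring, h2 b a hba hab]
        have e : ∀ x : ℝ, Real.sin (x + 2 * φ) = 2 * c * Real.sin (x + φ) - Real.sin x := by
          intro x
          have e1 : x + 2 * φ = (x + φ) + φ := by ring
          have e2 : Real.sin x = Real.sin ((x + φ) - φ) := by ring_nf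
          rw [e1, e2, Real.sin_add, Real.sin_sub]
          ring
        have e1 := e ((k + 1) * φ)
        have e2 := e (k * φ)
        rw [show (k + 1) * φ + 2 * φ = (((k + 2 : ℕ) : ℝ) + 1) * φ by push_cast; ring,
          show (k + 1) * φ + φ = (((k + 1 : ℕ) : ℝ) + 1) * φ by push_cast; ring] at e1
        rw [show k * φ + 2 * φ = ((k + 2 : ℕ) : ℝ) * φ by push_cast; ring,
          show k * φ + φ = ((k + 1 : ℕ) : ℝ) * φ by push_cast; ring] at e2
        rw [e1, e2]
        by_cases h : Even k <;> simp [h, Nat.even_add_one] <;> ring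
    have hlt : k < M s t := by omega
    have hkφ : ∀ j : ℕ, j ≤ M s t → 0 ≤ Real.sin (j * φ) := by
      intro j hj
      apply Real.sin_nonneg_of_nonneg_of_le_pi
      · rw [hφ]; positivity
      · rw [hφ, ← mul_div_assoc, div_le_iff₀ (by positivity), mul_comm]
        have : (j : ℝ) ≤ M s t := by exact_mod_cast hj
        nlinarith [Real.pi_pos]
    have h1 := hkφ (k + 1) (by omega)
    have h2 := hkφ k (by omega)
    push_cast at h1
    have := key k s t hcs hct
    have h3 : 0 ≤ Real.sin φ * M.dualRep (v * altProd M.toCoxeterSystem.simple s t k)⁻¹ f t := by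
      rw [this]
      split_ifs <;> positivity
    exact nonneg_of_mul_nonneg_right h3 hsin

end CoxeterMatrix

/-! ### Descents in Coxeter groups -/

namespace CoxeterMatrix

variable {B : Type*} (M : CoxeterMatrix B)

theorem altProd_map {A A' : Type*} [Monoid A] [Monoid A'] (φ : A →* A') (g : B → A) (s t : B)
    (k : ℕ) : φ (altProd g s t k) = altProd (fun b => φ (g b)) s t k := by
  induction k generalizing s t with
  | zero => simp [altProd]
  | succ k ih => rw [altProd, map_mul, ih, altProd]

theorem altProd_simple_eq_wordProd (s t : B) (k : ℕ) :
    altProd M.toCoxeterSystem.simple s t k = M.toCoxeterSystem.wordProd (CoxeterSystem.alternatingWord t s k) := by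
  induction k generalizing s t with
  | zero => simp [altProd, CoxeterSystem.alternatingWord]
  | succ k ih => rw [altProd, ih, CoxeterSystem.alternatingWord_succ, CoxeterSystem.wordProd_concat]

theorem altProd_simple_braid (s t : B) :
    altProd M.toCoxeterSystem.simple s t (M s t) = altProd M.toCoxeterSystem.simple t s (M s t) := by
  have := M.toCoxeterSystem.wordProd_braidWord_eq t s
  rw [CoxeterSystem.braidWord, CoxeterSystem.braidWord, ← altProd_simple_eq_wordProd,
    ← altProd_simple_eq_wordProd, M.symmetric t s] at this
  exact this

theorem length_mul_altProd_le (v : M.Group) (s t : B) (k : ℕ) :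
    M.toCoxeterSystem.length (v * altProd M.toCoxeterSystem.simple s t k) ≤ M.toCoxeterSystem.length v + k := by
  rw [altProd_simple_eq_wordProd]
  have h1 := M.toCoxeterSystem.length_mul_le v (M.toCoxeterSystem.wordProd (CoxeterSystem.alternatingWord t s k))
  have h2 := M.toCoxeterSystem.length_wordProd_le (CoxeterSystem.alternatingWord t s k)
  rw [CoxeterSystem.length_alternatingWord] at h2
  omega

/-- Letters `t, s, t, …` are removed on the right for as long as the length drops. If this stops
before `M s t` letters, the next letter is not a descent of the remainder by maximality. Nor is the
letter removed last, since otherwise `w` would have a shorter expression. -/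
theorem exists_strip {w : M.Group} {s t : B} (ht : M.toCoxeterSystem.IsRightDescent w t) :
    (M s t ≠ 0 ∧ ∃ v, w = v * altProd M.toCoxeterSystem.simple t s (M s t) ∧
      M.toCoxeterSystem.length w = M.toCoxeterSystem.length v + M s t) ∨
    ∃ v k, 0 < k ∧ (M s t = 0 ∨ k < M s t) ∧ w = v * altProd M.toCoxeterSystem.simple t s k ∧
      M.toCoxeterSystem.length w = M.toCoxeterSystem.length v + k ∧ ¬ M.toCoxeterSystem.IsRightDescent v s ∧
      ¬ M.toCoxeterSystem.IsRightDescent v t := by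
  classical
  let P : ℕ → Prop := fun k => ∃ v, w = v * altProd M.toCoxeterSystem.simple t s k ∧
    M.toCoxeterSystem.length w = M.toCoxeterSystem.length v + k
  have hfail : ∃ k, ¬ P k := ⟨M.toCoxeterSystem.length w + 1, by rintro ⟨v, -, h⟩; omega⟩
  have P0 : P 0 := ⟨w, by simp [altProd], by simp⟩
  have P1 : P 1 := ⟨w * M.toCoxeterSystem.simple t, by rw [altProd, altProd, one_mul, CoxeterSystem.simple_mul_simple_cancel_right], by
    rw [M.toCoxeterSystem.isRightDescent_iff] at ht; omega⟩
  have hspec := Nat.find_spec hfail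
  have hmin : ∀ j, j < Nat.find hfail → P j := fun j hj => not_not.1 (Nat.find_min hfail hj)
  obtain ⟨k', hk⟩ : ∃ k', Nat.find hfail = k' + 2 := by
    refine ⟨Nat.find hfail - 2, ?_⟩
    have h0 : Nat.find hfail ≠ 0 := fun h => by rw [h] at hspec; exact hspec P0
    have h1 : Nat.find hfail ≠ 1 := fun h => by rw [h] at hspec; exact hspec P1
    omega
  rw [hk] at hspec hmin
  by_cases hm : M s t ≠ 0 ∧ M s t ≤ k' + 1
  · exact Or.inl ⟨hm.1, hmin _ (by omega)⟩
  right
  obtain ⟨v, hw, hl⟩ := hmin (k' + 1) (by omega)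
  refine ⟨v, k' + 1, by omega, by omega, hw, hl, ?_⟩
  have next : ¬ M.toCoxeterSystem.IsRightDescent v (if Even (k' + 1) then t else s) := by
    intro h
    apply hspec
    refine ⟨v * M.toCoxeterSystem.simple (if Even (k' + 1) then t else s), ?_, ?_⟩
    · rw [altProd_succ_left, mul_assoc, CoxeterSystem.simple_mul_simple_cancel_left, hw]
    · rw [M.toCoxeterSystem.isRightDescent_iff] at h; omega
  have first : ¬ M.toCoxeterSystem.IsRightDescent v (if Even k' then t else s) := by
    intro h
    rw [altProd_succ_left, ← mul_assoc] at hw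
    have := M.length_mul_altProd_le (v * M.toCoxeterSystem.simple (if Even k' then t else s)) t s k'
    rw [← hw] at this
    rw [M.toCoxeterSystem.isRightDescent_iff] at h; omega
  by_cases h : Even k'
  · simp only [h, Nat.even_add_one, not_true_eq_false, if_true, if_false] at next first
    exact ⟨next, first⟩
  · simp only [h, Nat.even_add_one, not_false_eq_true, if_true, if_false] at next first
    exact ⟨first, next⟩

/-- Induction on the length. A non-trivial `w` has some descent `t ≠ s`; strip the letters `t, s`
from it. A full braid word cannot come off, since rewriting it would make `s` a descent. So the
shorter remainder has neither letter as a descent, both roots are positive for it, and the rank two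
computation brings positivity back to `w`. -/
theorem posRoot_of_not_isRightDescent (w : M.Group) (s : B) (h : ¬ M.toCoxeterSystem.IsRightDescent w s) :
    M.PosRoot w s := by
  generalize hn : M.toCoxeterSystem.length w = n
  induction n using Nat.strong_induction_on generalizing w s with
  | _ n ih =>
    subst hn
    rcases eq_or_ne w 1 with rfl | hw
    · intro f hf
      simpa using hf s
    obtain ⟨t, ht⟩ := M.toCoxeterSystem.exists_rightDescent_of_ne_one hw
    have hst : s ≠ t := by rintro rfl; exact h ht
    rcases M.exists_strip (s := s) ht with ⟨hm, v, hwv, hl⟩ | ⟨v, k, hk, hkm, hwv, hl, h1, h2⟩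
    · exfalso
      apply h
      obtain ⟨m, hm'⟩ := Nat.exists_eq_succ_of_ne_zero hm
      rw [← altProd_simple_braid, hm', altProd, ← mul_assoc] at hwv
      have := M.length_mul_altProd_le v t s m
      rw [CoxeterSystem.IsRightDescent, hwv, CoxeterSystem.simple_mul_simple_cancel_right, ← hwv]
      omega
    · rw [hwv]
      have := M.dihedral_nonneg v t s hst.symm (ih _ (by omega) v t h2 rfl)
        (ih _ (by omega) v s h1 rfl) k (by rwa [M.symmetric t s])
      exact this

theorem not_posRoot_of_isRightDescent (w : M.Group) (s : B) (h : M.toCoxeterSystem.IsRightDescent w s) :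
    ¬ M.PosRoot w s := by
  rw [M.toCoxeterSystem.isRightDescent_iff_not_isRightDescent_mul] at h
  have := M.not_posRoot_mul_simple (M.posRoot_of_not_isRightDescent _ _ h)
  rwa [CoxeterSystem.simple_mul_simple_cancel_right] at this

/-- An incomplete strip would make the root of `s` positive for `w`, which is impossible for a
descent. So a full braid word splits off, and in particular `m(s,t)` is finite. -/
theorem exists_eq_mul_altProd_of_isRightDescent {w : M.Group} {s t : B} (hst : s ≠ t)
    (hs : M.toCoxeterSystem.IsRightDescent w s) (ht : M.toCoxeterSystem.IsRightDescent w t) :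
    M s t ≠ 0 ∧ ∃ v, w = v * altProd M.toCoxeterSystem.simple t s (M s t) ∧
      M.toCoxeterSystem.length w = M.toCoxeterSystem.length v + M s t := by
  rcases M.exists_strip (s := s) ht with h | ⟨v, k, hk, hkm, hwv, hl, h1, h2⟩
  · exact h
  · exfalso
    apply M.not_posRoot_of_isRightDescent _ _ hs
    rw [hwv]
    exact M.dihedral_nonneg v t s hst.symm (M.posRoot_of_not_isRightDescent v t h2)
        (M.posRoot_of_not_isRightDescent v s h1) k (by rwa [M.symmetric t s])

theorem length_mul_altProd {v : M.Group} {s t : B} (hst : s ≠ t)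
    (hs : ¬ M.toCoxeterSystem.IsRightDescent v s) (ht : ¬ M.toCoxeterSystem.IsRightDescent v t) (k : ℕ)
    (hk : M s t = 0 ∨ k ≤ M s t) :
    M.toCoxeterSystem.length (v * altProd M.toCoxeterSystem.simple s t k) = M.toCoxeterSystem.length v + k := by
  induction k generalizing s t with
  | zero => simp [altProd]
  | succ k ih =>
    have h1 := ih hst.symm ht hs (by rw [M.symmetric t s]; omega)
    have h2 := M.dihedral_nonneg v t s hst.symm (M.posRoot_of_not_isRightDescent v t ht)
        (M.posRoot_of_not_isRightDescent v s hs) k (by rw [M.symmetric t s]; omega)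
    have h3 : ¬ M.toCoxeterSystem.IsRightDescent (v * altProd M.toCoxeterSystem.simple t s k) s := fun h =>
      M.not_posRoot_of_isRightDescent _ _ h h2
    rw [M.toCoxeterSystem.not_isRightDescent_iff] at h3
    rw [altProd, ← mul_assoc, h3, h1]
    omega

/-- The alternating products read in the two directions are inverse to each other. -/
theorem altProd_simple_inv (s t : B) (k : ℕ) :
    (altProd M.toCoxeterSystem.simple s t k)⁻¹ =
      altProd M.toCoxeterSystem.simple (if Even k then t else s) (if Even k then s else t) k := by
  induction k generalizing s t with
  | zero => simp [altProd]
  | succ k ih =>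
    rw [altProd_succ_left, mul_inv_rev, ih, CoxeterSystem.inv_simple, altProd]
    by_cases h : Even k <;> simp [h, Nat.even_add_one]

theorem length_altProd_mul {v : M.Group} {s t : B} (hst : s ≠ t)
    (hs : ¬ M.toCoxeterSystem.IsLeftDescent v s) (ht : ¬ M.toCoxeterSystem.IsLeftDescent v t) :
    M.toCoxeterSystem.length (altProd M.toCoxeterSystem.simple s t (M s t) * v) = M.toCoxeterSystem.length v + M s t := by
  rw [← M.toCoxeterSystem.isRightDescent_inv_iff] at hs ht
  rw [← M.toCoxeterSystem.length_inv, mul_inv_rev, altProd_simple_inv]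
  have hsym := M.symmetric t s
  by_cases h : Even (M s t)
  · simp only [h, if_true]
    have := M.length_mul_altProd hst.symm ht hs (M s t) (by omega)
    rw [this, M.toCoxeterSystem.length_inv]
  · simp only [h, if_false]
    have := M.length_mul_altProd hst hs ht (M s t) (by omega)
    rw [this, M.toCoxeterSystem.length_inv]

end CoxeterMatrix

section

open CoxeterMatrix (altProd altProd_succ_left altProd_map)

/-! ### Word combinatorics in Artin monoids -/

theorem FreeMonoid.eq_one_or_eq_mul_of {B : Type*} (w : FreeMonoid B) :
    w = 1 ∨ ∃ u a, w = u * FreeMonoid.of a := by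
  induction w using FreeMonoid.inductionOn' with
  | one => exact Or.inl rfl
  | of_mul x w ih =>
    right
    rcases ih with rfl | ⟨u, a, rfl⟩
    · exact ⟨1, x, by simp⟩
    · exact ⟨FreeMonoid.of x * u, a, by rw [mul_assoc]⟩

theorem FreeMonoid.mul_of_inj {B : Type*} {u u' : FreeMonoid B} {a a' : B}
    (h : u * FreeMonoid.of a = u' * FreeMonoid.of a') : u = u' ∧ a = a' := by
  have h' : u.toList ++ [a] = u'.toList ++ [a'] := congrArg FreeMonoid.toList h
  have := List.append_inj' h' rfl
  exact ⟨FreeMonoid.toList.injective this.1, by simpa using this.2⟩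

theorem FreeMonoid.mul_of_ne_one {B : Type*} (u : FreeMonoid B) (a : B) :
    u * FreeMonoid.of a ≠ 1 := by
  intro h
  have := congrArg FreeMonoid.length h
  simp at this

theorem altWord_eq_altProd {B : Type*} (s t : B) (k : ℕ) :
    altWord s t k =
      altProd FreeMonoid.of (if Even k then t else s) (if Even k then s else t) k := by
  induction k generalizing s t with
  | zero => simp [altWord, altProd]
  | succ k ih =>
    rw [altWord, ih, altProd_succ_left]
    by_cases h : Even k <;> simp [h, Nat.even_add_one]

namespace ArtinMonoid

variable {B : Type*} {M : CoxeterMatrix B}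

/-- The word length. -/
noncomputable def len (g : ArtinMonoid M) : ℕ :=
  Multiplicative.toAdd (PresentedMonoid.lift (fun _ => Multiplicative.ofAdd 1) (by
    rintro _ _ ⟨s, t, -⟩
    have h : ∀ (k : ℕ) (s t : B), FreeMonoid.lift (fun _ => Multiplicative.ofAdd 1)
        (altWord s t k) = Multiplicative.ofAdd k := by
      intro k
      induction k with
      | zero => intro s t; rfl
      | succ k ih => intro s t; rw [altWord, map_mul, ih]; simp [← ofAdd_add, add_comm]
    rw [h, h]) g)

theorem len_one : len (1 : ArtinMonoid M) = 0 := by simp [len]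

theorem len_mul (g h : ArtinMonoid M) : len (g * h) = len g + len h := by simp [len]

theorem len_gen (s : B) : len (gen M s) = 1 := rfl

theorem len_altProd (s t : B) (k : ℕ) : len (altProd (gen M) s t k) = k := by
  induction k generalizing s t with
  | zero => exact len_one
  | succ k ih => rw [altProd, len_mul, ih, len_gen]

theorem eq_one_or_eq_mul_gen (g : ArtinMonoid M) : g = 1 ∨ ∃ h s, g = h * gen M s := by
  obtain ⟨w, rfl⟩ := PresentedMonoid.surjective_mk g
  rcases w.eq_one_or_eq_mul_of with rfl | ⟨u, a, rfl⟩
  · exact Or.inl (map_one _)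
  · exact Or.inr ⟨_, a, map_mul _ _ _⟩

theorem eq_one_of_len_eq_zero {g : ArtinMonoid M} (h : len g = 0) : g = 1 := by
  rcases eq_one_or_eq_mul_gen g with h1 | ⟨g', s, rfl⟩
  · exact h1
  · rw [len_mul, len_gen] at h; omega

theorem braid (s t : B) (h : M s t ≠ 0) :
    altProd (gen M) s t (M s t) = altProd (gen M) t s (M s t) := by
  have h1 := altWord_eq M s t h
  rw [altWord_eq_altProd, altWord_eq_altProd, altProd_map, altProd_map] at h1
  by_cases he : Even (M s t)
  · simp only [he, if_true] at h1
    exact h1.symm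
  · simp only [he, if_false] at h1
    exact h1

/-- `comp a b` is the left complement of `gen a` in the least common left multiple of `gen a`
and `gen b`. -/
noncomputable def comp (M : CoxeterMatrix B) (a b : B) : ArtinMonoid M :=
  altProd (gen M) b a (M a b - 1)

theorem comp_mul_gen (a b : B) (h : M a b ≠ 0) :
    comp M a b * gen M a = altProd (gen M) a b (M a b) := by
  obtain ⟨m, hm⟩ := Nat.exists_eq_succ_of_ne_zero h
  rw [comp, hm, altProd, Nat.succ_sub_one]

theorem comp_mul_gen_comm (a b : B) (h : M a b ≠ 0) :
    comp M a b * gen M a = comp M b a * gen M b := by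
  rw [comp_mul_gen a b h, braid a b h, comp_mul_gen b a (by rwa [M.symmetric]), M.symmetric]

theorem len_comp (a b : B) : len (comp M a b) = M a b - 1 := len_altProd _ _ _

/-! ### Factorisations with a distinguished last letter -/

/-- An elementary rewriting of the factorisation `X * gen a` that changes the last letter. -/
inductive TailStep (M : CoxeterMatrix B) : ArtinMonoid M × B → ArtinMonoid M × B → Prop
  | mk (U : ArtinMonoid M) (a c : B) (hne : a ≠ c) (h : M a c ≠ 0) :
      TailStep M (U * comp M a c, a) (U * comp M c a, c)

theorem eqvGen_tailStep_mul_left (g : ArtinMonoid M) {x y : ArtinMonoid M × B}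
    (h : Relation.EqvGen (TailStep M) x y) :
    Relation.EqvGen (TailStep M) (g * x.1, x.2) (g * y.1, y.2) := by
  induction h with
  | rel x y h =>
    obtain ⟨U, a, c, hne, h⟩ := h
    have := TailStep.mk (g * U) a c hne h
    rw [mul_assoc, mul_assoc] at this
    exact .rel _ _ this
  | refl x => exact .refl _
  | symm x y _ ih => exact .symm _ _ ih
  | trans x y z _ _ h1 h2 => exact .trans _ _ _ h1 h2

/-- Two words are tail-equivalent if both are empty, or their last letters are connected by
elementary rewritings. -/
def TailEquiv (M : CoxeterMatrix B) (w w' : FreeMonoid B) : Prop :=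
  (w = 1 ∧ w' = 1) ∨ ∃ u a u' a', w = u * FreeMonoid.of a ∧ w' = u' * FreeMonoid.of a' ∧
    Relation.EqvGen (TailStep M) (PresentedMonoid.mk (ArtinRel M) u, a)
      (PresentedMonoid.mk (ArtinRel M) u', a')

theorem tailEquiv_altProd (p q : B) (h : M p q ≠ 0) :
    TailEquiv M (altProd FreeMonoid.of p q (M p q)) (altProd FreeMonoid.of q p (M p q)) := by
  obtain ⟨m, hm⟩ := Nat.exists_eq_succ_of_ne_zero h
  rw [hm]
  right
  refine ⟨altProd FreeMonoid.of q p m, p, altProd FreeMonoid.of p q m, q, rfl, rfl, ?_⟩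
  rcases eq_or_ne p q with rfl | hne
  · exact .refl _
  apply Relation.EqvGen.rel
  have := TailStep.mk (M := M) 1 p q hne h
  rw [one_mul, one_mul, comp, comp, M.symmetric q p, hm] at this
  rw [altProd_map, altProd_map]
  exact this

/-- Induction over the generated congruence. In a product the last letter comes from the right
factor, and the left factors, being equal in the monoid, go into the prefix; if the right factor is
empty, the left factor decides. -/
theorem tailEquiv_of_rel {w w' : FreeMonoid B} (h : ConGen.Rel (ArtinRel M) w w') :
    TailEquiv M w w' := by
  induction h with
  | of x y h =>
    obtain ⟨s, t, h⟩ := h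
    rw [altWord_eq_altProd, altWord_eq_altProd]
    have h' : M t s ≠ 0 := by rwa [M.symmetric]
    by_cases he : Even (M s t)
    · simp only [he, if_true]
      have := tailEquiv_altProd t s h'
      rwa [M.symmetric t s] at this
    · simp only [he, if_false]
      exact tailEquiv_altProd s t h
  | refl x =>
    rcases x.eq_one_or_eq_mul_of with rfl | ⟨u, a, rfl⟩
    · exact Or.inl ⟨rfl, rfl⟩
    · exact Or.inr ⟨u, a, u, a, rfl, rfl, .refl _⟩
  | symm _ ih =>
    rcases ih with ⟨rfl, rfl⟩ | ⟨u, a, u', a', rfl, rfl, h⟩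
    · exact Or.inl ⟨rfl, rfl⟩
    · exact Or.inr ⟨_, _, _, _, rfl, rfl, .symm _ _ h⟩
  | trans _ _ ih1 ih2 =>
    rcases ih1 with ⟨rfl, rfl⟩ | ⟨u, a, u', a', rfl, rfl, h⟩
    · exact ih2
    · rcases ih2 with ⟨h1, -⟩ | ⟨v, b, v', b', h1, rfl, h2⟩
      · exact absurd h1 (FreeMonoid.mul_of_ne_one _ _)
      · obtain ⟨rfl, rfl⟩ := FreeMonoid.mul_of_inj h1
        exact Or.inr ⟨_, _, _, _, rfl, rfl, .trans _ _ _ h h2⟩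
  | @mul w x y z hr _ ih1 ih2 =>
    rcases ih2 with ⟨rfl, rfl⟩ | ⟨u, a, u', a', rfl, rfl, h⟩
    · simpa using ih1
    · right
      refine ⟨w * u, a, x * u', a', by rw [mul_assoc], by rw [mul_assoc], ?_⟩
      have e : PresentedMonoid.mk (ArtinRel M) w = PresentedMonoid.mk (ArtinRel M) x :=
        PresentedMonoid.mk_eq_mk_iff.2 hr
      rw [map_mul, map_mul, ← e]
      exact eqvGen_tailStep_mul_left _ h

/-- This reduces the reduction lemma to one elementary step, where it holds by construction, and to
transitivity. -/
theorem eqvGen_of_mul_gen_eq {X Y : ArtinMonoid M} {a b : B} (h : X * gen M a = Y * gen M b) :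
    Relation.EqvGen (TailStep M) (X, a) (Y, b) := by
  obtain ⟨u, rfl⟩ := PresentedMonoid.surjective_mk X
  obtain ⟨v, rfl⟩ := PresentedMonoid.surjective_mk Y
  rw [gen, gen, PresentedMonoid.of, PresentedMonoid.of, ← map_mul, ← map_mul,
    PresentedMonoid.mk_eq_mk_iff] at h
  rcases tailEquiv_of_rel h with ⟨h1, -⟩ | ⟨u', a', v', b', h1, h2, h3⟩
  · exact absurd h1 (FreeMonoid.mul_of_ne_one _ _)
  · obtain ⟨rfl, rfl⟩ := FreeMonoid.mul_of_inj h1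
    obtain ⟨rfl, rfl⟩ := FreeMonoid.mul_of_inj h2
    exact h3

/-! ### Reduced elements -/

/-- The projection of the Artin monoid to the Coxeter group. -/
noncomputable def toGroup (M : CoxeterMatrix B) : ArtinMonoid M →* M.Group :=
  PresentedMonoid.lift M.toCoxeterSystem.simple (by
    rintro _ _ ⟨s, t, h⟩
    rw [altWord_eq_altProd, altWord_eq_altProd, altProd_map, altProd_map]
    simp only [FreeMonoid.lift_eval_of]
    have := M.altProd_simple_braid s t
    by_cases he : Even (M s t)
    · simp only [he, if_true]; exact this.symm
    · simp only [he, if_false]; exact this)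

theorem toGroup_gen (s : B) : toGroup M (gen M s) = M.toCoxeterSystem.simple s := rfl

theorem toGroup_altProd (s t : B) (k : ℕ) :
    toGroup M (altProd (gen M) s t k) = altProd M.toCoxeterSystem.simple s t k :=
  altProd_map _ _ _ _ _

/-- An element of the Artin monoid is reduced if its length is that of its image in the Coxeter
group. -/
def IsRed (g : ArtinMonoid M) : Prop := M.toCoxeterSystem.length (toGroup M g) = len g

theorem length_toGroup_le (g : ArtinMonoid M) :
    M.toCoxeterSystem.length (toGroup M g) ≤ len g := by
  generalize hn : len g = n
  induction n generalizing g with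
  | zero => rw [eq_one_of_len_eq_zero hn]; simp
  | succ n ih =>
    rcases eq_one_or_eq_mul_gen g with rfl | ⟨g', s, rfl⟩
    · rw [len_one] at hn; omega
    · rw [len_mul, len_gen] at hn
      have h1 := ih g' (by omega)
      have h2 := M.toCoxeterSystem.length_mul_le (toGroup M g') (toGroup M (gen M s))
      rw [toGroup_gen, CoxeterSystem.length_simple] at h2
      rw [map_mul, toGroup_gen]
      omega

theorem IsRed.of_mul {g h : ArtinMonoid M} (hr : IsRed (g * h)) : IsRed g ∧ IsRed h := by
  have h1 := length_toGroup_le g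
  have h2 := length_toGroup_le h
  have h3 := M.toCoxeterSystem.length_mul_le (toGroup M g) (toGroup M h)
  rw [IsRed, map_mul, len_mul] at hr
  constructor <;> unfold IsRed <;> omega

theorem exists_isRed (w : M.Group) : ∃ g : ArtinMonoid M, toGroup M g = w ∧ IsRed g := by
  generalize hn : M.toCoxeterSystem.length w = n
  induction n generalizing w with
  | zero =>
    rw [CoxeterSystem.length_eq_zero_iff] at hn
    exact ⟨1, by simp [hn], by simp [IsRed, len_one]⟩
  | succ n ih =>
    obtain ⟨s, hs⟩ := M.toCoxeterSystem.exists_rightDescent_of_ne_one (w := w)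
      (by rintro rfl; simp at hn)
    rw [CoxeterSystem.isRightDescent_iff] at hs
    obtain ⟨g, hg, hr⟩ := ih (w * M.toCoxeterSystem.simple s) (by omega)
    refine ⟨g * gen M s, ?_, ?_⟩
    · rw [map_mul, hg, toGroup_gen, CoxeterSystem.simple_mul_simple_cancel_right]
    · rw [IsRed, hg] at hr
      rw [IsRed, map_mul, hg, toGroup_gen, CoxeterSystem.simple_mul_simple_cancel_right, len_mul,
        len_gen]
      omega

theorem IsRed.isRightDescent {g : ArtinMonoid M} {s : B} (h : IsRed (g * gen M s)) :
    M.toCoxeterSystem.IsRightDescent (toGroup M (g * gen M s)) s := by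
  have h1 := length_toGroup_le g
  rw [IsRed, len_mul, len_gen] at h
  rw [CoxeterSystem.IsRightDescent, h, map_mul, toGroup_gen,
    CoxeterSystem.simple_mul_simple_cancel_right]
  omega

/-- If the image of `g` in the Coxeter group has the two right descents `s ≠ t`, then the image
has a reduced lift that ends with the least common multiple of `s` and `t`. -/
theorem exists_isRed_mul_altProd {w : M.Group} {s t : B} (hst : s ≠ t)
    (hs : M.toCoxeterSystem.IsRightDescent w s) (ht : M.toCoxeterSystem.IsRightDescent w t) :
    M s t ≠ 0 ∧ ∃ V : ArtinMonoid M, IsRed (V * altProd (gen M) s t (M s t)) ∧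
      toGroup M (V * altProd (gen M) s t (M s t)) = w := by
  obtain ⟨h0, v, hw, hl⟩ := M.exists_eq_mul_altProd_of_isRightDescent hst hs ht
  obtain ⟨V, rfl, hV⟩ := exists_isRed v
  rw [← M.altProd_simple_braid, ← toGroup_altProd, ← map_mul] at hw
  refine ⟨h0, V, ?_, hw.symm⟩
  rw [IsRed] at hV ⊢
  rw [← hw, hl, hV, len_mul, len_altProd]

/-- Matsumoto's theorem: a reduced element is determined by its image in the Coxeter group. -/
theorem IsRed.eq_of_toGroup_eq {g h : ArtinMonoid M} (hg : IsRed g) (hh : IsRed h)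
    (e : toGroup M g = toGroup M h) : g = h := by
  generalize hn : len g = n
  induction n generalizing g h with
  | zero =>
    rw [eq_one_of_len_eq_zero hn]
    rw [IsRed] at hg hh
    rw [← e] at hh
    exact (eq_one_of_len_eq_zero (by omega)).symm
  | succ n ih =>
    have hn' : len h = n + 1 := by rw [← hn]; unfold IsRed at hg hh; rw [← hg, ← hh, e]
    rcases eq_one_or_eq_mul_gen g with rfl | ⟨g, s, rfl⟩
    · rw [len_one] at hn; omega
    rcases eq_one_or_eq_mul_gen h with rfl | ⟨h, t, rfl⟩
    · rw [len_one] at hn'; omega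
    rw [len_mul, len_gen] at hn hn'
    -- equality after cancelling a common last letter
    have cancel : ∀ {x y : ArtinMonoid M} {r : B}, IsRed (x * gen M r) → IsRed (y * gen M r) →
        toGroup M (x * gen M r) = toGroup M (y * gen M r) → len x = n → x = y := by
      intro x y r hx hy hxy hl
      refine ih hx.of_mul.1 hy.of_mul.1 ?_ hl
      rw [map_mul, map_mul] at hxy
      exact mul_right_cancel hxy
    rcases eq_or_ne s t with rfl | hst
    · rw [cancel hg hh e (by omega)]
    obtain ⟨h0, V, hV, hVe⟩ := exists_isRed_mul_altProd hst hg.isRightDescent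
      (e ▸ hh.isRightDescent)
    have e1 : V * altProd (gen M) s t (M s t) = V * comp M s t * gen M s := by
      rw [mul_assoc, comp_mul_gen _ _ h0]
    have e2 : V * altProd (gen M) s t (M s t) = V * comp M t s * gen M t := by
      rw [mul_assoc, ← comp_mul_gen_comm _ _ h0, comp_mul_gen _ _ h0]
    have k1 : g = V * comp M s t := cancel hg (e1 ▸ hV) (by rw [← e1, hVe]) (by omega)
    have k2 : h = V * comp M t s := cancel hh (e2 ▸ hV) (by rw [← e2, hVe, e]) (by omega)
    rw [k1, k2, ← e1, ← e2]

end ArtinMonoid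

/-! ### The reduction lemma and right cancellation -/

namespace ArtinMonoid

variable {B : Type*} {M : CoxeterMatrix B}

/-- The conclusion of the reduction lemma for the factorisations `x.1 * gen x.2` and
`y.1 * gen y.2` of an element. -/
def TailLcm (M : CoxeterMatrix B) (x y : ArtinMonoid M × B) : Prop :=
  (x.2 = y.2 → x.1 = y.1) ∧ (x.2 ≠ y.2 → M x.2 y.2 ≠ 0 ∧
    ∃ W, x.1 = W * comp M x.2 y.2 ∧ y.1 = W * comp M y.2 x.2)

/-- The reduction lemma for elements `x.1 * gen x.2` with `x.1` of length `L`. -/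
def ReductionAt (M : CoxeterMatrix B) (L : ℕ) : Prop :=
  ∀ x y : ArtinMonoid M × B, len x.1 = L → x.1 * gen M x.2 = y.1 * gen M y.2 → TailLcm M x y

theorem TailLcm.symm {x y : ArtinMonoid M × B} (h : TailLcm M x y) : TailLcm M y x := by
  refine ⟨fun e => (h.1 e.symm).symm, fun hne => ?_⟩
  obtain ⟨h0, W, h1, h2⟩ := h.2 hne.symm
  exact ⟨by rwa [M.symmetric], W, h2, h1⟩

/-- For equal last letters the reduction lemma is cancellation of that letter, and `x` is removed
letter by letter. The length bound makes this available inside the induction that proves the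
reduction lemma. -/
theorem cancel_right_of_reductionAt {L : ℕ} (IH : ∀ L' < L, ReductionAt M L')
    (x g h : ArtinMonoid M) (hl : len (g * x) ≤ L) (e : g * x = h * x) : g = h := by
  generalize hn : len x = n
  induction n generalizing x with
  | zero => simpa [eq_one_of_len_eq_zero hn] using e
  | succ n ih =>
    rcases eq_one_or_eq_mul_gen x with rfl | ⟨x, s, rfl⟩
    · simpa using e
    · rw [len_mul, len_gen] at hn
      rw [len_mul, len_mul, len_gen] at hl
      rw [← mul_assoc, ← mul_assoc] at e
      exact ih x (by rw [len_mul]; omega) ((IH (len (g * x)) (by rw [len_mul]; omega)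
        (g * x, s) (h * x, s) rfl e).1 rfl) (by omega)

/-- Neither `s` nor `t` is a left descent of the image of `x`, so lengths add when the alternating
word is put in front. -/
theorem isRed_altProd_mul {x : ArtinMonoid M} {s t : B} (hst : s ≠ t)
    (hs : IsRed (gen M s * x)) (ht : IsRed (gen M t * x)) :
    IsRed (altProd (gen M) s t (M s t) * x) := by
  have hx := hs.of_mul.2
  have key : ∀ r : B, IsRed (gen M r * x) →
      ¬ M.toCoxeterSystem.IsLeftDescent (toGroup M x) r := by
    intro r hr
    rw [IsRed] at hr hx
    rw [CoxeterSystem.IsLeftDescent, ← toGroup_gen, ← map_mul, hr, hx, len_mul]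
    omega
  have := M.length_altProd_mul hst (key s hs) (key t ht)
  rw [IsRed] at hx ⊢
  rw [map_mul, toGroup_altProd, this, hx, len_mul, len_altProd, add_comm]

/-- A confluence argument among the right divisors of `Z` that stay reduced after appending `c`. If
`s * z` and `t * z` are two diverging extensions of `z`, the reduction lemma in smaller length shows
that the least common multiple of `s` and `t`, times `z`, again divides `Z`, and it remains in the
class by `isRed_altProd_mul`. Both branches are then joined to it in turn. The induction ends
because right divisors of `Z` have length at most `L`. -/
theorem exists_common_left_multiple {L : ℕ} (IH : ∀ L' < L, ReductionAt M L')
    (E : ArtinMonoid M → Prop) (Z : ArtinMonoid M) (c : B) (hZ : len Z = L)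
    (hE : ∀ z, E z ↔ (∃ R, Z = R * z) ∧ IsRed (z * gen M c)) (N : ℕ) (z x y : ArtinMonoid M)
    (hN : L ≤ len z + N) (hx : E (x * z)) (hy : E (y * z)) :
    ∃ w x' y', w = x' * (x * z) ∧ w = y' * (y * z) ∧ E w := by
  have suffix : ∀ a b, E (a * b) → E b := by
    intro a b h
    rw [hE] at h ⊢
    obtain ⟨⟨R, hR⟩, h2⟩ := h
    refine ⟨⟨R * a, by rw [hR, mul_assoc]⟩, ?_⟩
    rw [mul_assoc] at h2
    exact h2.of_mul.2
  have hlen : ∀ a, E a → len a ≤ L := by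
    intro a h
    obtain ⟨⟨R, hR⟩, -⟩ := (hE a).1 h
    rw [← hZ, hR, len_mul]
    omega
  induction N generalizing z x y with
  | zero =>
    have h1 := hlen _ hx
    rw [len_mul] at h1
    have : x = 1 := eq_one_of_len_eq_zero (by omega)
    subst this
    exact ⟨y * z, y, 1, by simp, by simp, hy⟩
  | succ N ih =>
    rcases eq_one_or_eq_mul_gen x with rfl | ⟨x, s, rfl⟩
    · exact ⟨y * z, y, 1, by simp, by simp, hy⟩
    rcases eq_one_or_eq_mul_gen y with rfl | ⟨y, t, rfl⟩
    · exact ⟨x * gen M s * z, 1, x * gen M s, by simp, by simp, hx⟩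
    have hxs : E (x * (gen M s * z)) := by rwa [← mul_assoc]
    have hyt : E (y * (gen M t * z)) := by rwa [← mul_assoc]
    have hns : ∀ r : B, L ≤ len (gen M r * z) + N := fun r => by rw [len_mul, len_gen]; omega
    rcases eq_or_ne s t with rfl | hst
    · obtain ⟨w, x', y', h1, h2, h3⟩ := ih _ x y (hns s) hxs hyt
      exact ⟨w, x', y', by rw [h1]; simp only [mul_assoc], by rw [h2]; simp only [mul_assoc], h3⟩
    obtain ⟨⟨R1, hR1⟩, hr1⟩ := (hE _).1 hx
    obtain ⟨⟨R2, hR2⟩, hr2⟩ := (hE _).1 hy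
    have e : (R1 * x * gen M s) * z = (R2 * y * gen M t) * z := by
      calc _ = Z := by rw [hR1]; simp only [mul_assoc]
        _ = _ := by rw [hR2]; simp only [mul_assoc]
    have hl : len ((R1 * x * gen M s) * z) = L := by
      rw [← hZ, hR1]; simp only [mul_assoc]
    have e' := cancel_right_of_reductionAt IH z _ _ hl.le e
    rw [len_mul, len_mul, len_gen] at hl
    obtain ⟨h0, W, hW1, hW2⟩ := (IH (len (R1 * x)) (by omega) (R1 * x, s) (R2 * y, t) rfl e').2 hst
    dsimp only at h0 hW1 hW2
    have hΔ : E (comp M s t * (gen M s * z)) := by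
      rw [hE]
      refine ⟨⟨W, ?_⟩, ?_⟩
      · rw [hR1, ← mul_assoc W, ← hW1]; simp only [mul_assoc]
      · rw [← mul_assoc, comp_mul_gen s t h0, mul_assoc]
        apply isRed_altProd_mul hst
        · rw [← mul_assoc]; exact ((hE _).1 (suffix _ _ hxs)).2
        · rw [← mul_assoc]; exact ((hE _).1 (suffix _ _ hyt)).2
    obtain ⟨w1, a1, b1, hw1, hw1', hE1⟩ := ih _ x (comp M s t) (hns s) hxs hΔ
    have hw1'' : w1 = (b1 * comp M t s) * (gen M t * z) := by
      rw [hw1', ← mul_assoc (comp M s t), comp_mul_gen_comm s t h0]; simp only [mul_assoc]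
    obtain ⟨w2, a2, b2, hw2, hw2', hE2⟩ := ih _ (b1 * comp M t s) y (hns t) (hw1'' ▸ hE1) hyt
    refine ⟨w2, a2 * a1, b2, ?_, by rw [hw2']; simp only [mul_assoc], hE2⟩
    rw [hw2, ← hw1'', hw1]
    simp only [mul_assoc]

theorem isRed_altProd {a b : B} (hab : a ≠ b) : IsRed (altProd (gen M) a b (M a b)) := by
  have := M.length_mul_altProd (v := 1) hab (by simp [CoxeterSystem.not_isRightDescent_one])
    (by simp [CoxeterSystem.not_isRightDescent_one]) (M a b) (Or.inr le_rfl)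
  rw [IsRed, toGroup_altProd, len_altProd]
  simpa using this

/-- The essential case has three distinct letters `a, c, b`, where `Z` ends with the complements of
`c` relative to `a` and to `b`. A common left multiple `w` of these, dividing `Z` and with `w * gen
M c` reduced, reduces the question to the Coxeter group. There `a` and `b` are both descents, so
their braid word splits off, and Matsumoto's theorem lifts this to the monoid. -/
theorem TailLcm.trans {L : ℕ} (IH : ∀ L' < L, ReductionAt M L') {x z y : ArtinMonoid M × B}
    (hz : len z.1 = L) (h1 : TailLcm M x z) (h2 : TailLcm M z y) : TailLcm M x y := by
  obtain ⟨X, a⟩ := x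
  obtain ⟨Z, c⟩ := z
  obtain ⟨Y, b⟩ := y
  rcases eq_or_ne a c with rfl | hac
  · obtain rfl : X = Z := h1.1 rfl
    exact h2
  rcases eq_or_ne c b with rfl | hcb
  · obtain rfl : Z = Y := h2.1 rfl
    exact h1
  obtain ⟨hm1, W1, hX, hZ1⟩ := h1.2 hac
  obtain ⟨hm2, W2, hZ2, hY⟩ := h2.2 hcb
  dsimp only at hz hm1 hX hZ1 hm2 hZ2 hY
  rcases eq_or_ne a b with rfl | hab
  · refine ⟨fun _ => ?_, fun h => absurd rfl h⟩
    have : W1 = W2 := cancel_right_of_reductionAt IH (comp M c a) W1 W2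
      (by rw [← hZ1, hz]) (by rw [← hZ1, hZ2])
    simp only
    rw [hX, hY, this]
  refine ⟨fun h => absurd h hab, fun _ => ?_⟩
  dsimp only
  let E : ArtinMonoid M → Prop := fun z => (∃ R, Z = R * z) ∧ IsRed (z * gen M c)
  have hEv : ∀ d, c ≠ d → M c d ≠ 0 → (∃ W, Z = W * comp M c d) → E (comp M c d * 1) := by
    intro d hd h0 hW
    rw [mul_one]
    refine ⟨hW, ?_⟩
    rw [comp_mul_gen c d h0]
    exact isRed_altProd hd
  obtain ⟨w, z1, z2, hw1, hw2, ⟨R, hR⟩, hred⟩ := exists_common_left_multiple IH E Z c hz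
    (fun _ => Iff.rfl) L 1 (comp M c a) (comp M c b) (by omega)
    (hEv a hac.symm (by rwa [M.symmetric]) ⟨_, hZ1⟩) (hEv b hcb hm2 ⟨_, hZ2⟩)
  rw [mul_one] at hw1 hw2
  have hW1 : W1 = R * z1 := cancel_right_of_reductionAt IH (comp M c a) _ _
      (by rw [← hZ1, hz]) (by rw [← hZ1, hR, hw1, mul_assoc])
  have hW2 : W2 = R * z2 := cancel_right_of_reductionAt IH (comp M c b) _ _
      (by rw [← hZ2, hz]) (by rw [← hZ2, hR, hw2, mul_assoc])
  have ea : w * gen M c = z1 * comp M a c * gen M a := by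
    rw [hw1, mul_assoc, mul_assoc, comp_mul_gen_comm a c hm1]
  have eb : w * gen M c = z2 * comp M b c * gen M b := by
    rw [hw2, mul_assoc, mul_assoc, comp_mul_gen_comm c b hm2]
  have da : M.toCoxeterSystem.IsRightDescent (toGroup M (w * gen M c)) a := by
    rw [ea] at hred ⊢
    exact hred.isRightDescent
  have db : M.toCoxeterSystem.IsRightDescent (toGroup M (w * gen M c)) b := by
    rw [eb] at hred ⊢
    exact hred.isRightDescent
  -- Finiteness of `m(a,b)` is a conclusion here: two descents of one group element force it.
  obtain ⟨h0, V, hV, hVe⟩ := exists_isRed_mul_altProd hab da db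
  have hVw := hV.eq_of_toGroup_eq hred hVe
  have cancel : ∀ {p q : ArtinMonoid M} {r : B}, p * gen M r = w * gen M c →
      q * gen M r = w * gen M c → p = q := by
    intro p q r hp hq
    have hp' := (hp ▸ hred : IsRed (p * gen M r))
    have hq' := (hq ▸ hred : IsRed (q * gen M r))
    refine hp'.of_mul.1.eq_of_toGroup_eq hq'.of_mul.1 ?_
    have := congrArg (toGroup M) (hp.trans hq.symm)
    rw [map_mul, map_mul] at this
    exact mul_right_cancel this
  have k1 : z1 * comp M a c = V * comp M a b :=
    cancel ea.symm (by rw [mul_assoc, comp_mul_gen a b h0, hVw])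
  have k2 : z2 * comp M b c = V * comp M b a :=
    cancel eb.symm (by rw [mul_assoc, ← comp_mul_gen_comm a b h0, comp_mul_gen a b h0, hVw])
  refine ⟨h0, R * V, ?_, ?_⟩
  · rw [hX, hW1, mul_assoc, k1, mul_assoc]
  · rw [hY, hW2, mul_assoc, k2, mul_assoc]

theorem reductionAt (L : ℕ) : ReductionAt M L := by
  induction L using Nat.strong_induction_on with
  | _ L IH =>
    intro x y hx hxy
    have h := eqvGen_of_mul_gen_eq hxy
    suffices H : ∀ x y : ArtinMonoid M × B, Relation.EqvGen (TailStep M) x y →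
        len x.1 = len y.1 ∧ (len x.1 = L → TailLcm M x y) from (H _ _ h).2 hx
    intro x y h
    induction h with
    | rel x y h =>
      obtain ⟨U, a, c, hne, h⟩ := h
      refine ⟨?_, fun _ => ⟨fun h => absurd h hne, fun _ => ⟨h, U, rfl, rfl⟩⟩⟩
      rw [len_mul, len_mul, len_comp, len_comp, M.symmetric a c]
    | refl x => exact ⟨rfl, fun _ => ⟨fun _ => rfl, fun h => absurd rfl h⟩⟩
    | symm x y _ ih => exact ⟨ih.1.symm, fun h => (ih.2 (ih.1.trans h)).symm⟩
    | trans x y z _ _ h1 h2 =>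
      exact ⟨h1.1.trans h2.1, fun h => (h1.2 h).trans IH (h1.1 ▸ h) (h2.2 (h1.1 ▸ h))⟩

/-- Artin monoids are right cancellative. -/
theorem mul_right_cancel_artin {g h x : ArtinMonoid M} (e : g * x = h * x) : g = h :=
  cancel_right_of_reductionAt (fun L' _ => reductionAt L') x g h le_rfl e

/-- The reduction lemma: an element that ends with two different generators ends with their least
common multiple. -/
theorem exists_eq_mul_comp {X Y : ArtinMonoid M} {a b : B} (hab : a ≠ b)
    (e : X * gen M a = Y * gen M b) :
    M a b ≠ 0 ∧ ∃ W, X = W * comp M a b ∧ Y = W * comp M b a :=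
  (reductionAt (len X) (X, a) (Y, b) rfl e).2 hab

theorem eq_mul_gen_of_comm {X Y : ArtinMonoid M} {a b : B} (hab : M a b = 2)
    (e : X * gen M a = Y * gen M b) : ∃ W, X = W * gen M b ∧ Y = W * gen M a := by
  have hne : a ≠ b := by rintro rfl; simp at hab
  obtain ⟨-, W, h1, h2⟩ := exists_eq_mul_comp hne e
  refine ⟨W, ?_, ?_⟩
  · simpa [comp, hab, altProd] using h1
  · simpa [comp, M.symmetric b a, hab, altProd] using h2

theorem eq_mul_gen_gen_of_braid {X Y : ArtinMonoid M} {a b : B} (hab : M a b = 3)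
    (e : X * gen M a = Y * gen M b) :
    ∃ W, X = W * gen M a * gen M b ∧ Y = W * gen M b * gen M a := by
  have hne : a ≠ b := by rintro rfl; simp at hab
  obtain ⟨-, W, h1, h2⟩ := exists_eq_mul_comp hne e
  refine ⟨W, ?_, ?_⟩
  · simpa [comp, hab, altProd, mul_assoc] using h1
  · simpa [comp, M.symmetric b a, hab, altProd, mul_assoc] using h2

/-! ### Cosets of standard submonoids -/

/-- The submonoid generated by the generators in `I`. -/
def standard (M : CoxeterMatrix B) (I : Set B) : Submonoid (ArtinMonoid M) :=
  Submonoid.closure (gen M '' I)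

/-- `g` does not end with a generator in `I`. -/
def NoEnd (I : Set B) (g : ArtinMonoid M) : Prop := ∀ s ∈ I, ∀ h, g ≠ h * gen M s

theorem gen_mem_standard {I : Set B} {s : B} (hs : s ∈ I) : gen M s ∈ standard M I :=
  Submonoid.subset_closure ⟨s, hs, rfl⟩

theorem altProd_mem_standard {I : Set B} {s t : B} (hs : s ∈ I) (ht : t ∈ I) (k : ℕ) :
    altProd (gen M) s t k ∈ standard M I := by
  induction k generalizing s t with
  | zero => exact Submonoid.one_mem _
  | succ k ih => exact Submonoid.mul_mem _ (ih ht hs) (gen_mem_standard hs)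

theorem eq_one_or_of_mem_standard {I : Set B} {b : ArtinMonoid M} (hb : b ∈ standard M I) :
    b = 1 ∨ ∃ c ∈ standard M I, ∃ s ∈ I, b = c * gen M s := by
  induction hb using Submonoid.closure_induction_right with
  | one => exact Or.inl rfl
  | mul_right x hx y hy _ =>
    obtain ⟨s, hs, rfl⟩ := hy
    exact Or.inr ⟨x, hx, s, hs, rfl⟩

theorem exists_noEnd_mul (I : Set B) (g : ArtinMonoid M) :
    ∃ r b, NoEnd I r ∧ b ∈ standard M I ∧ g = r * b := by
  generalize hn : len g = n
  induction n generalizing g with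
  | zero =>
    refine ⟨g, 1, ?_, Submonoid.one_mem _, by simp⟩
    rintro s - h rfl
    rw [len_mul, len_gen] at hn
    omega
  | succ n ih =>
    by_cases h : NoEnd I g
    · exact ⟨g, 1, h, Submonoid.one_mem _, by simp⟩
    · unfold NoEnd at h
      push Not at h
      obtain ⟨s, hs, g', rfl⟩ := h
      rw [len_mul, len_gen] at hn
      obtain ⟨r, b, hr, hb, rfl⟩ := ih g' (by omega)
      exact ⟨r, b * gen M s, hr, Submonoid.mul_mem _ hb (gen_mem_standard hs), by rw [mul_assoc]⟩

/-- Induction on the length by comparing the last letters of `b` and `b'`. Equal letters cancel. For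
different letters the reduction lemma gives a common prefix `W` followed by complements that lie in
the submonoid; the `NoEnd` part of `W` is then equal to both `r` and `r'` by induction. -/
theorem NoEnd.eq_of_mul_eq {I : Set B} {r r' b b' : ArtinMonoid M} (hr : NoEnd I r)
    (hr' : NoEnd I r') (hb : b ∈ standard M I) (hb' : b' ∈ standard M I)
    (e : r * b = r' * b') : r = r' := by
  generalize hn : len (r * b) = n
  induction n using Nat.strong_induction_on generalizing r r' b b' with
  | _ n ih =>
    rcases eq_one_or_of_mem_standard hb with rfl | ⟨c, hc, s, hs, rfl⟩
    · rcases eq_one_or_of_mem_standard hb' with rfl | ⟨c', hc', t, ht, rfl⟩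
      · simpa using e
      · rw [mul_one, ← mul_assoc] at e
        exact absurd e (hr t ht _)
    rcases eq_one_or_of_mem_standard hb' with rfl | ⟨c', hc', t, ht, rfl⟩
    · rw [mul_one, ← mul_assoc] at e
      exact absurd e.symm (hr' s hs _)
    rw [← mul_assoc, ← mul_assoc] at e
    have hlen := congrArg len e
    simp only [len_mul, len_gen] at hlen hn
    rcases eq_or_ne s t with rfl | hst
    · exact ih _ (by rw [len_mul]; omega) hr hr' hc hc' (mul_right_cancel_artin e) rfl
    obtain ⟨h0, W, h1, h2⟩ := exists_eq_mul_comp hst e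
    obtain ⟨q, d, hq, hd, rfl⟩ := exists_noEnd_mul I W
    rw [mul_assoc] at h1 h2
    have k1 := ih _ (by rw [len_mul]; omega) hr hq hc
      (Submonoid.mul_mem _ hd (altProd_mem_standard ht hs _)) h1 rfl
    have k2 := ih _ (by rw [len_mul]; omega) hr' hq hc'
      (Submonoid.mul_mem _ hd (altProd_mem_standard hs ht _)) h2 rfl
    rw [k1, k2]

/-- Related elements have the same `NoEnd` factor by uniqueness, so the transitive closure preserves
this factor. -/
theorem NoEnd.eq_of_cosetSetoid {I : Set B} {r r' : ArtinMonoid M} (hr : NoEnd I r)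
    (hr' : NoEnd I r') (h : cosetSetoid (standard M I) r r') : r = r' := by
  have key : ∀ g g' : ArtinMonoid M, cosetSetoid (standard M I) g g' →
      ∃ q b b', NoEnd I q ∧ b ∈ standard M I ∧ b' ∈ standard M I ∧ g = q * b ∧ g' = q * b' := by
    have step : ∀ g g' : ArtinMonoid M, CosetRel (standard M I) g g' →
        ∃ q b b', NoEnd I q ∧ b ∈ standard M I ∧ b' ∈ standard M I ∧ g = q * b ∧ g' = q * b' := by
      rintro g g' ⟨c, hc, c', hc', e⟩
      obtain ⟨q, b, hq, hb, rfl⟩ := exists_noEnd_mul I g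
      obtain ⟨q', b', hq', hb', rfl⟩ := exists_noEnd_mul I g'
      rw [mul_assoc, mul_assoc] at e
      obtain rfl := hq.eq_of_mul_eq hq' (Submonoid.mul_mem _ hb hc) (Submonoid.mul_mem _ hb' hc') e
      exact ⟨q, b, b', hq, hb, hb', rfl, rfl⟩
    intro g g' h
    induction h with
    | single h => exact step _ _ h
    | tail _ h ih =>
      obtain ⟨q, b, b', hq, hb, hb', e1, e2⟩ := ih
      obtain ⟨p, c, c', hp, hc, hc', e3, e4⟩ := step _ _ h
      obtain rfl := hq.eq_of_mul_eq hp hb' hc (e2.symm.trans e3)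
      exact ⟨q, b, c', hq, hb, hc', e1, e4⟩
  obtain ⟨q, b, b', hq, hb, hb', e1, e2⟩ := key r r' h
  have k1 := hr.eq_of_mul_eq hq (Submonoid.one_mem _) hb (by rw [mul_one, e1])
  have k2 := hr'.eq_of_mul_eq hq (Submonoid.one_mem _) hb' (by rw [mul_one, e2])
  rw [k1, k2]

end ArtinMonoid

end

/-! ### Combinatorics of the tower -/

namespace TowerMonoid

open ArtinMonoid

variable {S : Type*} {M : CoxeterMatrix (Option S)} {n : ℕ}

/-- The generators of `A⁺_q`. -/
def lowGens (S : Type*) (n q : ℕ) : Set (Gen S n) :=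
  {b | ∀ j, b = .inr j → j.1 ≤ q}

theorem parabolic_eq_standard (q : ℕ) :
    parabolic M n q = standard (towerMatrix M n) (lowGens S n q) := by
  rw [parabolic, standard]
  congr 1
  ext a
  constructor
  · rintro (⟨s, rfl⟩ | ⟨j, hj, rfl⟩)
    · exact ⟨.inl s, by rintro j ⟨⟩, rfl⟩
    · exact ⟨.inr j, by rintro _ ⟨⟩; exact hj, rfl⟩
  · rintro ⟨b, hb, rfl⟩
    rcases b with s | j
    · exact Or.inl ⟨s, rfl⟩
    · exact Or.inr ⟨j, hb j rfl, rfl⟩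

theorem sigma_eq_gen (j : Set.Icc 1 n) : sigma M n j.1 = gen (towerMatrix M n) (.inr j) := by
  rw [sigma, dif_pos j.2]

theorem len_sigma {j : ℕ} (hj : j ∈ Set.Icc 1 n) : len (sigma M n j) = 1 := by
  rw [sigma, dif_pos hj, len_gen]

/-- `g` ends with `x`. -/
def EndsWith (g x : TowerMonoid M n) : Prop := ∃ h, g = h * x

theorem descend_add (r k l : ℕ) :
    descend M n r (k + l) = descend M n (r + k) l * descend M n r k := by
  induction l with
  | zero => simp [descend]
  | succ l ih => rw [← add_assoc, descend, ih, descend, mul_assoc, add_assoc r k l]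

theorem endsWith_of_mul_sigma {b : Gen S n} {j : Set.Icc 1 n} {g : TowerMonoid M n}
    (hb : towerMatrix M n b (.inr j) = 2)
    (h : EndsWith (g * sigma M n j.1) (gen (towerMatrix M n) b)) :
    EndsWith g (gen (towerMatrix M n) b) := by
  obtain ⟨Y, hY⟩ := h
  rw [sigma_eq_gen] at hY
  obtain ⟨W, h1, -⟩ := eq_mul_gen_of_comm (by rwa [CoxeterMatrix.symmetric]) hY
  exact ⟨W, h1⟩

theorem endsWith_of_mul_descend {b : Gen S n} (r k : ℕ) {g : TowerMonoid M n}
    (hb : ∀ j : Set.Icc 1 n, r < j.1 → j.1 ≤ r + k → towerMatrix M n b (.inr j) = 2)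
    (h : EndsWith (g * descend M n r k) (gen (towerMatrix M n) b)) :
    EndsWith g (gen (towerMatrix M n) b) := by
  induction k generalizing g with
  | zero => simpa [descend] using h
  | succ k ih =>
    rw [descend, ← mul_assoc] at h
    have h1 := ih (fun j hj hj' => hb j hj (by omega)) h
    by_cases hr : r + k + 1 ∈ Set.Icc 1 n
    · exact endsWith_of_mul_sigma (j := ⟨_, hr⟩) (hb _ (by simp only; omega) le_rfl) h1
    · rwa [sigma, dif_neg hr, mul_one] at h1

theorem towerMatrix_inr_inr_of_lt {i j : Set.Icc 1 n} (h : i.1 + 2 ≤ j.1 ∨ j.1 + 2 ≤ i.1) :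
    towerMatrix M n (.inr i) (.inr j) = 2 := by
  rw [towerMatrix_apply, towerEntry, if_neg (by omega), if_neg (by omega)]

theorem towerMatrix_inl_inr {s : S} {j : Set.Icc 1 n} (h : 2 ≤ j.1) :
    towerMatrix M n (.inl s) (.inr j) = 2 := by
  rw [towerMatrix_apply, towerEntry, if_neg (by omega)]

theorem towerMatrix_inr_inr_succ {i j : Set.Icc 1 n} (h : i.1 = j.1 + 1) :
    towerMatrix M n (.inr i) (.inr j) = 3 := by
  rw [towerMatrix_apply, towerEntry, if_neg (by omega), if_pos (by omega)]

/-- The braid relation between `σ_{q+1}` and `σ_{q+2}` forces `σ_{q+2} σ_{q+1}` at the end of the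
product without its last factor. Since `σ_{q+1}` commutes with the remaining factors, it can be
split off from `g` and cancelled, leaving the same situation one index higher. -/
theorem endsWith_descend_of_mul_descend (q k : ℕ) {g : TowerMonoid M n} (hn : q + 1 + k ≤ n)
    (h : EndsWith (g * descend M n (q + 1) k) (sigma M n (q + 1))) :
    EndsWith g (descend M n q (k + 1)) := by
  induction k generalizing g q with
  | zero => simpa [descend] using h
  | succ k ih =>
    obtain ⟨Y, hY⟩ := h
    rw [descend_succ_eq, ← mul_assoc] at hY
    let i : Set.Icc 1 n := ⟨q + 1 + 1, by constructor <;> omega⟩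
    let j : Set.Icc 1 n := ⟨q + 1, by constructor <;> omega⟩
    have hi : sigma M n (q + 1 + 1) = gen (towerMatrix M n) (.inr i) := sigma_eq_gen i
    have hj : sigma M n (q + 1) = gen (towerMatrix M n) (.inr j) := sigma_eq_gen j
    rw [hi, hj] at hY
    obtain ⟨W, hW, -⟩ := eq_mul_gen_gen_of_braid (towerMatrix_inr_inr_succ rfl) hY
    rw [← hj, ← hi] at hW
    obtain ⟨ε, rfl⟩ : EndsWith g (gen (towerMatrix M n) (.inr j)) := by
      refine endsWith_of_mul_descend (q + 1 + 1) k ?_ ⟨_, hj ▸ hW⟩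
      intro l hl _
      apply towerMatrix_inr_inr_of_lt
      simp only [j]
      omega
    have hcomm := parabolic_comm_descend M n (q := q + 1) (r := q + 1 + 1) le_rfl k _
      (sigma_mem_parabolic M n le_rfl)
    rw [← hj, mul_assoc, hcomm, ← mul_assoc] at hW
    obtain ⟨Y', rfl⟩ := ih (q + 1) (by omega) ⟨W, mul_right_cancel_artin hW⟩
    rw [← hj]
    exact ⟨Y', by rw [mul_assoc, ← descend_succ_eq]⟩

/-! ### Faces of top-dimensional simplices -/

/-- The element that describes the passage to the face opposite to the vertices in the list. -/
noncomputable def chain (M : CoxeterMatrix (Option S)) (n : ℕ) : ℕ → List ℕ → TowerMonoid M n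
  | _, [] => 1
  | i, c :: l => descend M n i (c - i) * chain M n (i + 1) l

theorem chain_concat (i : ℕ) (l : List ℕ) (c : ℕ) :
    chain M n i (l ++ [c]) =
      chain M n i l * descend M n (i + l.length) (c - (i + l.length)) := by
  induction l generalizing i with
  | nil => simp [chain]
  | cons d l ih =>
    rw [List.cons_append, chain, ih, chain, mul_assoc, List.length_cons]
    congr 3 <;> omega

/-- A strictly increasing list of numbers between `1` and `n`. -/
def IsAscending (n : ℕ) (l : List ℕ) : Prop := l.Pairwise (· < ·) ∧ ∀ c ∈ l, 1 ≤ c ∧ c ≤ n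

theorem IsAscending.of_concat {l : List ℕ} {c : ℕ} (h : IsAscending n (l ++ [c])) :
    IsAscending n l ∧ (∀ d ∈ l, d < c) ∧ l.length + 1 ≤ c ∧ c ≤ n := by
  obtain ⟨h1, h2⟩ := h
  rw [List.pairwise_append] at h1
  have h3 : ∀ d ∈ l, d < c := fun d hd => h1.2.2 d hd c (by simp)
  have h4 : l.toFinset ⊆ Finset.Ico 1 c := by
    intro d hd
    rw [List.mem_toFinset] at hd
    exact Finset.mem_Ico.2 ⟨(h2 d (by simp [hd])).1, h3 d hd⟩
  have h5 := Finset.card_le_card h4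
  rw [List.toFinset_card_of_nodup (h1.1.imp fun h => h.ne), Nat.card_Ico] at h5
  have h6 := h2 c (by simp)
  exact ⟨⟨h1.1, fun d hd => h2 d (by simp [hd])⟩, h3, by omega, h6.2⟩

theorem endsWith_of_mul_chain {b : Gen S n} {g : TowerMonoid M n} {l : List ℕ}
    (hb : ∀ j : Set.Icc 1 n, 2 ≤ j.1 → (∃ c ∈ l, j.1 ≤ c) → towerMatrix M n b (.inr j) = 2)
    (h : EndsWith (g * chain M n 1 l) (gen (towerMatrix M n) b)) :
    EndsWith g (gen (towerMatrix M n) b) := by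
  induction l using List.reverseRecOn with
  | nil => simpa [chain] using h
  | append_singleton l c ih =>
    rw [chain_concat, ← mul_assoc] at h
    refine ih (fun j hj ⟨d, hd, hjd⟩ => hb j hj ⟨d, by simp [hd], hjd⟩)
      (endsWith_of_mul_descend _ _ ?_ h)
    intro j hj hj'
    exact hb j (by omega) ⟨c, by simp, by omega⟩

/-- The facet with number `c` of the simplex of `g` is not shared with a simplex of smaller
length. -/
def IsFree (g : TowerMonoid M n) (c : ℕ) : Prop :=
  (c < n → ¬ EndsWith g (sigma M n (c + 1))) ∧ ¬ EndsWith g (descend M n 0 c)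

/-- All letters of the chain have index less than `c`, so `σ_{c+1}` commutes with them and would
already end `g`. -/
theorem not_endsWith_mul_chain {g : TowerMonoid M n} {l : List ℕ} {c : ℕ} (hl : ∀ d ∈ l, d < c)
    (hc : c < n) (hg : IsFree g c) : ¬ EndsWith (g * chain M n 1 l) (sigma M n (c + 1)) := by
  intro h
  let j : Set.Icc 1 n := ⟨c + 1, by constructor <;> omega⟩
  have hj : sigma M n (c + 1) = gen (towerMatrix M n) (.inr j) := sigma_eq_gen j
  apply hg.1 hc
  rw [hj] at h ⊢
  refine endsWith_of_mul_chain ?_ h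
  rintro i - ⟨d, hd, hid⟩
  have := hl d hd
  apply towerMatrix_inr_inr_of_lt
  simp only [j]
  omega

/-- Thus an iterated face along free facets has this product as its canonical representative.
Generators in `S`, and `σ_j` with `j` at most the length of the shorter list, commute with the last
descending factor or with the whole chain, so induction or the hypothesis on `g` excludes them. Only
the index just below the last descending factor needs freeness. -/
theorem noEnd_mul_chain {g : TowerMonoid M n} (hg : NoEnd (lowGens S n 0) g) {l : List ℕ}
    (hl : IsAscending n l) (hfree : ∀ c ∈ l, IsFree g c) :
    NoEnd (lowGens S n l.length) (g * chain M n 1 l) := by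
  induction l using List.reverseRecOn with
  | nil => simpa [chain] using hg
  | append_singleton l c ih =>
    obtain ⟨h1, h2, h3, h4⟩ := hl.of_concat
    have ih' := ih h1 fun d hd => hfree d (by simp [hd])
    rintro (s | j) hb h he
    · have : EndsWith g (gen (towerMatrix M n) (.inl s)) :=
        endsWith_of_mul_chain (fun j hj _ => towerMatrix_inl_inr hj) ⟨h, he⟩
      obtain ⟨k, hk⟩ := this
      exact hg (.inl s) (by rintro j ⟨⟩) k hk
    · have hjl := hb j rfl
      rw [List.length_append, List.length_singleton] at hjl
      rw [chain_concat, ← mul_assoc, add_comm 1 l.length] at he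
      rcases Nat.lt_or_ge j.1 (l.length + 1) with hlt | hge
      · obtain ⟨k, hk⟩ : EndsWith (g * chain M n 1 l) (gen (towerMatrix M n) (.inr j)) :=
          endsWith_of_mul_descend _ _
            (fun i hi _ => towerMatrix_inr_inr_of_lt (Or.inl (by omega))) ⟨h, he⟩
        exact ih' (.inr j) (by rintro _ ⟨⟩; omega) k hk
      have hjeq : j.1 = l.length + 1 := by omega
      rw [← sigma_eq_gen, hjeq] at he
      have hd := endsWith_descend_of_mul_descend _ _ (by omega) ⟨h, he⟩
      -- For an empty list this contradicts the second half of freeness of `c`. Otherwise cancelling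
      -- the descending factor of the preceding entry `c'` leaves an element ending with `σ_{c'+1}`,
      -- against the first half of freeness of `c'`.
      rcases l.eq_nil_or_concat' with rfl | ⟨l, c', rfl⟩
      · apply (hfree c (by simp)).2
        simpa [chain, show c - 1 + 1 = c by simp at h3; omega] using hd
      · obtain ⟨k1, k2, k3, k4⟩ := h1.of_concat
        have hcc := h2 c' (by simp)
        rw [List.length_append, List.length_singleton] at hd h3
        obtain ⟨Y, hY⟩ := hd
        rw [chain_concat, ← mul_assoc, add_comm 1 l.length,
          show c - (l.length + 1 + 1) + 1 = (c' - (l.length + 1)) + (c - c') by omega,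
          descend_add, ← mul_assoc] at hY
        have hY' := mul_right_cancel_artin hY
        rw [show c - c' = (c - c' - 1) + 1 by omega, descend_succ_eq,
          show l.length + 1 + (c' - (l.length + 1)) = c' by omega, ← mul_assoc] at hY'
        exact not_endsWith_mul_chain k2 (by omega) (hfree c' (by simp)) ⟨_, hY'⟩

/-- Compare the last entries. If they differ, cancelling the shorter descending factor makes a
product end with `σ_{c+1}`, where `c` is the smaller entry, and freeness of `c` forbids this. If
they agree, the factors cancel. -/
theorem mul_chain_inj {g g' : TowerMonoid M n} {l l' : List ℕ} (hlen : l.length = l'.length)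
    (hl : IsAscending n l) (hl' : IsAscending n l') (hfree : ∀ c ∈ l, IsFree g c)
    (hfree' : ∀ c ∈ l', IsFree g' c) (e : g * chain M n 1 l = g' * chain M n 1 l') :
    l = l' ∧ g = g' := by
  induction l using List.reverseRecOn generalizing l' with
  | nil =>
    obtain rfl : l' = [] := List.eq_nil_of_length_eq_zero hlen.symm
    exact ⟨rfl, by simpa [chain] using e⟩
  | append_singleton l c ih =>
    rcases l'.eq_nil_or_concat' with rfl | ⟨l', c', rfl⟩
    · simp at hlen
    have hlen' : l.length = l'.length := by simpa using hlen
    obtain ⟨h1, h2, h3, h4⟩ := hl.of_concat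
    obtain ⟨h1', h2', h3', h4'⟩ := hl'.of_concat
    rw [chain_concat, chain_concat, ← mul_assoc, ← mul_assoc, ← hlen'] at e
    have key : ∀ {x y : TowerMonoid M n} {a b : ℕ}, a < b → l.length + 1 ≤ a →
        x * descend M n (1 + l.length) (a - (1 + l.length)) =
          y * descend M n (1 + l.length) (b - (1 + l.length)) →
        EndsWith x (sigma M n (a + 1)) := by
      intro x y a b hab ha h
      rw [show b - (1 + l.length) = (a - (1 + l.length)) + (b - a - 1 + 1) by omega, descend_add,
        show 1 + l.length + (a - (1 + l.length)) = a by omega, descend_succ_eq, ← mul_assoc,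
        ← mul_assoc] at h
      exact ⟨_, mul_right_cancel_artin h⟩
    rcases lt_trichotomy c c' with hc | rfl | hc
    · exact absurd (key hc h3 e) (not_endsWith_mul_chain h2 (by omega) (hfree c (by simp)))
    · obtain ⟨rfl, rfl⟩ := ih hlen' h1 h1' (fun d hd => hfree d (by simp [hd]))
        (fun d hd => hfree' d (by simp [hd])) (mul_right_cancel_artin e)
      exact ⟨rfl, rfl⟩
    · exact absurd (key hc (by omega) e.symm)
        (not_endsWith_mul_chain h2' (by omega) (hfree' c' (by simp)))

theorem eq_one_of_isFree {g : TowerMonoid M n} (hg : NoEnd (lowGens S n 0) g)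
    (h : ∀ c, 1 ≤ c → c ≤ n → IsFree g c) : g = 1 := by
  rcases eq_one_or_eq_mul_gen g with h1 | ⟨k, b, hk⟩
  · exact h1
  exfalso
  rcases b with s | j
  · exact hg (.inl s) (by rintro j ⟨⟩) k hk
  · have hj := j.2
    rw [Set.mem_Icc] at hj
    rw [← sigma_eq_gen] at hk
    rcases Nat.lt_or_ge 1 j.1 with h1 | h1
    · have := (h (j.1 - 1) (by omega) (by omega)).1 (by omega)
      rw [show j.1 - 1 + 1 = j.1 by omega] at this
      exact this ⟨k, hk⟩
    · have h2 : j.1 = 1 := by omega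
      apply (h 1 le_rfl (by omega)).2
      exact ⟨k, by simpa [descend, h2] using hk⟩

/-- A facet that is not free is a facet of a simplex of smaller length. -/
theorem exists_shorter_facet {g : TowerMonoid M n} {c : ℕ} (h1 : 1 ≤ c) (hn : c ≤ n)
    (h : ¬ IsFree g c) : ∃ g' : TowerMonoid M n, len g' < len g ∧ ∃ c', 1 ≤ c' ∧ c' ≤ n ∧
      CosetRel (parabolic M n 1) (g * descend M n 1 (c - 1)) (g' * descend M n 1 (c' - 1)) := by
  rw [IsFree, not_and_or] at h
  rcases h with h | h
  · push Not at h
    obtain ⟨hc, g', rfl⟩ := h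
    refine ⟨g', ?_, c + 1, by omega, by omega, 1, Submonoid.one_mem _, 1, Submonoid.one_mem _, ?_⟩
    · rw [len_mul, len_sigma ⟨by omega, by omega⟩]; omega
    · obtain ⟨c, rfl⟩ : ∃ d, c = d + 1 := ⟨c - 1, by omega⟩
      rw [Nat.add_sub_cancel, Nat.add_sub_cancel, descend, add_comm 1 c]
      simp only [mul_assoc, mul_one]
  · push Not at h
    obtain ⟨g', rfl⟩ := h
    obtain ⟨c, rfl⟩ : ∃ d, c = d + 1 := ⟨c - 1, by omega⟩
    refine ⟨g' * descend M n 0 c, ?_, c + 1, by omega, hn, 1, Submonoid.one_mem _,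
      sigma M n 1, sigma_mem_parabolic M n le_rfl, ?_⟩
    · rw [descend, len_mul, len_mul, len_mul, len_sigma ⟨by omega, by omega⟩]; omega
    -- The simplicial identity moves one factor: `(σ_c ⋯ σ₁)(σ_c ⋯ σ₂) = (σ_{c-1} ⋯ σ₁)(σ_c ⋯ σ₂)
    -- σ₁`, and the final `σ₁` disappears in the coset. The shorter simplex shares its facet with
    -- the same number.
    · have := descend_descend M n (r := 0) (i := c) (j := c) le_rfl (by omega)
      simp only [zero_add] at this
      rw [Nat.add_sub_cancel, mul_one, mul_assoc, this]
      simp only [mul_assoc]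

end TowerMonoid

/-! ### The normal form of a point of the geometric realisation -/

theorem Fin.castSucc_succAbove_of_le {p : ℕ} {a b : Fin (p + 1)} (h : a ≤ b) :
    a.castSucc.succAbove b = b.succ := by
  rw [Fin.succAbove_of_le_castSucc]
  exact Fin.castSucc_le_castSucc_iff.2 h

theorem Fin.succ_succAbove_of_le {p : ℕ} {a b : Fin (p + 1)} (h : a ≤ b) :
    b.succ.succAbove a = a.castSucc := by
  rw [Fin.succAbove_of_castSucc_lt]
  rw [Fin.lt_def] at *
  simp only [Fin.val_castSucc, Fin.val_succ]
  exact Nat.lt_succ_of_le h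

theorem Fin.succAbove_succAbove_of_le {p : ℕ} {a b : Fin (p + 2)} (h : a ≤ b) (k : Fin (p + 1)) :
    a.castSucc.succAbove (b.succAbove k) = b.succ.succAbove (a.succAbove k) := by
  rw [Fin.le_def] at h
  ext
  simp only [Fin.succAbove, Fin.lt_def, Fin.val_castSucc, Fin.val_succ]
  split_ifs <;> simp only [Fin.val_castSucc, Fin.val_succ] at * <;> omega

theorem exists_least_zero {p : ℕ} {u : Fin (p + 1) → ℝ} (h : ∃ i, u i = 0) :
    ∃ i, u i = 0 ∧ ∀ j < i, u j ≠ 0 := by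
  classical
  have hne : (Finset.univ.filter fun i => u i = 0).Nonempty := by
    obtain ⟨i, hi⟩ := h
    exact ⟨i, by simpa using hi⟩
  refine ⟨Finset.min' _ hne, ?_, fun j hj h0 => ?_⟩
  · simpa using Finset.min'_mem _ hne
  · exact absurd (Finset.min'_le _ j (by simpa using h0)) (not_le.2 hj)

section FaceInclusion

variable {p : ℕ} (i : Fin (p + 2))

theorem map_succAbove_self (u : stdSimplex ℝ (Fin (p + 1))) :
    stdSimplex.map i.succAbove u i = 0 := by
  classical
  rw [stdSimplex.map_coe, FunOnFinite.linearMap_apply_apply]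
  refine Finset.sum_eq_zero fun j hj => ?_
  simp at hj

theorem map_succAbove_succAbove (u : stdSimplex ℝ (Fin (p + 1))) (j : Fin (p + 1)) :
    stdSimplex.map i.succAbove u (i.succAbove j) = u j := by
  classical
  rw [stdSimplex.map_coe, FunOnFinite.linearMap_apply_apply,
    Finset.sum_eq_single_of_mem j (by simp)]
  intro k hk hkj
  rw [Finset.mem_filter] at hk
  exact absurd (Fin.succAbove_right_injective hk.2) hkj

theorem exists_eq_map_succAbove {u : stdSimplex ℝ (Fin (p + 2))} (h : u i = 0) :
    ∃ v : stdSimplex ℝ (Fin (p + 1)), u = stdSimplex.map i.succAbove v := by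
  refine ⟨⟨fun j => u (i.succAbove j), fun j => u.2.1 _, ?_⟩, ?_⟩
  · have := u.2.2
    rw [Fin.sum_univ_succAbove _ i] at this
    change u i + _ = 1 at this
    rw [h, zero_add] at this
    exact this
  · ext j
    rcases Fin.eq_self_or_eq_succAbove i j with rfl | ⟨k, rfl⟩
    · rw [map_succAbove_self, h]
    · rw [map_succAbove_succAbove]
      rfl

theorem map_succAbove_comp (u : stdSimplex ℝ (Fin (p + 1))) :
    (fun j => stdSimplex.map i.succAbove u (i.succAbove j)) = u :=
  funext fun j => map_succAbove_succAbove i u j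

theorem isClosedEmbedding_map_succAbove :
    Topology.IsClosedEmbedding
      (stdSimplex.map i.succAbove : stdSimplex ℝ (Fin (p + 1)) → stdSimplex ℝ (Fin (p + 2))) := by
  apply (stdSimplex.continuous_map _).isClosedEmbedding
  intro u v h
  ext j
  rw [← map_succAbove_succAbove i u, ← map_succAbove_succAbove i v, h]

end FaceInclusion

namespace SemiSimplicialSet

variable (X : SemiSimplicialSet)

open Classical in
/-- Remove the zero coordinates of a point one after the other, starting with the first. -/
noncomputable def normalForm : (p : ℕ) → X.obj p → (Fin (p + 1) → ℝ) →
    Σ p : ℕ, X.obj p × (Fin (p + 1) → ℝ)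
  | 0, x, u => ⟨0, x, u⟩
  | p + 1, x, u =>
    if h : ∃ i, u i = 0 then
      normalForm p (X.face p (exists_least_zero h).choose x)
        (fun j => u ((exists_least_zero h).choose.succAbove j))
    else ⟨p + 1, x, u⟩

theorem normalForm_eq_self {p : ℕ} (x : X.obj p) (u : Fin (p + 1) → ℝ) (h : ∀ i, u i ≠ 0) :
    X.normalForm p x u = ⟨p, x, u⟩ := by
  cases p with
  | zero => rfl
  | succ p => rw [normalForm, dif_neg]; push Not; exact h

theorem normalForm_eq_least {p : ℕ} (x : X.obj (p + 1)) (u : Fin (p + 2) → ℝ)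
    (i : Fin (p + 2)) (hi : u i = 0) (hlt : ∀ j < i, u j ≠ 0) :
    X.normalForm (p + 1) x u = X.normalForm p (X.face p i x) (fun j => u (i.succAbove j)) := by
  have h : ∃ i, u i = 0 := ⟨i, hi⟩
  have e : (exists_least_zero h).choose = i := by
    obtain ⟨h1, h2⟩ := (exists_least_zero h).choose_spec
    rcases lt_trichotomy (exists_least_zero h).choose i with hl | hl | hl
    · exact absurd h1 (hlt _ hl)
    · exact hl
    · exact absurd hi (h2 _ hl)
  rw [normalForm, dif_pos h, e]

/-- The order in which zero coordinates are removed is irrelevant: the face identity exchanges the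
given zero with the least one. A non-zero coordinate is required because `normalForm` stops in
dimension `0` without looking at the coordinate. -/
theorem normalForm_face {p : ℕ} (x : X.obj (p + 1)) (u : Fin (p + 2) → ℝ) (i : Fin (p + 2))
    (hi : u i = 0) (hu : ∃ j, u j ≠ 0) :
    X.normalForm (p + 1) x u = X.normalForm p (X.face p i x) (fun j => u (i.succAbove j)) := by
  induction p with
  | zero =>
    refine X.normalForm_eq_least x u i hi fun j hj h0 => ?_
    obtain ⟨k, hk⟩ := hu
    fin_cases i <;> fin_cases j <;> fin_cases k <;> simp_all
  | succ p ih =>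
    obtain ⟨i₀, h0, hlt⟩ := exists_least_zero ⟨i, hi⟩
    rcases lt_trichotomy i i₀ with h | rfl | h
    · exact absurd hi (hlt _ h)
    · exact X.normalForm_eq_least x u i hi hlt
    obtain ⟨b, rfl⟩ := Fin.exists_succ_eq.2 (Fin.ne_zero_of_lt h)
    obtain ⟨a, rfl⟩ := Fin.exists_castSucc_eq.2 (Fin.ne_last_of_lt h)
    have hab : a ≤ b := by
      rw [Fin.lt_def, Fin.val_castSucc, Fin.val_succ] at h
      exact Fin.le_def.2 (by omega)
    have nz : ∀ i : Fin (p + 3), u i = 0 → ∃ j, u (i.succAbove j) ≠ 0 := by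
      intro i hi
      obtain ⟨k, hk⟩ := hu
      rcases Fin.eq_self_or_eq_succAbove i k with rfl | ⟨j, rfl⟩
      · exact absurd hi hk
      · exact ⟨j, hk⟩
    rw [X.normalForm_eq_least x u _ h0 hlt,
      ih _ _ b (by rw [Fin.castSucc_succAbove_of_le hab, hi]) (nz _ h0),
      ih (X.face (p + 1) b.succ x) _ a (by rw [Fin.succ_succAbove_of_le hab, h0]) (nz _ hi),
      X.face_face p a b hab x]
    simp only [Fin.succAbove_succAbove_of_le hab]

/-- The point of the realisation with barycentric coordinates `u` in the simplex `x`. -/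
def cell {X : SemiSimplicialSet} {p : ℕ} (x : X.obj p) (u : stdSimplex ℝ (Fin (p + 1))) :
    X.Realisation := Quot.mk _ ⟨⟨p, x⟩, u⟩

variable {X}

theorem cell_map_succAbove {p : ℕ} (x : X.obj (p + 1)) (i : Fin (p + 2))
    (u : stdSimplex ℝ (Fin (p + 1))) : cell x (stdSimplex.map i.succAbove u) =
      cell (X.face p i x) u :=
  Quot.sound (Glue.mk p i x u)

theorem continuous_cell {p : ℕ} (x : X.obj p) : Continuous (cell x) :=
  continuous_quot_mk.comp
    (continuous_sigmaMk (σ := fun x : (Σ p : ℕ, X.obj p) => stdSimplex ℝ (Fin (x.1 + 1)))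
      (i := ⟨p, x⟩))

theorem exists_eq_cell (z : X.Realisation) : ∃ p, ∃ x : X.obj p, ∃ u, z = cell x u := by
  obtain ⟨⟨⟨p, x⟩, u⟩, rfl⟩ := Quot.exists_rep z
  exact ⟨p, x, u, rfl⟩

theorem isClosed_realisation_iff (C : Set X.Realisation) :
    IsClosed C ↔ ∀ p, ∀ x : X.obj p, IsClosed (cell x ⁻¹' C) := by
  refine ⟨fun h p x => h.preimage (continuous_cell x), fun h => ?_⟩
  have hq : Topology.IsQuotientMap (Quot.mk X.Glue) := isQuotientMap_quot_mk
  refine (hq.isClosed_preimage (s := C)).1 (isClosed_sigma_iff.2 ?_)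
  rintro ⟨p, x⟩
  exact h p x

/-- The normal form is constant along the gluing relation and so descends to the realisation; this
is how equal points are compared. -/
theorem normalForm_eq_of_cell_eq {p p' : ℕ} {x : X.obj p} {x' : X.obj p'}
    {u : stdSimplex ℝ (Fin (p + 1))} {u' : stdSimplex ℝ (Fin (p' + 1))}
    (h : cell x u = cell x' u') : X.normalForm p x u = X.normalForm p' x' u' := by
  let F : X.Realisation → Σ p : ℕ, X.obj p × (Fin (p + 1) → ℝ) :=
    Quot.lift (fun c => X.normalForm c.1.1 c.1.2 c.2) (by
      rintro _ _ ⟨p, i, x, u⟩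
      have := X.normalForm_face x (stdSimplex.map i.succAbove u) i (map_succAbove_self i u) (by
        by_contra hc
        push Not at hc
        have := stdSimplex.sum_eq_one (stdSimplex.map (S := ℝ) i.succAbove u)
        rw [Finset.sum_eq_zero fun j _ => hc j] at this
        exact zero_ne_one this)
      rw [map_succAbove_comp] at this
      exact this)
  exact congrArg F h

end SemiSimplicialSet

/-! ### Normal forms in the coset complex -/

/-- Insert a zero in position `c` of a sequence. -/
noncomputable def insertZero (c : ℕ) (v : ℕ → ℝ) : ℕ → ℝ :=
  fun k => if k < c then v k else if k = c then 0 else v (k - 1)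

/-- Insert zeros in the positions of a list, counted from `b`. -/
noncomputable def insertZeros : ℕ → List ℕ → (ℕ → ℝ) → ℕ → ℝ
  | _, [], v => v
  | b, c :: l, v => insertZero (c - b) (insertZeros (b + 1) l v)

/-- Extension of a tuple by zero. -/
noncomputable def extendZero {p : ℕ} (u : Fin (p + 1) → ℝ) : ℕ → ℝ :=
  fun k => if h : k < p + 1 then u ⟨k, h⟩ else 0

theorem extendZero_injective {p : ℕ} :
    Function.Injective (extendZero : (Fin (p + 1) → ℝ) → ℕ → ℝ) := by
  intro u v h
  ext k
  have := congrFun h k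
  simpa only [extendZero, k.2, dif_pos] using this

theorem extendZero_eq_insertZero {p : ℕ} (u : Fin (p + 2) → ℝ) (i : Fin (p + 2)) (hi : u i = 0) :
    extendZero u = insertZero i (extendZero fun j => u (i.succAbove j)) := by
  have hlt := i.2
  ext k
  unfold insertZero extendZero
  split_ifs with h1 h2 h3 h3 h4 h5 h6
  · congr 1; ext; simp [Fin.succAbove, Fin.lt_def, h2]
  · omega
  · subst h3; exact hi
  · congr 1
    ext
    have : ¬ (k - 1 < i.1) := by omega
    simp [Fin.succAbove, Fin.lt_def, this]
    omega
  · omega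
  · omega
  · rfl
  · omega
  · omega
  · rfl

namespace TowerMonoid

open ArtinMonoid SemiSimplicialSet

variable {S : Type*} {M : CoxeterMatrix (Option S)} {n : ℕ}

/-- The simplex `[g]` of dimension `p`. -/
def simplex (M : CoxeterMatrix (Option S)) {n p : ℕ} (hp : p < n) (g : TowerMonoid M n) :
    (cosetComplex M n).obj p :=
  ⟨Quotient.mk (cosetSetoid (parabolic M n (n - p - 1))) g, hp⟩

theorem face_simplex {p : ℕ} (hp : p + 1 < n) (k : Fin (p + 2)) (g : TowerMonoid M n) :
    (cosetComplex M n).face p k (simplex M hp g) =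
      simplex M (by omega : p < n) (g * descend M n (n - (p + 1)) k) := rfl

theorem simplex_eq_of_cosetRel {p : ℕ} (hp : p < n) {g h : TowerMonoid M n}
    (e : CosetRel (parabolic M n (n - p - 1)) g h) : simplex M hp g = simplex M hp h :=
  Subtype.ext (Quotient.sound (.single e))

theorem cosetSetoid_of_simplex_eq {p : ℕ} {hp : p < n} {g h : TowerMonoid M n}
    (e : simplex M hp g = simplex M hp h) :
    cosetSetoid (parabolic M n (n - p - 1)) g h :=
  Quotient.exact (congrArg Subtype.val e)

theorem exists_eq_simplex {p : ℕ} (x : (cosetComplex M n).obj p) :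
    ∃ hp : p < n, ∃ g, x = simplex M hp g := by
  obtain ⟨c, hp⟩ := x
  obtain ⟨g, rfl⟩ := Quotient.exists_rep c
  exact ⟨hp, g, rfl⟩

/-- Zeros are removed from left to right. Each later position drops by one while the offset `n - p`
rises by one, so the entries of `l` are positions in the original simplex. The last clause makes `u`
recoverable from the normal form. -/
theorem normalForm_simplex {p : ℕ} (hp : p < n) (g : TowerMonoid M n) (u : Fin (p + 1) → ℝ) :
    ∃ (l : List ℕ) (p' : ℕ) (hp' : p' < n) (u' : Fin (p' + 1) → ℝ), p = p' + l.length ∧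
      (cosetComplex M n).normalForm p (simplex M hp g) u =
        ⟨p', simplex M hp' (g * chain M n (n - p) l), u'⟩ ∧
      l.Pairwise (· < ·) ∧
      (∀ c ∈ l, ∃ j : Fin (p + 1), u j = 0 ∧ c = n - p + j) ∧
      extendZero u = insertZeros (n - p) l (extendZero u') := by
  induction p generalizing g with
  | zero =>
    exact ⟨[], 0, hp, u, rfl, by simp [chain, normalForm], List.Pairwise.nil, by simp, rfl⟩
  | succ p ih =>
    by_cases h : ∃ i, u i = 0
    · obtain ⟨i, hi, hlt⟩ := exists_least_zero h
      obtain ⟨l, p', hp', u', h1, h2, h3, h4, h5⟩ := ih (by omega)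
        (g * descend M n (n - (p + 1)) i) (fun j => u (i.succAbove j))
      have hnp : n - (p + 1) + 1 = n - p := by omega
      have hl : ∀ c ∈ l, n - (p + 1) + i < c ∧
          ∃ j : Fin (p + 2), u j = 0 ∧ c = n - (p + 1) + j := by
        intro c hc
        obtain ⟨j, hj, rfl⟩ := h4 c hc
        have hij : i ≤ j.castSucc := by
          by_contra hlt'
          push Not at hlt'
          rw [Fin.succAbove_of_castSucc_lt _ _ hlt'] at hj
          exact hlt _ hlt' hj
        refine ⟨?_, i.succAbove j, hj, ?_⟩
        · rw [Fin.le_def, Fin.val_castSucc] at hij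
          omega
        · rw [Fin.succAbove_of_le_castSucc _ _ hij, Fin.val_succ]
          omega
      refine ⟨(n - (p + 1) + i) :: l, p', hp', u', ?_, ?_, ?_, ?_, ?_⟩
      · rw [List.length_cons]; omega
      · rw [normalForm_eq_least _ _ _ i hi hlt, face_simplex, h2, chain, mul_assoc, hnp,
          Nat.add_sub_cancel_left]
      · exact List.Pairwise.cons (fun c hc => (hl c hc).1) h3
      · intro c hc
        rcases List.mem_cons.1 hc with rfl | hc
        · exact ⟨i, hi, rfl⟩
        · exact (hl c hc).2
      · rw [insertZeros, extendZero_eq_insertZero u i hi, h5, hnp, Nat.add_sub_cancel_left]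
    · push Not at h
      exact ⟨[], p + 1, hp, u, rfl, by simp [chain, normalForm_eq_self _ _ _ h],
        List.Pairwise.nil, by simp, rfl⟩

/-- A point of the realisation is represented only once as a point of a top-dimensional simplex
all of whose vanishing coordinates belong to free facets. -/
theorem eq_of_cell_eq {d : ℕ} {g g' : TowerMonoid M (d + 1)}
    (hg : NoEnd (lowGens S (d + 1) 0) g) (hg' : NoEnd (lowGens S (d + 1) 0) g')
    {u u' : stdSimplex ℝ (Fin (d + 1))} (hu : ∀ j, u j = 0 → IsFree g (j + 1))
    (hu' : ∀ j, u' j = 0 → IsFree g' (j + 1))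
    (h : cell (simplex M d.lt_add_one g) u = cell (simplex M d.lt_add_one g') u') :
    g = g' ∧ u = u' := by
  have e := normalForm_eq_of_cell_eq h
  obtain ⟨l, p, hp, v, h1, h2, h3, h4, h5⟩ := normalForm_simplex d.lt_add_one g u
  obtain ⟨l', p', hp', v', h1', h2', h3', h4', h5'⟩ := normalForm_simplex d.lt_add_one g' u'
  rw [h2, h2'] at e
  obtain rfl : p = p' := congrArg (·.1) e
  have e' := eq_of_heq (Sigma.mk.inj e).2
  have hs := (Prod.mk.inj e').1
  obtain rfl := (Prod.mk.inj e').2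
  have hd : d + 1 - d = 1 := by omega
  rw [hd] at hs h4 h5 h4' h5'
  have key : ∀ {g : TowerMonoid M (d + 1)} {u : stdSimplex ℝ (Fin (d + 1))} {l : List ℕ},
      (∀ j, u j = 0 → IsFree g (j + 1)) → l.Pairwise (· < ·) →
      (∀ c ∈ l, ∃ j : Fin (d + 1), u j = 0 ∧ c = 1 + j) →
      IsAscending (d + 1) l ∧ ∀ c ∈ l, IsFree g c := by
    intro g u l hu hl hz
    refine ⟨⟨hl, fun c hc => ?_⟩, fun c hc => ?_⟩
    · obtain ⟨j, -, rfl⟩ := hz c hc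
      have := j.2
      omega
    · obtain ⟨j, hj, rfl⟩ := hz c hc
      rw [add_comm 1 j.1]
      exact hu j hj
  obtain ⟨k1, k2⟩ := key hu h3 h4
  obtain ⟨k1', k2'⟩ := key hu' h3' h4'
  have hlen : l.length = l'.length := by omega
  have hq : d + 1 - p - 1 = l.length := by omega
  have hc := cosetSetoid_of_simplex_eq hs
  rw [hq, parabolic_eq_standard] at hc
  have hprod := (noEnd_mul_chain hg k1 k2).eq_of_cosetSetoid
    (hlen ▸ noEnd_mul_chain hg' k1' k2') hc
  obtain ⟨rfl, rfl⟩ := mul_chain_inj hlen k1 k1' k2 k2' hprod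
  refine ⟨rfl, ?_⟩
  ext j
  exact congrFun (extendZero_injective (h5.trans h5'.symm)) j

end TowerMonoid

section

open Set Topology

/-! ### Spaces with a shelling -/

/-- A shelling of a space `X` that is a union of closed simplices of dimension `d + 1`. The simplex
`x` is glued to simplices of smaller rank along the facets in `shared x`, and to nothing else. -/
structure Shelling {X I : Type*} [TopologicalSpace X] {d : ℕ}
    (χ : I → stdSimplex ℝ (Fin (d + 2)) → X) where
  rank : I → ℕ
  rank_injective : Function.Injective rank
  continuous : ∀ x, Continuous (χ x)
  surjective : ∀ z, ∃ x u, z = χ x u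
  isClosed : ∀ C : Set X, (∀ x, IsClosed (χ x ⁻¹' C)) → IsClosed C
  shared : I → Finset (Fin (d + 2))
  glue : ∀ x, ∀ j ∈ shared x, ∃ x' j', rank x' < rank x ∧
    ∀ v, χ x (stdSimplex.map j.succAbove v) = χ x' (stdSimplex.map (j' : Fin (d + 2)).succAbove v)
  unique : ∀ x x' u u', (∀ j ∈ shared x, u j ≠ 0) → (∀ j ∈ shared x', u' j ≠ 0) →
    χ x u = χ x' u' → x = x' ∧ u = u'
  first : ∀ x, shared x = ∅ → ∀ y, rank x ≤ rank y

namespace Shelling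

variable {X I : Type*} [TopologicalSpace X] {d : ℕ} {χ : I → stdSimplex ℝ (Fin (d + 2)) → X}

/-- A point on a shared facet is rewritten in a simplex of smaller rank until it lies on no shared
facet. -/
theorem exists_reduced (s : Shelling χ) (x : I) (u : stdSimplex ℝ (Fin (d + 2))) :
    ∃ x' u', χ x u = χ x' u' ∧ (∀ j ∈ s.shared x', u' j ≠ 0) ∧ s.rank x' ≤ s.rank x ∧
      ((∃ j ∈ s.shared x, u j = 0) → s.rank x' < s.rank x) := by
  generalize hr : s.rank x = r
  induction r using Nat.strong_induction_on generalizing x u with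
  | _ r ih =>
    subst hr
    by_cases h : ∃ j ∈ s.shared x, u j = 0
    · obtain ⟨j, hj, hu⟩ := h
      obtain ⟨v, rfl⟩ := exists_eq_map_succAbove j hu
      obtain ⟨y, j', hy, hv⟩ := s.glue x j hj
      obtain ⟨x', u', h1, h2, h3, -⟩ := ih _ hy y (stdSimplex.map j'.succAbove v) rfl
      exact ⟨x', u', (hv v).trans h1, h2, by omega, fun _ => by omega⟩
    · exact ⟨x, u, rfl, fun j hj hu => h ⟨j, hj, hu⟩, le_rfl, fun h' => absurd h' h⟩

/-- Closedness is tested on each simplex `y`, by induction on the sum of the two ranks. A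
coincidence between points of `x` and `y` occurs on a shared facet of `y`, or on one of `x`, or else
`x = y` and the points agree. In the first two cases the facet is moved to a simplex of smaller
rank. -/
theorem isClosedMap (s : Shelling χ) (x : I) : IsClosedMap (χ x) := by
  intro C hC
  apply s.isClosed
  intro y
  generalize hr : s.rank x + s.rank y = r
  induction r using Nat.strong_induction_on generalizing x y C with
  | _ r ih =>
    subst hr
    have : Nonempty I := ⟨x⟩
    choose! fx jx hfx hjx using s.glue x
    choose! fy jy hfy hjy using s.glue y
    let A : s.shared y → Set (stdSimplex ℝ (Fin (d + 2))) := fun j =>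
      stdSimplex.map j.1.succAbove ''
        (stdSimplex.map (jy j).succAbove ⁻¹' (χ (fy j) ⁻¹' (χ x '' C)))
    let D : s.shared x → Set (stdSimplex ℝ (Fin (d + 2))) := fun j =>
      χ y ⁻¹' (χ (fx j) '' (stdSimplex.map (jx j).succAbove ''
        (stdSimplex.map j.1.succAbove ⁻¹' C)))
    have hA : IsClosed (⋃ j, A j) := by
      refine isClosed_iUnion_of_finite fun j => ?_
      apply (isClosedEmbedding_map_succAbove _).isClosedMap
      apply IsClosed.preimage (stdSimplex.continuous_map _)
      exact ih _ (by have := hfy j j.2; omega) x C hC (fy j) rfl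
    have hD : IsClosed (⋃ j, D j) := by
      refine isClosed_iUnion_of_finite fun j => ?_
      refine ih _ (by have := hfx j j.2; omega) (fx j) _ ?_ y rfl
      exact (isClosedEmbedding_map_succAbove _).isClosedMap _
        (hC.preimage (stdSimplex.continuous_map _))
    have hE : IsClosed {u | x = y ∧ u ∈ C} := by
      by_cases h : x = y <;> simp [h, hC]
    have key : χ y ⁻¹' (χ x '' C) = (⋃ j, A j) ∪ (⋃ j, D j) ∪ {u | x = y ∧ u ∈ C} := by
      ext u
      constructor
      · rintro ⟨c, hc, hcu⟩
        by_cases hu : ∃ j ∈ s.shared y, u j = 0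
        · obtain ⟨j, hj, hu⟩ := hu
          obtain ⟨v, rfl⟩ := exists_eq_map_succAbove j hu
          exact Or.inl (Or.inl (mem_iUnion.2 ⟨⟨j, hj⟩, v, ⟨c, hc, by rw [hcu, hjy j hj]⟩, rfl⟩))
        by_cases hc' : ∃ j ∈ s.shared x, c j = 0
        · obtain ⟨j, hj, hc'⟩ := hc'
          obtain ⟨v, rfl⟩ := exists_eq_map_succAbove j hc'
          exact Or.inl (Or.inr (mem_iUnion.2 ⟨⟨j, hj⟩, _, ⟨v, hc, rfl⟩, by
            rw [← hcu, hjx j hj]⟩))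
        · push Not at hu hc'
          obtain ⟨rfl, rfl⟩ := s.unique _ _ _ _ hc' hu hcu
          exact Or.inr ⟨rfl, hc⟩
      · rintro ((h | h) | ⟨rfl, h⟩)
        · obtain ⟨⟨j, hj⟩, v, ⟨c, hc, hcv⟩, rfl⟩ := mem_iUnion.1 h
          exact ⟨c, hc, by rw [hcv, hjy j hj]⟩
        · obtain ⟨⟨j, hj⟩, _, ⟨v, hv, rfl⟩, h⟩ := mem_iUnion.1 h
          exact ⟨_, hv, by rw [← h, hjx j hj]⟩
        · exact ⟨u, h, rfl⟩
    rw [key]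
    exact (hA.union hD).union hE

theorem isProperMap (s : Shelling χ) (x : I) : IsProperMap (χ x) := by
  rw [isProperMap_iff_isClosedMap_and_compact_fibers]
  refine ⟨s.continuous x, s.isClosedMap x, fun z => ?_⟩
  by_cases h : ∃ u, χ x u = z
  · obtain ⟨u, rfl⟩ := h
    have := s.isClosedMap x {u} isClosed_singleton
    rw [image_singleton] at this
    exact (this.preimage (s.continuous x)).isCompact
  · have : χ x ⁻¹' {z} = ∅ := by
      ext u; simpa using fun hu => h ⟨u, hu⟩
    rw [this]
    exact isCompact_empty

/-! ### The filtration by stages -/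

/-- The union of the simplices of rank less than `k`. -/
def stage (s : Shelling χ) (k : ℕ) : Set X := {z | ∃ x u, s.rank x < k ∧ z = χ x u}

theorem stage_mono (s : Shelling χ) {k l : ℕ} (h : k ≤ l) : s.stage k ⊆ s.stage l := by
  rintro z ⟨x, u, hx, rfl⟩
  exact ⟨x, u, by omega, rfl⟩

theorem isClosed_stage (s : Shelling χ) (k : ℕ) : IsClosed (s.stage k) := by
  have hfin : {x | s.rank x < k}.Finite :=
    Set.Finite.preimage s.rank_injective.injOn (Set.finite_Iio k)
  have : s.stage k = ⋃ x ∈ {x | s.rank x < k}, range (χ x) := by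
    ext z
    simp only [stage, mem_ofPred_eq, mem_iUnion, mem_range, exists_prop]
    constructor
    · rintro ⟨x, u, hx, rfl⟩; exact ⟨x, hx, u, rfl⟩
    · rintro ⟨x, hx, u, rfl⟩; exact ⟨x, u, hx, rfl⟩
  rw [this]
  exact hfin.isClosed_biUnion fun x _ => (s.isClosedMap x).isClosed_range

theorem mem_stage_iff (s : Shelling χ) {x : I} {u : stdSimplex ℝ (Fin (d + 2))} :
    χ x u ∈ s.stage (s.rank x) ↔ ∃ j ∈ s.shared x, u j = 0 := by
  constructor
  · rintro ⟨y, v, hy, h⟩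
    by_contra hu
    push Not at hu
    obtain ⟨x', u', h1, h2, h3, -⟩ := s.exists_reduced y v
    obtain ⟨rfl, -⟩ := s.unique _ _ _ _ hu h2 (h.trans h1)
    omega
  · intro h
    obtain ⟨x', u', h1, h2, h3, h4⟩ := s.exists_reduced x u
    exact ⟨x', u', h4 h, h1⟩

/-- Otherwise choose points of `K` outside each stage. A simplex contains only those with index at
most its rank, so every tail of the sequence is closed, and the complements of the tails form a
directed open cover of `K` with no single member containing `K`. -/
theorem exists_subset_stage (s : Shelling χ) {K : Set X} (hK : IsCompact K) : ∃ k, K ⊆ s.stage k := by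
  by_contra hcon
  push Not at hcon
  have : ∀ k, ∃ z ∈ K, z ∉ s.stage k := fun k => by
    simpa [Set.subset_def] using hcon k
  choose p hpK hp using this
  have hclosed : ∀ k, IsClosed (p '' Ici k) := by
    intro k
    apply s.isClosed
    intro x
    have hsub : χ x ⁻¹' (p '' Ici k) =
        ⋃ m ∈ {m | m ∈ Ici k ∧ m ≤ s.rank x ∧ p m ∈ range (χ x)}, χ x ⁻¹' {p m} := by
      ext u
      simp only [mem_preimage, mem_image, mem_iUnion, mem_singleton_iff, mem_ofPred_eq,
        exists_prop]
      constructor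
      · rintro ⟨m, hm, h⟩
        refine ⟨m, ⟨hm, ?_, u, h.symm⟩, h.symm⟩
        by_contra hlt
        exact hp m ⟨x, u, by omega, h⟩
      · rintro ⟨m, ⟨hm, -⟩, h⟩
        exact ⟨m, hm, h.symm⟩
    rw [hsub]
    apply Set.Finite.isClosed_biUnion
    · exact (Set.finite_Iic (s.rank x)).subset fun m hm => hm.2.1
    · rintro m ⟨-, -, u, hu⟩
      rw [← hu]
      have := s.isClosedMap x {u} isClosed_singleton
      rw [image_singleton] at this
      exact this.preimage (s.continuous x)
  obtain ⟨k, hk⟩ := hK.elim_directed_cover (fun k => (p '' Ici k)ᶜ)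
    (fun k => (hclosed k).isOpen_compl) (by
      intro z _
      obtain ⟨x, u, rfl⟩ := s.surjective z
      refine mem_iUnion.2 ⟨s.rank x + 1, ?_⟩
      rintro ⟨m, hm, h⟩
      rw [mem_Ici] at hm
      exact hp m ⟨x, u, by omega, h⟩) (by
      refine directed_of_isDirected_le fun a b hab => ?_
      apply compl_subset_compl.2
      exact image_mono (Ici_subset_Ici.2 hab))
  exact hk (hpK k) ⟨k, mem_Ici.2 le_rfl, rfl⟩

/-- Gluing continuous maps along the attachment of one simplex. -/
theorem exists_glue (s : Shelling χ) {L Y : Type*} [TopologicalSpace L] [TopologicalSpace Y] (x : I) {g : L → X}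
    (hg : Continuous g) (hr : ∀ l, g l ∈ s.stage (s.rank x) ∨ ∃ u, g l = χ x u) {ψ : L → Y}
    (hψ : Continuous ψ) {φ : L × stdSimplex ℝ (Fin (d + 2)) → Y} (hφ : Continuous φ)
    (hcomp : ∀ l u, g l = χ x u → (∃ j ∈ s.shared x, u j = 0) → φ (l, u) = ψ l) :
    ∃ h : L → Y, Continuous h ∧ (∀ l, g l ∈ s.stage (s.rank x) → h l = ψ l) ∧
      ∀ l u, g l = χ x u → h l = φ (l, u) := by
  have hex : ∀ l, ∃ y : Y, (g l ∈ s.stage (s.rank x) → y = ψ l) ∧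
      ∀ u, g l = χ x u → y = φ (l, u) := by
    intro l
    by_cases h : g l ∈ s.stage (s.rank x)
    · refine ⟨ψ l, fun _ => rfl, fun u hu => (hcomp l u hu ?_).symm⟩
      rwa [hu, s.mem_stage_iff] at h
    · obtain ⟨u, hu⟩ := (hr l).resolve_left h
      refine ⟨φ (l, u), fun h' => absurd h' h, fun v hv => ?_⟩
      have hu' := h
      have hv' := h
      rw [hu, s.mem_stage_iff] at hu'
      rw [hv, s.mem_stage_iff] at hv'
      push Not at hu' hv'
      rw [(s.unique _ _ _ _ hu' hv' (hu.symm.trans hv)).2]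
  choose h h1 h2 using hex
  refine ⟨h, ?_, h1, h2⟩
  rw [continuous_iff_isClosed]
  intro C hC
  -- The attaching map is proper, hence still closed after taking the product with `L`; closedness
  -- alone would not suffice.
  have hprop : IsClosedMap (Prod.map id (χ x) : L × stdSimplex ℝ (Fin (d + 2)) → L × X) :=
    (isProperMap_id.prodMap (s.isProperMap x)).isClosedMap
  have key : h ⁻¹' C = (ψ ⁻¹' C ∩ g ⁻¹' s.stage (s.rank x)) ∪
      (fun l => (l, g l)) ⁻¹' (Prod.map id (χ x) '' (φ ⁻¹' C)) := by
    ext l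
    constructor
    · intro hl
      by_cases hm : g l ∈ s.stage (s.rank x)
      · exact Or.inl ⟨by rw [mem_preimage, ← h1 l hm]; exact hl, hm⟩
      · obtain ⟨u, hu⟩ := (hr l).resolve_left hm
        refine Or.inr ⟨(l, u), ?_, by simp [hu]⟩
        rw [mem_preimage, ← h2 l u hu]
        exact hl
    · rintro (⟨hl, hm⟩ | ⟨⟨l', u⟩, hlu, he⟩)
      · rw [mem_preimage, h1 l hm]; exact hl
      · simp only [Prod.map, id, Prod.mk.injEq] at he
        obtain ⟨rfl, hu⟩ := he
        rw [mem_preimage, h2 l' u hu.symm]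
        exact hlu
  rw [key]
  exact ((hC.preimage hψ).inter ((s.isClosed_stage _).preimage hg)).union
    ((hprop _ (hC.preimage hφ)).preimage (continuous_id.prodMk hg))

theorem stage_succ (s : Shelling χ) (x : I) {z : X} (hz : z ∈ s.stage (s.rank x + 1)) :
    z ∈ s.stage (s.rank x) ∨ ∃ u, z = χ x u := by
  obtain ⟨y, u, hy, rfl⟩ := hz
  rcases Nat.lt_or_ge (s.rank y) (s.rank x) with h | h
  · exact Or.inl ⟨y, u, h, rfl⟩
  · have : y = x := s.rank_injective (by omega)
    exact Or.inr ⟨u, by rw [this]⟩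

/-- A deformation of a simplex that fixes the shared facets induces a homotopy. -/
theorem exists_homotopic (s : Shelling χ) {K : Type*} [TopologicalSpace K] (x : I) (g : C(K, X))
    (hg : ∀ z, g z ∈ s.stage (s.rank x + 1))
    (R : K × unitInterval → stdSimplex ℝ (Fin (d + 2)) → stdSimplex ℝ (Fin (d + 2)))
    (hR : Continuous fun q : (K × unitInterval) × stdSimplex ℝ (Fin (d + 2)) => R q.1 q.2)
    (h0 : ∀ z u, R (z, 0) u = u)
    (hfix : ∀ q u, (∃ j ∈ s.shared x, u j = 0) → R q u = u) :
    ∃ g' : C(K, X), g.Homotopic g' ∧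
      (∀ z, g z ∈ s.stage (s.rank x) → g' z = g z) ∧
      ∀ z u, g z = χ x u → g' z = χ x (R (z, 1) u) := by
  obtain ⟨h, hc, h1, h2⟩ := s.exists_glue x (g := fun q : K × unitInterval => g q.1)
    (by fun_prop) (fun q => s.stage_succ x (hg q.1)) (ψ := fun q => g q.1) (by fun_prop)
    (φ := fun q => χ x (R q.1 q.2)) ((s.continuous x).comp hR)
    (fun q u hq hu => by rw [hfix q u hu, hq])
  have hz0 : ∀ z, h (z, 0) = g z := by
    intro z
    rcases s.stage_succ x (hg z) with hz | ⟨u, hu⟩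
    · exact h1 _ hz
    · rw [h2 (z, 0) u hu, h0, hu]
  refine ⟨⟨fun z => h (z, 1), by fun_prop⟩, ⟨⟨⟨fun q => h (q.2, q.1), by fun_prop⟩, hz0,
    fun z => rfl⟩⟩, fun z hz => h1 _ hz, fun z u hu => h2 _ u hu⟩

end Shelling

/-! ### Deformations of the standard simplex -/

section MinCoord

variable {m : ℕ}

/-- The minimum of the coordinates in `J`. -/
noncomputable def minCoord (J : Finset (Fin m)) (hJ : J.Nonempty) (u : stdSimplex ℝ (Fin m)) : ℝ :=
  J.inf' hJ fun j => u j

theorem continuous_coord (j : Fin m) : Continuous fun u : stdSimplex ℝ (Fin m) => u j :=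
  (continuous_apply j).comp continuous_subtype_val

theorem continuous_minCoord (J : Finset (Fin m)) (hJ : J.Nonempty) :
    Continuous (minCoord J hJ) :=
  Continuous.finset_inf'_apply hJ fun j _ => continuous_coord j

theorem minCoord_le {J : Finset (Fin m)} (hJ : J.Nonempty) (u : stdSimplex ℝ (Fin m)) {j : Fin m}
    (hj : j ∈ J) : minCoord J hJ u ≤ u j :=
  Finset.inf'_le _ hj

theorem minCoord_nonneg {J : Finset (Fin m)} (hJ : J.Nonempty) (u : stdSimplex ℝ (Fin m)) :
    0 ≤ minCoord J hJ u :=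
  Finset.le_inf' _ _ fun j _ => u.2.1 j

theorem exists_minCoord_eq {J : Finset (Fin m)} (hJ : J.Nonempty) (u : stdSimplex ℝ (Fin m)) :
    ∃ j ∈ J, minCoord J hJ u = u j :=
  Finset.exists_mem_eq_inf' hJ _

theorem minCoord_eq_zero {J : Finset (Fin m)} (hJ : J.Nonempty) {u : stdSimplex ℝ (Fin m)}
    (h : ∃ j ∈ J, u j = 0) : minCoord J hJ u = 0 := by
  obtain ⟨j, hj, h0⟩ := h
  exact le_antisymm (h0 ▸ minCoord_le hJ u hj) (minCoord_nonneg hJ u)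

theorem eq_of_forall_inv_le {u : stdSimplex ℝ (Fin m)} (h : ∀ j, (1 / m : ℝ) ≤ u j) (j : Fin m) :
    u j = 1 / m := by
  have hm : (m : ℝ) ≠ 0 := by
    have := j.pos
    positivity
  have hs : ∑ j, (u j - 1 / m) = 0 := by
    rw [Finset.sum_sub_distrib, stdSimplex.sum_eq_one]
    simp [hm]
  have := (Finset.sum_eq_zero_iff_of_nonneg fun j _ => sub_nonneg.2 (h j)).1 hs j
    (Finset.mem_univ j)
  linarith

theorem minCoord_univ_le (hJ : (Finset.univ : Finset (Fin m)).Nonempty)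
    (u : stdSimplex ℝ (Fin m)) : minCoord Finset.univ hJ u ≤ 1 / m := by
  by_contra h
  push Not at h
  obtain ⟨j, -⟩ := id hJ
  have h1 : ∀ i, 1 / (m : ℝ) < u i := fun i => lt_of_lt_of_le h (minCoord_le _ u (Finset.mem_univ i))
  exact (h1 j).ne' (eq_of_forall_inv_le (fun i => (h1 i).le) j)

end MinCoord

/-- Every map from `K` to a Euclidean space of dimension `d` can be moved off the origin. -/
def GeneralPosition (K : Type*) [TopologicalSpace K] (d : ℕ) : Prop :=
  ∀ F : C(K, Fin d → ℝ), ∀ ε > 0, ∃ F' : C(K, Fin d → ℝ),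
    (∀ z, F' z ≠ 0) ∧ ∀ z, ‖F' z - F z‖ < ε

/-! ### Pushing maps down through the stages -/

namespace Shelling

variable {X I : Type*} [TopologicalSpace X] {d : ℕ} {χ : I → stdSimplex ℝ (Fin (d + 2)) → X}
  {K : Type*} [TopologicalSpace K]

/-- Such a simplex has least rank, so the image lies in it alone, and the straight-line contraction
to a vertex applies. -/
theorem nullhomotopic_of_shared_eq_empty (s : Shelling χ) (x : I) (hx : s.shared x = ∅)
    (g : C(K, X)) (hg : ∀ z, g z ∈ s.stage (s.rank x + 1)) : g.Nullhomotopic := by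
  let b : stdSimplex ℝ (Fin (d + 2)) := stdSimplex.vertex 0
  obtain ⟨g', hgg', -, h⟩ := s.exists_homotopic x g hg
    (fun q u => ⟨fun j => (1 - (q.2 : ℝ)) * u j + q.2 * b j, fun j => by
      have h1 := q.2.2.1
      have h2 := q.2.2.2
      have := u.2.1 j
      have := b.2.1 j
      exact add_nonneg (mul_nonneg (by linarith) (by assumption))
        (mul_nonneg h1 (by assumption)), by
      rw [Finset.sum_add_distrib, ← Finset.mul_sum, ← Finset.mul_sum, stdSimplex.sum_eq_one,
        stdSimplex.sum_eq_one]
      ring⟩)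
    (by
      apply Continuous.subtype_mk
      apply continuous_pi
      intro j
      have := (continuous_coord j).comp
        (continuous_snd : Continuous fun q : (K × unitInterval) × stdSimplex ℝ (Fin (d + 2)) => q.2)
      simp only [Function.comp_def] at this
      fun_prop)
    (by intro z u; ext j; simp [DFunLike.coe])
    (by simp [hx])
  refine ⟨χ x b, ?_⟩
  have : g' = ContinuousMap.const K (χ x b) := by
    ext z
    rcases s.stage_succ x (hg z) with hz | ⟨u, hu⟩
    · obtain ⟨y, u, hy, -⟩ := hz
      have := s.first x hx y
      omega
    · rw [h z u hu]
      simp only [ContinuousMap.const_apply]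
      congr 1
      ext j
      simp [DFunLike.coe]
  exact this ▸ hgg'

/-- All coordinates in `J` are lowered by their minimum, and the mass is moved to the coordinates
outside `J`. This retracts the simplex onto the shared facets, where the minimum is zero and nothing
moves. -/
theorem exists_homotopic_stage_of_ne_univ (s : Shelling χ) (x : I) (hx : (s.shared x).Nonempty)
    (hx' : ∃ j, j ∉ s.shared x) (g : C(K, X)) (hg : ∀ z, g z ∈ s.stage (s.rank x + 1)) :
    ∃ g' : C(K, X), g.Homotopic g' ∧ ∀ z, g' z ∈ s.stage (s.rank x) := by
  set J := s.shared x with hJ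
  -- The weight that keeps the sum of the coordinates constant.
  let a : ℝ := J.card / (Jᶜ).card
  have ha : 0 ≤ a := by positivity
  let v : Fin (d + 2) → ℝ := fun j => if j ∈ J then -1 else a
  have hcard : ((Jᶜ).card : ℝ) ≠ 0 := by
    obtain ⟨j, hj⟩ := hx'
    have : (Jᶜ).Nonempty := ⟨j, Finset.mem_compl.2 hj⟩
    exact_mod_cast this.card_pos.ne'
  have hv : ∑ j, v j = 0 := by
    rw [← Finset.sum_add_sum_compl J, Finset.sum_congr rfl fun j (hj : j ∈ J) =>
      show v j = -1 from if_pos hj, Finset.sum_congr rfl fun j (hj : j ∈ Jᶜ) =>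
      show v j = a from if_neg (Finset.mem_compl.1 hj)]
    simp only [Finset.sum_const, nsmul_eq_mul, a]
    field_simp
    ring
  obtain ⟨g', hgg', h1, h2⟩ := s.exists_homotopic x g hg
    (fun q u => ⟨fun j => u j + q.2 * minCoord J hx u * v j, fun j => by
      have h1 := q.2.2.1
      have h2 := q.2.2.2
      have h3 := minCoord_nonneg hx u
      by_cases hj : j ∈ J
      · have h4 := minCoord_le hx u hj
        simp only [v, if_pos hj]
        nlinarith
      · simp only [v, if_neg hj]
        have := u.2.1 j
        exact add_nonneg this (by positivity), by
      rw [Finset.sum_add_distrib, ← Finset.mul_sum, stdSimplex.sum_eq_one, hv]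
      ring⟩)
    (by
      apply Continuous.subtype_mk
      apply continuous_pi
      intro j
      have h1 := (continuous_coord j).comp
        (continuous_snd : Continuous fun q : (K × unitInterval) × stdSimplex ℝ (Fin (d + 2)) => q.2)
      have h2 := (continuous_minCoord J hx).comp
        (continuous_snd : Continuous fun q : (K × unitInterval) × stdSimplex ℝ (Fin (d + 2)) => q.2)
      simp only [Function.comp_def] at h1 h2
      fun_prop)
    (by intro z u; ext j; simp [DFunLike.coe])
    (by
      intro q u hu
      ext j
      simp [DFunLike.coe, minCoord_eq_zero hx hu])
  refine ⟨g', hgg', fun z => ?_⟩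
  rcases s.stage_succ x (hg z) with hz | ⟨u, hu⟩
  · rw [h1 z hz]; exact hz
  · rw [h2 z u hu, s.mem_stage_iff]
    obtain ⟨j, hj, hm⟩ := exists_minCoord_eq hx u
    refine ⟨j, hj, ?_⟩
    change u j + ((1 : unitInterval) : ℝ) * minCoord J hx u * v j = 0
    simp only [v, if_pos hj, hm]
    simp

/-- The last `d + 1` coordinates minus `c`, cut off near the boundary, give a map to a Euclidean
space. General position moves it off the origin, and the correction is carried back into the
simplex, again with the cut-off. -/
theorem exists_homotopic_avoiding_barycenter (s : Shelling χ) (hK : GeneralPosition K (d + 1))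
    (x : I) (g : C(K, X))
    (hg : ∀ z, g z ∈ s.stage (s.rank x + 1)) :
    ∃ g' : C(K, X), g.Homotopic g' ∧ ∀ z, g' z ∈ s.stage (s.rank x) ∨
      ∃ u, g' z = χ x u ∧ minCoord Finset.univ Finset.univ_nonempty u < 1 / (d + 2 : ℕ) := by
  set c : ℝ := 1 / (d + 2 : ℕ) with hc
  have hc0 : 0 < c := by positivity
  set κ : ℝ := c / 4 with hκ
  have hκ0 : 0 < κ := by positivity
  let m : stdSimplex ℝ (Fin (d + 2)) → ℝ := minCoord Finset.univ Finset.univ_nonempty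
  have hm : Continuous m := continuous_minCoord _ _
  have hm0 : ∀ u, 0 ≤ m u := minCoord_nonneg _
  have hmle : ∀ u j, m u ≤ u j := fun u j => minCoord_le _ u (Finset.mem_univ j)
  -- The cut-off is `0` on the boundary and `1` where all coordinates are at least `κ`. The bound
  -- `lam u * κ ≤ m u` keeps the displaced coordinates non-negative.
  let lam : stdSimplex ℝ (Fin (d + 2)) → ℝ := fun u => min 1 (m u / κ)
  have hlam : Continuous lam := continuous_const.min (hm.div_const κ)
  have hlam0 : ∀ u, 0 ≤ lam u := fun u => le_min zero_le_one (div_nonneg (hm0 u) hκ0.le)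
  have hlam1 : ∀ u, lam u ≤ 1 := fun u => min_le_left _ _
  have hlamκ : ∀ u, lam u * κ ≤ m u := fun u => by
    rw [← le_div_iff₀ hκ0]; exact min_le_right _ _
  have hbd : ∀ u : stdSimplex ℝ (Fin (d + 2)), (∃ j ∈ s.shared x, u j = 0) → lam u = 0 := by
    rintro u ⟨j, -, hj⟩
    have : m u = 0 := minCoord_eq_zero _ ⟨j, Finset.mem_univ j, hj⟩
    simp [lam, this]
  obtain ⟨F, hF, hF0, hFu⟩ := s.exists_glue x g.continuous (fun z => s.stage_succ x (hg z))
    (ψ := fun _ : K => (0 : Fin (d + 1) → ℝ)) continuous_const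
    (φ := fun q j => lam q.2 * (q.2 j.succ - c))
    (by
      apply continuous_pi
      intro j
      have h1 := (continuous_coord j.succ).comp
        (continuous_snd : Continuous fun q : K × stdSimplex ℝ (Fin (d + 2)) => q.2)
      have h2 := hlam.comp
        (continuous_snd : Continuous fun q : K × stdSimplex ℝ (Fin (d + 2)) => q.2)
      simp only [Function.comp_def] at h1 h2
      fun_prop)
    (by
      intro z u _ hu
      ext j
      simp [hbd u hu])
  obtain ⟨F', hF'0, hF'⟩ := hK ⟨F, hF⟩ (κ / (d + 2 : ℕ)) (by positivity)
  -- The first entry makes the displacement sum to zero; the tolerance `κ / (d + 2)` bounds that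
  -- entry too by `κ`.
  let e : K → Fin (d + 2) → ℝ := fun z => Fin.cons (-∑ j, (F' z j - F z j)) fun j => F' z j - F z j
  have hesum : ∀ z, ∑ j, e z j = 0 := fun z => by
    simp [e, Fin.sum_univ_succ, Fin.cons_zero, Fin.cons_succ]
  have hcoord : ∀ z (j : Fin (d + 1)), |F' z j - F z j| ≤ κ / (d + 2 : ℕ) := fun z j =>
    (norm_le_pi_norm (F' z - F z) j).trans (hF' z).le
  have hebd : ∀ z j, |e z j| ≤ κ := by
    intro z j
    refine Fin.cases ?_ (fun j => ?_) j
    · simp only [e, Fin.cons_zero, abs_neg]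
      refine (Finset.abs_sum_le_sum_abs _ _).trans
        ((Finset.sum_le_sum fun j _ => hcoord z j).trans ?_)
      rw [Finset.sum_const, Finset.card_univ, Fintype.card_fin, nsmul_eq_mul, mul_div_assoc',
        div_le_iff₀ (by positivity)]
      push_cast
      nlinarith
    · simp only [e, Fin.cons_succ]
      refine (hcoord z j).trans (div_le_self hκ0.le ?_)
      push_cast
      have : (0 : ℝ) ≤ d := Nat.cast_nonneg d
      linarith
  have hecont : ∀ j, Continuous fun z => e z j := by
    intro j
    refine Fin.cases ?_ (fun j => ?_) j
    · simp only [e, Fin.cons_zero]; fun_prop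
    · simp only [e, Fin.cons_succ]; fun_prop
  have hmove : ∀ (t : unitInterval) u z j, |(t : ℝ) * lam u * e z j| ≤ lam u * κ := by
    intro t u z j
    rw [abs_mul, abs_of_nonneg (mul_nonneg t.2.1 (hlam0 u))]
    have h1 := hebd z j
    have h2 := t.2.2
    have h3 := hlam0 u
    calc (t : ℝ) * lam u * |e z j| ≤ 1 * lam u * κ := by gcongr
      _ = lam u * κ := by ring
  obtain ⟨g', hgg', h1, h2⟩ := s.exists_homotopic x g hg
    (fun q u => ⟨fun j => u j + q.2 * lam u * e q.1 j, fun j => by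
      have h1 := hmove q.2 u q.1 j
      have h2 := hlamκ u
      have h3 := hmle u j
      have h4 := neg_abs_le ((q.2 : ℝ) * lam u * e q.1 j)
      simp only
      linarith, by
      rw [Finset.sum_add_distrib, ← Finset.mul_sum, stdSimplex.sum_eq_one, hesum]
      ring⟩)
    (by
      apply Continuous.subtype_mk
      apply continuous_pi
      intro j
      have h1 := (continuous_coord j).comp
        (continuous_snd : Continuous fun q : (K × unitInterval) × stdSimplex ℝ (Fin (d + 2)) => q.2)
      have h2 := hlam.comp
        (continuous_snd : Continuous fun q : (K × unitInterval) × stdSimplex ℝ (Fin (d + 2)) => q.2)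
      have h3 := (hecont j).comp (continuous_fst.comp
        (continuous_fst : Continuous fun q : (K × unitInterval) × stdSimplex ℝ (Fin (d + 2)) =>
          q.1))
      simp only [Function.comp_def] at h1 h2 h3
      fun_prop)
    (by intro z u; ext j; simp [DFunLike.coe])
    (by
      intro q u hu
      ext j
      simp [DFunLike.coe, hbd u hu])
  refine ⟨g', hgg', fun z => ?_⟩
  rcases s.stage_succ x (hg z) with hz | ⟨u, hu⟩
  · left; rw [h1 z hz]; exact hz
  right
  refine ⟨_, h2 z u hu, ?_⟩
  by_contra hcon
  push Not at hcon
  have hle := fun j => hcon.trans (minCoord_le _ _ (Finset.mem_univ j))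
  have heq := eq_of_forall_inv_le hle
  have heq' : ∀ j, u j + lam u * e z j = c := by
    intro j
    have : u j + ((1 : unitInterval) : ℝ) * lam u * e z j = c := heq j
    simpa using this
  -- If the image were the barycentre, then either the cut-off is `1` and `F' z = 0`, or some
  -- coordinate is at most `2 * m u < 2 * κ = c / 2`.
  rcases le_or_gt κ (m u) with hmu | hmu
  · have hl : lam u = 1 := min_eq_left ((one_le_div₀ hκ0).2 hmu)
    apply hF'0 z
    ext j
    have h3 := congrFun (hFu z u hu) j
    have h4 := heq' j.succ
    simp only [e, Fin.cons_succ, hl, one_mul] at h3 h4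
    rw [Pi.zero_apply]
    linarith
  · obtain ⟨j, -, hj⟩ := exists_minCoord_eq Finset.univ_nonempty u
    have h3 := heq' j
    have h4 := hmove 1 u z j
    have h5 := hlamκ u
    have h6 := le_abs_self (((1 : unitInterval) : ℝ) * lam u * e z j)
    have h7 : m u = u j := hj
    rw [Set.Icc.coe_one, one_mul] at h4 h6
    linarith

/-- With the barycentre avoided, radial projection away from it sends the image to the boundary, all
of which is shared. -/
theorem exists_homotopic_stage_of_eq_univ [CompactSpace K] (s : Shelling χ)
    (hK : GeneralPosition K (d + 1)) (x : I) (hx : s.shared x = Finset.univ) (g : C(K, X))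
    (hg : ∀ z, g z ∈ s.stage (s.rank x + 1)) :
    ∃ g' : C(K, X), g.Homotopic g' ∧ ∀ z, g' z ∈ s.stage (s.rank x) := by
  obtain ⟨g₁, hgg₁, hg₁⟩ := s.exists_homotopic_avoiding_barycenter hK x g hg
  set c : ℝ := 1 / (d + 2 : ℕ) with hc
  have hc0 : 0 < c := by positivity
  let m : stdSimplex ℝ (Fin (d + 2)) → ℝ := minCoord Finset.univ Finset.univ_nonempty
  have hm : Continuous m := continuous_minCoord _ _
  have hm0 : ∀ u, 0 ≤ m u := minCoord_nonneg _
  have hmle : ∀ u j, m u ≤ u j := fun u j => minCoord_le _ u (Finset.mem_univ j)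
  have hmc : ∀ u, m u ≤ c := minCoord_univ_le _
  have hbd : ∀ u : stdSimplex ℝ (Fin (d + 2)), (∃ j ∈ s.shared x, u j = 0) → m u = 0 := by
    rintro u ⟨j, -, hj⟩
    exact minCoord_eq_zero _ ⟨j, Finset.mem_univ j, hj⟩
  have hr : ∀ z, g₁ z ∈ s.stage (s.rank x) ∨ ∃ u, g₁ z = χ x u := fun z =>
    (hg₁ z).imp id fun ⟨u, hu, _⟩ => ⟨u, hu⟩
  obtain ⟨μ, hμ, hμ0, hμu⟩ := s.exists_glue x g₁.continuous hr
    (ψ := fun _ : K => (0 : ℝ)) continuous_const (φ := fun q => m q.2) (hm.comp continuous_snd)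
    (fun z u _ hu => hbd u hu)
  have hμc : ∀ z, μ z < c := by
    intro z
    rcases hg₁ z with hz | ⟨u, hu, hlt⟩
    · rw [hμ0 z hz]; exact hc0
    · rw [hμu z u hu]; exact hlt
  -- Compactness keeps the image uniformly away from the barycentre. This allows the denominator `c
  -- - m u` of the projection to be truncated at `c - b`, so that the deformation is continuous on
  -- the whole simplex and unchanged on the image.
  obtain ⟨b, hb, hbc⟩ : ∃ b, (∀ z, μ z ≤ b) ∧ b < c := by
    rcases isEmpty_or_nonempty K with hKe | hKne
    · exact ⟨0, fun z => isEmptyElim z, hc0⟩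
    · obtain ⟨z, -, hz⟩ := isCompact_univ.exists_isMaxOn univ_nonempty hμ.continuousOn
      exact ⟨μ z, fun w => hz (mem_univ w), hμc z⟩
  let f : stdSimplex ℝ (Fin (d + 2)) → ℝ := fun u => m u / max (c - m u) (c - b)
  have hden : ∀ u, 0 < max (c - m u) (c - b) := fun u => lt_max_of_lt_right (by linarith)
  have hf : Continuous f :=
    hm.div ((continuous_const.sub hm).max continuous_const) fun u => (hden u).ne'
  have hf0 : ∀ u, 0 ≤ f u := fun u => div_nonneg (hm0 u) (hden u).le
  have hfm : ∀ u, f u * (c - m u) ≤ m u := by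
    intro u
    have : f u * max (c - m u) (c - b) = m u := div_mul_cancel₀ _ (hden u).ne'
    calc f u * (c - m u) ≤ f u * max (c - m u) (c - b) :=
          mul_le_mul_of_nonneg_left (le_max_left _ _) (hf0 u)
      _ = m u := this
  have hr' : ∀ z, g₁ z ∈ s.stage (s.rank x + 1) := by
    intro z
    rcases hr z with hz | ⟨u, hu⟩
    · exact s.stage_mono (Nat.le_succ _) hz
    · exact ⟨x, u, Nat.lt_succ_self _, hu⟩
  obtain ⟨g', hgg', h1, h2⟩ := s.exists_homotopic x g₁ hr'
    (fun q u => ⟨fun j => u j + q.2 * f u * (u j - c), fun j => by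
      have h1 := hfm u
      have h2 := hmle u j
      have h3 := hf0 u
      have h4 := q.2.2.1
      have h5 := q.2.2.2
      have h6 := hmc u
      have h7 : (q.2 : ℝ) * (f u * (c - m u)) ≤ f u * (c - m u) :=
        mul_le_of_le_one_left (mul_nonneg h3 (by linarith)) h5
      have h8 : (q.2 : ℝ) * f u * (m u - c) ≤ q.2 * f u * (u j - c) :=
        mul_le_mul_of_nonneg_left (by linarith) (mul_nonneg h4 h3)
      simp only
      nlinarith, by
      have : ∑ j, (u j - c) = 0 := by
        rw [Finset.sum_sub_distrib, stdSimplex.sum_eq_one, hc, Finset.sum_const, Finset.card_univ,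
          Fintype.card_fin, nsmul_eq_mul, mul_one_div_cancel (by positivity), sub_self]
      rw [Finset.sum_add_distrib, ← Finset.mul_sum, stdSimplex.sum_eq_one, this]
      ring⟩)
    (by
      apply Continuous.subtype_mk
      apply continuous_pi
      intro j
      have h1 := (continuous_coord j).comp
        (continuous_snd : Continuous fun q : (K × unitInterval) × stdSimplex ℝ (Fin (d + 2)) => q.2)
      have h2 := hf.comp
        (continuous_snd : Continuous fun q : (K × unitInterval) × stdSimplex ℝ (Fin (d + 2)) => q.2)
      simp only [Function.comp_def] at h1 h2
      fun_prop)
    (by intro z u; ext j; simp [DFunLike.coe])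
    (by
      intro q u hu
      ext j
      simp [DFunLike.coe, f, hbd u hu])
  refine ⟨g', hgg₁.trans hgg', fun z => ?_⟩
  rcases hr z with hz | ⟨u, hu⟩
  · rw [h1 z hz]; exact hz
  · rw [h2 z u hu, s.mem_stage_iff]
    obtain ⟨j, -, hj⟩ := exists_minCoord_eq Finset.univ_nonempty u
    refine ⟨j, by rw [hx]; exact Finset.mem_univ j, ?_⟩
    change u j + ((1 : unitInterval) : ℝ) * f u * (u j - c) = 0
    have h3 : m u ≤ b := by
      have := hb z
      rwa [hμu z u hu] at this
    have h4 : f u = m u / (c - m u) := by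
      simp only [f]
      rw [max_eq_left (by linarith)]
    have h5 : u j = m u := hj.symm
    have h6 : c - m u ≠ 0 := by
      have : 0 < c - m u := by linarith
      exact this.ne'
    rw [h4, h5, Set.Icc.coe_one]
    field_simp
    ring

/-- A compact space in general position maps trivially to a space with a shelling. -/
theorem nullhomotopic [CompactSpace K] [Nonempty K] (s : Shelling χ)
    (hK : GeneralPosition K (d + 1)) (g : C(K, X)) : g.Nullhomotopic := by
  obtain ⟨k, hk⟩ := s.exists_subset_stage (isCompact_range g.continuous)
  have hk' : ∀ z, g z ∈ s.stage k := fun z => hk (mem_range_self z)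
  clear hk
  induction k generalizing g with
  | zero =>
    obtain ⟨x, u, hx, -⟩ := hk' (Classical.arbitrary K)
    omega
  | succ k ih =>
    by_cases h : ∃ x, s.rank x = k
    · obtain ⟨x, rfl⟩ := h
      rcases Finset.eq_empty_or_nonempty (s.shared x) with hx | hx
      · exact s.nullhomotopic_of_shared_eq_empty x hx g hk'
      obtain ⟨g', hgg', hg'⟩ : ∃ g' : C(K, X), g.Homotopic g' ∧ ∀ z, g' z ∈ s.stage (s.rank x) := by
        by_cases hx' : s.shared x = Finset.univ
        · exact s.exists_homotopic_stage_of_eq_univ hK x hx' g hk'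
        · refine s.exists_homotopic_stage_of_ne_univ x hx ?_ g hk'
          by_contra hcon
          push Not at hcon
          exact hx' (Finset.eq_univ_iff_forall.2 hcon)
      obtain ⟨y, hy⟩ := ih g' hg'
      exact ⟨y, hgg'.trans hy⟩
    · refine ih g fun z => ?_
      obtain ⟨x, u, hx, hu⟩ := hk' z
      refine ⟨x, u, ?_, hu⟩
      have : s.rank x ≠ k := fun h' => h ⟨x, h'⟩
      omega

end Shelling

end

section

open Set Topology unitInterval

/-! ### Maps defined on the boundary of a cube -/

namespace Cube

variable {N : Type*}

theorem isClosed_boundary [Finite N] : IsClosed (Cube.boundary N) := by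
  have h : Cube.boundary N = ⋃ i : N, {y | y i = 0} ∪ {y | y i = 1} := by
    ext y
    simp [Cube.boundary]
  rw [h]
  exact isClosed_iUnion_of_finite fun i =>
    (isClosed_eq (continuous_apply i) continuous_const).union
      (isClosed_eq (continuous_apply i) continuous_const)

instance [Finite N] : CompactSpace (Cube.boundary N) :=
  isCompact_iff_compactSpace.1 isClosed_boundary.isCompact

instance [Nonempty N] : Nonempty (Cube.boundary N) :=
  ⟨⟨fun _ => 0, Classical.arbitrary N, Or.inl rfl⟩⟩

/-- The inclusion of the boundary of the cube into the vector space spanned by it. -/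
def boundaryCoe (y : Cube.boundary N) (k : N) : ℝ := y.1 k

theorem continuous_boundaryCoe : Continuous (boundaryCoe (N := N)) :=
  continuous_pi fun k =>
    continuous_subtype_val.comp ((continuous_apply k).comp continuous_subtype_val)

theorem injective_boundaryCoe : Function.Injective (boundaryCoe (N := N)) := fun _ _ h =>
  Subtype.ext (funext fun k => Subtype.ext (congrFun h k))

/-- The boundary is a finite union of `i`-dimensional faces. After a Tietze extension and a `C¹`
approximation, the image of each face has Hausdorff dimension at most `i < d`, so an arbitrarily
small translation moves the whole image off the origin. -/
theorem generalPosition_boundary {i d : ℕ} (h : i < d) :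
    GeneralPosition (Cube.boundary (Fin (i + 1))) d := by
  intro F ε hε
  obtain ⟨G, hG⟩ := ContinuousMap.exists_extension
    (continuous_boundaryCoe.isClosedEmbedding (injective_boundaryCoe (N := Fin (i + 1)))) F
  obtain ⟨g, hg, hgG, -⟩ := G.continuous.exists_contDiff_approx 1
    (ε := fun _ => ε / 2) continuous_const (fun _ => half_pos hε)
  let B : Set (Fin d → ℝ) := ⋃ p : Fin (i + 1) × Bool,
    range fun y : Fin i → ℝ => g (p.1.insertNth (if p.2 then 0 else 1 : ℝ) y)
  have hB : dimH B < Module.finrank ℝ (Fin d → ℝ) := by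
    rw [dimH_iUnion]
    refine lt_of_le_of_lt (iSup_le fun p => ?_) (b := (i : ENNReal)) ?_
    · have hc : ContDiff ℝ 1 fun y : Fin i → ℝ =>
          g (p.1.insertNth (if p.2 then 0 else 1 : ℝ) y) := by
        refine hg.comp (contDiff_pi.2 fun k => ?_)
        induction k using p.1.succAboveCases with
        | x => simpa using contDiff_const
        | p k => simpa using contDiff_apply ℝ ℝ k
      simpa using hc.dimH_range_le
    · simpa using h
  obtain ⟨v, hv, hv0⟩ := (dense_compl_of_dimH_lt_finrank hB).exists_dist_lt 0 (half_pos hε)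
  refine ⟨⟨fun z => g (boundaryCoe z) - v,
    (hg.continuous.comp continuous_boundaryCoe).sub continuous_const⟩, fun z hz => hv ?_, fun z => ?_⟩
  · obtain ⟨k, hk⟩ := z.2
    refine mem_iUnion.2 ⟨(k, decide (z.1 k = 0)), fun j => z.1 (k.succAbove j), ?_⟩
    have hz' : g (boundaryCoe z) = v := sub_eq_zero.1 hz
    rw [← hz']
    refine congrArg g (funext fun j => ?_)
    induction j using k.succAboveCases with
    | x =>
      rcases hk with hk | hk <;> simp [boundaryCoe, hk]
    | p j => simp [boundaryCoe]
  · have h1 : G (boundaryCoe z) = F z := DFunLike.congr_fun hG z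
    have h2 := hgG (boundaryCoe z)
    rw [h1, dist_eq_norm] at h2
    rw [dist_zero_left] at hv0
    calc ‖g (boundaryCoe z) - v - F z‖ = ‖(g (boundaryCoe z) - F z) - v‖ := by congr 1; abel
      _ ≤ ‖g (boundaryCoe z) - F z‖ + ‖v‖ := norm_sub_le _ _
      _ < ε := by linarith

/-- The point at distance `t` on the segment from `y` to the centre of the cube. -/
noncomputable def shrink (p : Cube.boundary N × I) (k : N) : I :=
  ⟨(1 - p.2) * p.1.1 k + p.2 * (1 / 2), by
    have h1 := p.2.2
    have h2 := (p.1.1 k).2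
    rw [mem_Icc] at *
    constructor <;> nlinarith⟩

theorem continuous_shrink : Continuous (shrink (N := N)) := by
  refine continuous_pi fun k => Continuous.subtype_mk ?_ _
  have h1 : Continuous fun p : Cube.boundary N × I => ((p.2 : I) : ℝ) :=
    continuous_subtype_val.comp continuous_snd
  have h2 : Continuous fun p : Cube.boundary N × I => ((p.1.1 k : I) : ℝ) :=
    continuous_subtype_val.comp ((continuous_apply k).comp
      (continuous_subtype_val.comp continuous_fst))
  fun_prop

theorem abs_shrink_sub_half (p : Cube.boundary N × I) (k : N) :
    |(shrink p k : ℝ) - 1 / 2| = (1 - p.2) * |(p.1.1 k : ℝ) - 1 / 2| := by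
  have h : (shrink p k : ℝ) - 1 / 2 = (1 - p.2) * ((p.1.1 k : ℝ) - 1 / 2) := by
    simp only [shrink]
    ring
  rw [h, abs_mul, abs_of_nonneg (sub_nonneg.2 p.2.2.2)]

theorem abs_sub_half_le (a : I) : |(a : ℝ) - 1 / 2| ≤ 1 / 2 := by
  have := a.2
  rw [mem_Icc] at this
  rw [abs_le]
  constructor <;> linarith

theorem abs_sub_half_eq {a : I} (h : a = 0 ∨ a = 1) : |(a : ℝ) - 1 / 2| = 1 / 2 := by
  rcases h with rfl | rfl
  · norm_num
  · norm_num

theorem snd_le_of_shrink_eq {p q : Cube.boundary N × I} (h : shrink p = shrink q) : q.2 ≤ p.2 := by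
  obtain ⟨k, hk⟩ := p.1.2
  have h1 := abs_shrink_sub_half p k
  rw [h, abs_shrink_sub_half q k, abs_sub_half_eq hk] at h1
  have h2 := abs_sub_half_le (q.1.1 k)
  have h3 := q.2.2.2
  change (q.2 : ℝ) ≤ p.2
  nlinarith

theorem eq_of_shrink_eq {p q : Cube.boundary N × I} (h : shrink p = shrink q) :
    p.2 = q.2 ∧ (p.2 = 1 ∨ p.1 = q.1) := by
  have h1 : p.2 = q.2 := le_antisymm (snd_le_of_shrink_eq h.symm) (snd_le_of_shrink_eq h)
  refine ⟨h1, or_iff_not_imp_left.2 fun h2 => Subtype.ext (funext fun k => Subtype.ext ?_)⟩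
  have h3 := congrArg (fun y : N → I => ((y k : I) : ℝ)) h
  simp only [shrink, ← h1] at h3
  have h4 : (1 - (p.2 : ℝ)) ≠ 0 := fun h0 => h2 (Subtype.ext (sub_eq_zero.1 h0).symm)
  exact mul_left_cancel₀ h4 (by linarith)

theorem surjective_shrink [Finite N] [Nonempty N] : Function.Surjective (shrink (N := N)) := by
  intro y
  obtain ⟨k, hk⟩ := Finite.exists_max fun k => |(y k : ℝ) - 1 / 2|
  -- Twice the distance to the centre in the maximum norm; dividing by it moves `y` radially to the
  -- boundary, and the centre needs its own case.
  set r : ℝ := 2 * |(y k : ℝ) - 1 / 2| with hr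
  have hr0 : 0 ≤ r := by positivity
  have hr1 : r ≤ 1 := by have := abs_sub_half_le (y k); linarith
  rcases hr0.eq_or_lt with h0 | h0
  · refine ⟨(Classical.arbitrary _, 1), funext fun j => Subtype.ext ?_⟩
    have h1 := hk j
    have h2 : |(y j : ℝ) - 1 / 2| = 0 := le_antisymm (by linarith) (abs_nonneg _)
    rw [abs_eq_zero] at h2
    simp only [shrink, Set.Icc.coe_one]
    linarith
  · have hb : ∀ j, |((y j : ℝ) - 1 / 2) / r| ≤ 1 / 2 := fun j => by
      rw [abs_div, abs_of_pos h0, div_le_iff₀ h0]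
      have := hk j
      linarith
    have hI : ∀ j, 1 / 2 + ((y j : ℝ) - 1 / 2) / r ∈ Icc (0 : ℝ) 1 := fun j => by
      have := abs_le.1 (hb j)
      constructor <;> linarith
    refine ⟨(⟨fun j => ⟨_, hI j⟩, k, ?_⟩, ⟨1 - r, by constructor <;> linarith⟩),
      funext fun j => Subtype.ext ?_⟩
    · rcases abs_cases ((y k : ℝ) - 1 / 2) with ⟨h1, -⟩ | ⟨h1, -⟩
      · right
        apply Subtype.ext
        have h2 : (y k : ℝ) - 1 / 2 = 1 / 2 * r := by rw [← h1]; rw [hr]; ring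
        change 1 / 2 + ((y k : ℝ) - 1 / 2) / r = 1
        rw [h2, mul_div_cancel_right₀ _ h0.ne']
        norm_num
      · left
        apply Subtype.ext
        have h2 : (y k : ℝ) - 1 / 2 = -(1 / 2) * r := by
          rw [hr, h1]
          ring
        change 1 / 2 + ((y k : ℝ) - 1 / 2) / r = 0
        rw [h2, mul_div_cancel_right₀ _ h0.ne']
        norm_num
    · simp only [shrink]
      field_simp
      ring

/-- A null-homotopic map on the boundary of the cube extends to the cube. -/
theorem exists_extension_of_nullhomotopic [Finite N] [Nonempty N] {X : Type*} [TopologicalSpace X]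
    {f : C(Cube.boundary N, X)} (h : f.Nullhomotopic) :
    ∃ G : C(N → I, X), ∀ y : Cube.boundary N, G y = f y := by
  obtain ⟨c, ⟨H⟩⟩ := h
  -- The cube is the cone over its boundary: `shrink` identifies only points at parameter `1`, where
  -- the null-homotopy is constant.
  have hq : IsQuotientMap (⟨shrink, continuous_shrink⟩ : C(Cube.boundary N × I, N → I)) :=
    continuous_shrink.isClosedMap.isQuotientMap continuous_shrink surjective_shrink
  let H' : C(Cube.boundary N × I, X) := ⟨fun p => H (p.2, p.1), by fun_prop⟩
  have hH' : Function.FactorsThrough H'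
      (⟨shrink, continuous_shrink⟩ : C(Cube.boundary N × I, N → I)) := by
    rintro ⟨p1, p2⟩ ⟨q1, q2⟩ hpq
    obtain ⟨h1, h2⟩ := eq_of_shrink_eq hpq
    dsimp only at h1 h2
    subst h1
    rcases h2 with rfl | rfl
    · exact (H.apply_one p1).trans (H.apply_one q1).symm
    · rfl
  refine ⟨hq.lift H' hH', fun y => ?_⟩
  have h1 : shrink (y, 0) = y.1 := funext fun k => Subtype.ext (by simp [shrink])
  have h2 := DFunLike.congr_fun (hq.lift_comp H' hH') (y, 0)
  rw [ContinuousMap.comp_apply] at h2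
  change _ = H (0, y) at h2
  rw [H.apply_zero] at h2
  rw [← h2]
  exact congrArg _ h1.symm

end Cube

/-- If all maps from the boundary of the `(i + 1)`-cube are null-homotopic, then `πᵢ` vanishes. -/
theorem subsingleton_homotopyGroup {X : Type*} [TopologicalSpace X] {i : ℕ}
    (h : ∀ f : C(Cube.boundary (Fin (i + 1)), X), f.Nullhomotopic) (x : X) :
    Subsingleton (HomotopyGroup.Pi i X x) := by
  classical
  suffices H : ∀ f : GenLoop (Fin i) X x, GenLoop.Homotopic f GenLoop.const by
    refine ⟨fun a b => ?_⟩
    induction a using Quotient.inductionOn with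
    | h a =>
      induction b using Quotient.inductionOn with
      | h b => exact Quotient.sound ((H a).trans (H b).symm)
  intro f
  -- The loop is put on the face `y 0 = 0` and the base point on the rest of the boundary. An
  -- extension to the cube, with `y 0` as time, is a homotopy to the constant loop relative to the
  -- boundary.
  let b : Cube.boundary (Fin (i + 1)) → X := fun y =>
    if y.1 0 = 0 then f (Fin.tail y.1) else x
  have hzero : IsClosed {y : Cube.boundary (Fin (i + 1)) | y.1 0 = 0} :=
    isClosed_eq ((continuous_apply 0).comp continuous_subtype_val) continuous_const
  have htail : Continuous fun y : Cube.boundary (Fin (i + 1)) => (Fin.tail y.1 : Fin i → I) :=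
    continuous_pi fun k => (continuous_apply k.succ).comp continuous_subtype_val
  have hb : Continuous b := by
    refine Continuous.if (fun y hy => ?_) (f.1.continuous.comp htail) continuous_const
    have h0 : y.1 0 = 0 := hzero.frontier_subset hy
    have hc : IsClosed {y : Cube.boundary (Fin (i + 1)) |
        y.1 0 = 1 ∨ Fin.tail y.1 ∈ Cube.boundary (Fin i)} :=
      (isClosed_eq ((continuous_apply 0).comp continuous_subtype_val) continuous_const).union
        (Cube.isClosed_boundary.preimage htail)
    have hy' : y ∈ closure {y : Cube.boundary (Fin (i + 1)) | y.1 0 = 0}ᶜ :=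
      (frontier_eq_closure_inter_closure.subset hy).2
    have hsub : {y : Cube.boundary (Fin (i + 1)) | y.1 0 = 0}ᶜ ⊆
        {y | y.1 0 = 1 ∨ Fin.tail y.1 ∈ Cube.boundary (Fin i)} := fun z hz => by
      obtain ⟨k, hk⟩ := z.2
      induction k using Fin.cases with
      | zero => exact Or.inl (hk.resolve_left hz)
      | succ k => exact Or.inr ⟨k, hk⟩
    rcases closure_minimal hsub hc hy' with h1 | h1
    · exact absurd (h0.symm.trans h1) zero_ne_one
    · exact f.2 _ h1
  obtain ⟨G, hG⟩ := Cube.exists_extension_of_nullhomotopic (h ⟨b, hb⟩)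
  have hcons : Continuous fun p : I × (Fin i → I) => (Fin.cons p.1 p.2 : Fin (i + 1) → I) := by
    refine continuous_pi fun k => ?_
    induction k using Fin.cases with
    | zero => exact continuous_fst
    | succ k => exact (continuous_apply k).comp continuous_snd
  have hval : ∀ (t : I) (y : Fin i → I) (hm : (Fin.cons t y : Fin (i + 1) → I) ∈ Cube.boundary _),
      G (Fin.cons t y) = if t = 0 then f y else x := fun t y hm => by
    rw [hG ⟨_, hm⟩]
    simp [b]
  refine ⟨⟨⟨⟨fun p => G (Fin.cons p.1 p.2), G.continuous.comp hcons⟩, fun y => ?_, fun y => ?_⟩,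
    fun t y hy => ?_⟩⟩
  · exact (hval 0 y ⟨0, Or.inl rfl⟩).trans (if_pos rfl)
  · exact (hval 1 y ⟨0, Or.inr rfl⟩).trans (if_neg one_ne_zero)
  · have hm : (Fin.cons t y : Fin (i + 1) → I) ∈ Cube.boundary _ := by
      obtain ⟨k, hk⟩ := hy
      exact ⟨k.succ, hk⟩
    have h1 := f.2 y hy
    change G (Fin.cons t y) = f.1 y
    rw [hval t y hm, h1]
    split_ifs
    · exact h1
    · rfl

end

section

open Set Topology

/-! ### The shelling of the coset complex -/

/-- Ties are broken by a well-ordering and the rank counts predecessors; finiteness of the sublevel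
sets makes the count finite. -/
theorem exists_injective_rank {I : Type*} (f : I → ℕ) (hf : ∀ k, {x | f x ≤ k}.Finite) :
    ∃ r : I → ℕ, Function.Injective r ∧ ∀ x y, f x < f y → r x < r y := by
  let lt : I → I → Prop := fun x y => f x < f y ∨ f x = f y ∧ WellOrderingRel x y
  have htrans : ∀ {x y z}, lt x y → lt y z → lt x z := by
    rintro x y z (h | ⟨h, h'⟩) (k | ⟨k, k'⟩)
    · exact Or.inl (h.trans k)
    · exact Or.inl (k ▸ h)
    · exact Or.inl (h ▸ k)
    · exact Or.inr ⟨h.trans k, _root_.trans h' k'⟩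
  have hirrefl : ∀ x, ¬ lt x x := by
    rintro x (h | ⟨-, h⟩)
    · exact lt_irrefl _ h
    · exact irrefl x h
  have hmono : ∀ x y, lt x y → {z | lt z x}.ncard < {z | lt z y}.ncard := fun x y h => by
    refine ncard_lt_ncard ⟨fun z hz => htrans hz h, fun hsub => hirrefl x (hsub h)⟩ ?_
    exact (hf (f y)).subset fun z hz => hz.elim le_of_lt fun hz => hz.1.le
  refine ⟨fun x => {z | lt z x}.ncard, fun x y h => ?_, fun x y h => hmono x y (Or.inl h)⟩
  have h1 : ¬ lt x y := fun k => (hmono x y k).ne h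
  have h2 : ¬ lt y x := fun k => (hmono y x k).ne h.symm
  have h3 : f x = f y := by
    by_contra hne
    rcases lt_or_gt_of_ne hne with k | k
    · exact h1 (Or.inl k)
    · exact h2 (Or.inl k)
  rcases trichotomous_of WellOrderingRel x y with k | k | k
  · exact absurd (Or.inr ⟨h3, k⟩) h1
  · exact k
  · exact absurd (Or.inr ⟨h3.symm, k⟩) h2

theorem ArtinMonoid.len_mk {B : Type*} {M : CoxeterMatrix B} (w : FreeMonoid B) :
    len (PresentedMonoid.mk (ArtinRel M) w) = w.length := by
  induction w using FreeMonoid.inductionOn' with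
  | one => exact len_one
  | of_mul s w ih =>
    rw [map_mul, len_mul, ih, FreeMonoid.length_mul, FreeMonoid.length_of]
    rfl

theorem ArtinMonoid.finite_len_le {B : Type*} [Finite B] (M : CoxeterMatrix B) (k : ℕ) :
    {g : ArtinMonoid M | len g ≤ k}.Finite := by
  refine ((List.finite_length_le B k).image fun l =>
    PresentedMonoid.mk (ArtinRel M) (FreeMonoid.ofList l)).subset fun g hg => ?_
  obtain ⟨w, rfl⟩ := PresentedMonoid.surjective_mk g
  exact ⟨w.toList, (len_mk w).symm.trans_le hg, rfl⟩

namespace TowerMonoid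

open ArtinMonoid SemiSimplicialSet

variable {S : Type*} {M : CoxeterMatrix (Option S)} {d : ℕ}

theorem simplex_eq_face_zero {n p : ℕ} (hp : p + 1 < n) (g : TowerMonoid M n) :
    simplex M (by omega : p < n) g = (cosetComplex M n).face p 0 (simplex M hp g) := by
  rw [face_simplex, Fin.val_zero, descend, mul_one]

theorem exists_noEnd_simplex_eq (g : TowerMonoid M (d + 1)) :
    ∃ r, NoEnd (lowGens S (d + 1) 0) r ∧ len r ≤ len g ∧
      simplex M d.lt_add_one g = simplex M d.lt_add_one r := by
  obtain ⟨r, b, hr, hb, rfl⟩ := exists_noEnd_mul (lowGens S (d + 1) 0) g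
  refine ⟨r, hr, by rw [len_mul]; omega, simplex_eq_of_cosetRel _ ?_⟩
  rw [show d + 1 - d - 1 = 0 by omega, parabolic_eq_standard]
  exact ⟨1, one_mem _, b, hb, mul_one _⟩

/-- The face map with index `0` multiplies by the empty product, so `[g]` is a face of the simplex
with the same representative one dimension higher. -/
theorem exists_eq_cell_top (z : (cosetComplex M (d + 1)).Realisation) :
    ∃ g u, z = cell (simplex M d.lt_add_one g) u := by
  obtain ⟨p, x, u, rfl⟩ := exists_eq_cell z
  obtain ⟨hp, g, rfl⟩ := exists_eq_simplex x
  induction hk : d - p generalizing p with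
  | zero =>
    obtain rfl : p = d := by omega
    exact ⟨g, u, rfl⟩
  | succ k ih =>
    have hp' : p + 1 < d + 1 := by omega
    rw [simplex_eq_face_zero hp', ← cell_map_succAbove]
    exact ih (p + 1) _ hp' (by omega)

theorem isClosed_of_top {C : Set (cosetComplex M (d + 1)).Realisation}
    (h : ∀ g, IsClosed (cell (simplex M d.lt_add_one g) ⁻¹' C)) : IsClosed C := by
  refine (isClosed_realisation_iff C).2 fun p x => ?_
  obtain ⟨hp, g, rfl⟩ := exists_eq_simplex x
  induction hk : d - p generalizing p with
  | zero =>
    obtain rfl : p = d := by omega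
    exact h g
  | succ k ih =>
    have hp' : p + 1 < d + 1 := by omega
    have hcl := ih (p + 1) hp' (by omega)
    have he : cell (simplex M hp g) ⁻¹' C =
        stdSimplex.map (0 : Fin (p + 2)).succAbove ⁻¹' (cell (simplex M hp' g) ⁻¹' C) := by
      ext u
      rw [mem_preimage, mem_preimage, mem_preimage, simplex_eq_face_zero hp',
        cell_map_succAbove]
    rw [he]
    exact hcl.preimage (isClosedEmbedding_map_succAbove _).continuous

/-- The top-dimensional simplices, indexed by their shortest representatives. -/
abbrev Facets (M : CoxeterMatrix (Option S)) (n : ℕ) : Type _ :=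
  {g : TowerMonoid M n // NoEnd (lowGens S n 0) g}

theorem exists_glue_facet (g : Facets M (d + 2)) (j : Fin (d + 2)) (hj : ¬ IsFree g.1 (j + 1)) :
    ∃ (g' : Facets M (d + 2)) (j' : Fin (d + 2)), len g'.1 < len g.1 ∧
      ∀ v, cell (simplex M (d + 1).lt_add_one g.1) (stdSimplex.map j.succAbove v) =
        cell (simplex M (d + 1).lt_add_one g'.1) (stdSimplex.map j'.succAbove v) := by
  obtain ⟨g', hlt, c', h1, h2, hc⟩ := exists_shorter_facet (by omega) (by omega) hj
  obtain ⟨r, hr, hle, he⟩ := exists_noEnd_simplex_eq (d := d + 1) g'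
  refine ⟨⟨r, hr⟩, ⟨c' - 1, by omega⟩, by simpa using lt_of_le_of_lt hle hlt, fun v => ?_⟩
  rw [cell_map_succAbove, ← he, cell_map_succAbove, face_simplex, face_simplex]
  congr 1
  apply simplex_eq_of_cosetRel
  rw [show d + 2 - d - 1 = 1 by omega, show d + 1 + 1 - (d + 1) = 1 by omega]
  exact hc

theorem exists_shelling [Finite S] (M : CoxeterMatrix (Option S)) (d : ℕ) :
    Nonempty (Shelling fun g : Facets M (d + 2) => cell (simplex M (d + 1).lt_add_one g.1)) := by
  classical
  obtain ⟨r, hr, hmono⟩ := exists_injective_rank (fun g : Facets M (d + 2) => len g.1) fun k =>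
    (finite_len_le (towerMatrix M (d + 2)) k).preimage Subtype.val_injective.injOn
  refine ⟨{
    rank := r
    rank_injective := hr
    continuous := fun g => continuous_cell _
    surjective := fun z => ?_
    isClosed := fun C hC => isClosed_of_top fun g => ?_
    shared := fun g => Finset.univ.filter fun j => ¬ IsFree g.1 (j + 1)
    glue := fun g j hj => ?_
    unique := fun g g' u u' hu hu' h => ?_
    first := fun g hg g' => ?_ }⟩
  · obtain ⟨g, u, rfl⟩ := exists_eq_cell_top z
    obtain ⟨r, hr, -, he⟩ := exists_noEnd_simplex_eq g
    exact ⟨⟨r, hr⟩, u, by rw [he]⟩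
  · obtain ⟨r, hr, -, he⟩ := exists_noEnd_simplex_eq g
    rw [he]
    exact hC ⟨r, hr⟩
  · obtain ⟨g', j', hlt, h⟩ := exists_glue_facet g j (by simpa using hj)
    exact ⟨g', j', hmono _ _ hlt, h⟩
  · have key : ∀ {g : Facets M (d + 2)} {u : stdSimplex ℝ (Fin (d + 2))},
        (∀ j ∈ Finset.univ.filter fun j : Fin (d + 2) => ¬ IsFree g.1 (j + 1), u j ≠ 0) →
          ∀ j, u j = 0 → IsFree g.1 (j + 1) := fun hu j hj => by
      by_contra hfree
      exact hu j (by simpa using hfree) hj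
    obtain ⟨h1, h2⟩ := eq_of_cell_eq g.2 g'.2 (key hu) (key hu') h
    exact ⟨Subtype.ext h1, h2⟩
  -- A simplex with no shared facet is the one of `1`, the unique element of length `0`, so it has
  -- the least rank.
  · have h1 : g.1 = 1 := eq_one_of_isFree g.2 fun c hc hcn => by
      have := Finset.filter_eq_empty_iff.1 hg (Finset.mem_univ (⟨c - 1, by omega⟩ : Fin (d + 2)))
      rw [not_not] at this
      simpa [Nat.sub_add_cancel hc] using this
    by_cases hg' : g'.1 = 1
    · exact (congrArg r (Subtype.ext (h1.trans hg'.symm))).le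
    · refine (hmono _ _ ?_).le
      rw [h1, len_one]
      exact Nat.pos_of_ne_zero fun h0 => hg' (eq_one_of_len_eq_zero h0)

end TowerMonoid

end

theorem theorem8p1 {S : Type*} [Finite S] (M : CoxeterMatrix (Option S)) (n : ℕ) :
    IsKConnected ((n : ℤ) - 2) (cosetComplex M n).Realisation := by
  refine ⟨fun hn => ?_, fun i hi x => ?_⟩
  · have hn' : 0 < n := by omega
    exact ⟨SemiSimplicialSet.cell (TowerMonoid.simplex M hn' 1) (Classical.arbitrary _)⟩
  -- For `n ≤ 1` there is no `i` to consider. Otherwise the top dimension is `d + 1`, and `i ≤ d` is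
  -- what general position needs.
  · obtain ⟨d, rfl⟩ : ∃ d, n = d + 2 := ⟨n - 2, by omega⟩
    obtain ⟨s⟩ := TowerMonoid.exists_shelling M d
    exact subsingleton_homotopyGroup
      (fun f => s.nullhomotopic (Cube.generalPosition_boundary (by omega)) f) x
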